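/- Let $d\ge 1$ and let $\Omega\subset\mathbb R^d$ be a polytopal domain, i.e. a nonempty bounded open set with $\Omega=\operatorname{int}\overline\Omega$ whose boundary lies in finitely many hyperplanes (convexity is not required). Let $\Omega_h$ be a finite mesh of $\Omega$: a finite family of pairwise disjoint, possibly nonconvex, polytopal cells $K\subset\Omega$ (of the same kind as $\Omega$) whose closures cover $\Omega$. Let $\Gamma_s=\Omega\cap\bigcup_{K}\partial K$ be the mesh skeleton, $\nu$ a measurable unit normal field on $\Gamma_s$ (defined almost everywhere), and $\Gamma_D\subset\partial\Omega$ a measurable subset, the Dirichlet boundary. Boundary integrals are taken with respect to the $(d-1)$-dimensional surface (Hausdorff) measure $dS$. Let $$V=\{w\in L^2(\Omega):\ w|_K\in H^1(K)\ \text{ for all } K\in\Omega_h\},\qquad \|w\|_V^2=\|w\|_{L^2(\Omega)}^2+\sum_{K}\|\nabla w\|_{L^2(K)}^2,$$ be the broken Sobolev space and $V^*$ its dual. For $w\in V$ let $w(x\pm 0\,\nu)$ be the one-sided traces of $w$ at $x\in\Gamma_s$, i.e. the limits as $r\to0^+$ of the averages of $w$ over the two half-balls of radius $r$ about $x$ on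 the sides $\pm\nu(x)$, let $[w](x)=w(x+0\,\nu)-w(x-0\,\nu)$ be the jump, and let the trace of $w$ at $x\in\partial\Omega$ be the limit of the averages of $w$ over $\Omega\cap B_r(x)$. Set $$d(\varphi,v)=\int_{\Gamma_s}[\varphi]\,[v]\,dS+\int_{\Gamma_D}\varphi\,v\,dS,\qquad \varphi,v\in V,$$ $$V^c_0=\{w\in V:\ [w]=0 \text{ a.e. on }\Gamma_s,\ w=0\text{ a.e. on }\Gamma_D\}.$$ Then for every $w\in V$ the one-sided traces exist almost everywhere on $\Gamma_s$ and the trace exists almost everywhere on $\Gamma_D$, with $[w]\in L^2(\Gamma_s)$ and $w|_{\Gamma_D}\in L^2(\Gamma_D)$; the form $d$ induces a linear operator $D:V\to V^*$, $(D\varphi)(v)=d(\varphi,v)$; and $$\ker D=V^c_0 .$$ Moreover, as a subset of $L^2(\Omega)$, $$V^c_0=\{w\in H^1(\Omega):\ w=0 \text{ a.e. on }\Gamma_D\ \text{in the sense of traces}\},$$ the space $H^1_0(\Omega)$ of $H^1$ functions vanishing on the Dirichlet boundary. -/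

import Mathlib

open MeasureTheory Filter Topology Set
open scoped ContDiff ENNReal InnerProductSpace

noncomputable section

namespace BrokenSobolev

/-- The Euclidean space `ℝᵈ`. -/
abbrev Sp (d : ℕ) : Type := EuclideanSpace ℝ (Fin d)

variable {d : ℕ}

/-! ### Polytopal domains and meshes -/

/-- An open polytope, convex or not (a polygon for `d = 2`, a polyhedron for `d = 3`): a nonempty
bounded open set whose boundary lies in finitely many hyperplanes, and which lies on one side only
of its boundary (no slits, no missing points). It need be neither convex nor simply connected. -/
structure IsPolytope (K : Set (Sp d)) : Prop where
  isOpen : IsOpen K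
  nonempty : K.Nonempty
  isBounded : Bornology.IsBounded K
  interior_closure : interior (closure K) = K
  frontier_subset : ∃ H : Finset (Sp d × ℝ), (∀ h ∈ H, h.1 ≠ 0) ∧
    frontier K ⊆ ⋃ h ∈ H, {x | ⟪h.1, x⟫_ℝ = h.2}

/-- A mesh of `Ω`: non-overlapping open polytopes contained in `Ω` whose closures cover `Ω`. -/
structure Mesh (Ω : Set (Sp d)) (ι : Type*) where
  cell : ι → Set (Sp d)
  isPolytope : ∀ i, IsPolytope (cell i)
  disjoint : Pairwise fun i j => Disjoint (cell i) (cell j)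
  subset : ∀ i, cell i ⊆ Ω
  cover : Ω ⊆ ⋃ i, closure (cell i)

/-- The mesh skeleton: the part inside `Ω` of the boundaries of the cells. -/
def Mesh.skeleton {Ω : Set (Sp d)} {ι : Type*} (T : Mesh Ω ι) : Set (Sp d) :=
  Ω ∩ ⋃ i, frontier (T.cell i)

/-- The surface measure `dS` on a set `S` of dimension `d - 1`: the Hausdorff measure of
dimension `d - 1`, normalised to agree with Lebesgue measure on hyperplanes. -/
def surface (S : Set (Sp d)) : Measure (Sp d) :=
  (Measure.euclideanHausdorffMeasure (d - 1) : Measure (Sp d)).restrict S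

/-- `n` is a unit normal to `S` at `x`: near `x`, the set `S` is the hyperplane through `x`
orthogonal to the unit vector `n`. -/
def IsUnitNormalAt (S : Set (Sp d)) (n x : Sp d) : Prop :=
  ‖n‖ = 1 ∧ ∃ r > 0, S ∩ Metric.ball x r = {y | ⟪n, y - x⟫_ℝ = 0} ∩ Metric.ball x r

/-- A (measurable) choice of a unit normal to `S` at almost every point of `S`. -/
def IsUnitNormalField (S : Set (Sp d)) (ν : Sp d → Sp d) : Prop :=
  Measurable ν ∧ ∀ᵐ x ∂surface S, IsUnitNormalAt S (ν x) x

/-! ### Weak gradients, `H¹` and the broken space -/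

/-- `g ∈ L²(K)` is the weak gradient of `u` on the open set `K`. -/
def IsWeakGradient (K : Set (Sp d)) (u : Sp d → ℝ) (g : Sp d → Sp d) : Prop :=
  MemLp g 2 (volume.restrict K) ∧
  ∀ φ : Sp d → ℝ, ContDiff ℝ ∞ φ → HasCompactSupport φ → tsupport φ ⊆ K → ∀ e : Sp d,
    ∫ x in K, u x * fderiv ℝ φ x e = - ∫ x in K, ⟪g x, e⟫_ℝ * φ x

/-- `u ∈ H¹(K)`. -/
def MemH1 (K : Set (Sp d)) (u : Sp d → ℝ) : Prop :=
  MemLp u 2 (volume.restrict K) ∧ ∃ g, IsWeakGradient K u g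

open Classical in
/-- The weak gradient of `u` on `K` (unique almost everywhere on `K`). -/
def weakGradient (K : Set (Sp d)) (u : Sp d → ℝ) : Sp d → Sp d :=
  if h : ∃ g, IsWeakGradient K u g then h.choose else 0

theorem memLp_bounded_of_compactSupport {K : Set (Sp d)} {f : Sp d → ℝ}
    (hf : Continuous f) (hc : HasCompactSupport f) : MemLp f 2 (volume.restrict K) :=
  (hf.memLp_of_hasCompactSupport hc).restrict K

theorem continuous_fderiv_apply {φ : Sp d → ℝ} (hφ : ContDiff ℝ ∞ φ) (e : Sp d) :
    Continuous fun x => fderiv ℝ φ x e :=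
  (hφ.continuous_fderiv (by simp)).clm_apply continuous_const

theorem hasCompactSupport_fderiv_apply {φ : Sp d → ℝ} (hc : HasCompactSupport φ) (e : Sp d) :
    HasCompactSupport fun x => fderiv ℝ φ x e :=
  hc.fderiv_apply ℝ e

theorem MemH1.add {K : Set (Sp d)} {u v : Sp d → ℝ} (hu : MemH1 K u) (hv : MemH1 K v) :
    MemH1 K (u + v) := by
  obtain ⟨hu2, g, hg2, hg⟩ := hu
  obtain ⟨hv2, h, hh2, hh⟩ := hv
  refine ⟨hu2.add hv2, g + h, hg2.add hh2, fun φ hφ hc hs e => ?_⟩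
  have hD : MemLp (fun x => fderiv ℝ φ x e) 2 (volume.restrict K) :=
    memLp_bounded_of_compactSupport (continuous_fderiv_apply hφ e)
      (hasCompactSupport_fderiv_apply hc e)
  have hP : MemLp φ 2 (volume.restrict K) := memLp_bounded_of_compactSupport hφ.continuous hc
  have e1 : ∫ x in K, (u + v) x * fderiv ℝ φ x e
      = (∫ x in K, u x * fderiv ℝ φ x e) + ∫ x in K, v x * fderiv ℝ φ x e := by
    refine Eq.trans ?_ (integral_add (hu2.integrable_mul hD) (hv2.integrable_mul hD))
    simp [add_mul]
  have e2 : ∫ x in K, ⟪(g + h) x, e⟫_ℝ * φ x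
      = (∫ x in K, ⟪g x, e⟫_ℝ * φ x) + ∫ x in K, ⟪h x, e⟫_ℝ * φ x := by
    refine Eq.trans ?_ (integral_add ((hg2.inner_const e).integrable_mul hP)
      ((hh2.inner_const e).integrable_mul hP))
    simp [add_mul, inner_add_left]
  rw [e1, e2, hg φ hφ hc hs e, hh φ hφ hc hs e]
  ring

theorem MemH1.const_smul {K : Set (Sp d)} {u : Sp d → ℝ} (c : ℝ) (hu : MemH1 K u) :
    MemH1 K (c • u) := by
  obtain ⟨hu2, g, hg2, hg⟩ := hu
  refine ⟨hu2.const_smul c, c • g, hg2.const_smul c, fun φ hφ hc hs e => ?_⟩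
  have := hg φ hφ hc hs e
  simp only [Pi.smul_apply, smul_eq_mul, inner_smul_left, mul_assoc, integral_const_mul, this]
  simp

theorem MemH1.zero (K : Set (Sp d)) : MemH1 K (0 : Sp d → ℝ) :=
  ⟨MemLp.zero, 0, MemLp.zero, fun φ _ _ _ e => by simp⟩

theorem MemH1.congr_ae {K : Set (Sp d)} {u v : Sp d → ℝ} (hu : MemH1 K u)
    (h : u =ᵐ[volume.restrict K] v) : MemH1 K v := by
  obtain ⟨hu2, g, hg2, hg⟩ := hu
  refine ⟨hu2.ae_eq h, g, hg2, fun φ hφ hc hs e => ?_⟩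
  rw [← hg φ hφ hc hs e]
  refine integral_congr_ae ?_
  filter_upwards [h] with x hx
  rw [hx]

/-- The space `L²(Ω)`. -/
abbrev L2 (Ω : Set (Sp d)) : Type := Lp ℝ 2 (volume.restrict Ω : Measure (Sp d))

variable {Ω : Set (Sp d)} {ι : Type*}

/-- The broken Sobolev space `V` of a mesh: the `w ∈ L²(Ω)` with `w ∈ H¹(K)` for every cell `K`. -/
def brokenH1 (T : Mesh Ω ι) : Submodule ℝ (L2 Ω) where
  carrier := {w | ∀ i, MemH1 (T.cell i) w}
  zero_mem' i := (MemH1.zero _).congr_ae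
    ((Lp.coeFn_zero ℝ 2 _).symm.filter_mono (ae_mono (Measure.restrict_mono_set _ (T.subset i))))
  add_mem' {u v} hu hv i := ((hu i).add (hv i)).congr_ae
    ((Lp.coeFn_add u v).symm.filter_mono (ae_mono (Measure.restrict_mono_set _ (T.subset i))))
  smul_mem' c u hu i := ((hu i).const_smul c).congr_ae
    ((Lp.coeFn_smul c u).symm.filter_mono (ae_mono (Measure.restrict_mono_set _ (T.subset i))))

/-- The broken `H¹` norm. -/
def brokenNorm [Fintype ι] (T : Mesh Ω ι) (w : Sp d → ℝ) : ℝ :=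
  √((∫ x in Ω, w x ^ 2) + ∑ i, ∫ x in T.cell i, ‖weakGradient (T.cell i) w x‖ ^ 2)

/-- The dual space `V*`: the linear functionals on `V` that are bounded in the broken norm. -/
def brokenDual [Fintype ι] (T : Mesh Ω ι) : Submodule ℝ (Module.Dual ℝ (brokenH1 T)) where
  carrier := {l | ∃ C : ℝ, ∀ v : brokenH1 T, |l v| ≤ C * brokenNorm T v}
  zero_mem' := ⟨0, fun v => by simp⟩
  add_mem' := by
    rintro l m ⟨C, hC⟩ ⟨C', hC'⟩
    refine ⟨C + C', fun v => ?_⟩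
    rw [LinearMap.add_apply, add_mul]
    exact (abs_add_le _ _).trans (add_le_add (hC v) (hC' v))
  smul_mem' := by
    rintro c l ⟨C, hC⟩
    refine ⟨|c| * C, fun v => ?_⟩
    rw [LinearMap.smul_apply, smul_eq_mul, abs_mul, mul_assoc]
    exact mul_le_mul_of_nonneg_left (hC v) (abs_nonneg c)

/-! ### Traces and jumps -/

/-- `w` has the trace `a` at the point `x`, seen from the set `S`: the averages of `w` over the
part of small balls around `x` that lies in `S` tend to `a`. Unlike the values of `w` on a line
through `x`, this does not depend on the representative of `w` in `L²`. -/
def HasTraceAt (S : Set (Sp d)) (w : Sp d → ℝ) (x : Sp d) (a : ℝ) : Prop :=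
  Tendsto (fun r : ℝ => ⨍ y in S ∩ Metric.ball x r, w y) (𝓝[>] 0) (𝓝 a)

/-- The trace of `w` at `x` from within `S`. -/
def trace (S : Set (Sp d)) (w : Sp d → ℝ) (x : Sp d) : ℝ :=
  limUnder (𝓝[>] (0 : ℝ)) fun r => ⨍ y in S ∩ Metric.ball x r, w y

/-- The open half-space at `x` into which `n` points. -/
def side (n x : Sp d) : Set (Sp d) := {y | 0 < ⟪n, y - x⟫_ℝ}

/-- The jump `w(x + 0 ν) - w(x - 0 ν)` of `w` at `x` in the direction of the normal `ν`. -/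
def jump (ν : Sp d → Sp d) (w : Sp d → ℝ) (x : Sp d) : ℝ :=
  trace (side (ν x) x) w x - trace (side (-ν x) x) w x

/-- The form `d(φ, v) = ⟨[φ], [v]⟩` over the skeleton `+ ⟨φ, v⟩` over the Dirichlet boundary. -/
def dForm (T : Mesh Ω ι) (ν : Sp d → Sp d) (ΓD : Set (Sp d)) (φ v : Sp d → ℝ) : ℝ :=
  (∫ x, jump ν φ x * jump ν v x ∂surface T.skeleton) +
    ∫ x, trace Ω φ x * trace Ω v x ∂surface ΓD

/-- The admissible test space `V^c_0`: no jump on the skeleton and zero trace on `ΓD`. -/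
def admissible (T : Mesh Ω ι) (ν : Sp d → Sp d) (ΓD : Set (Sp d)) : Set (brokenH1 T) :=
  {w | (∀ᵐ x ∂surface T.skeleton, jump ν w x = 0) ∧ ∀ᵐ x ∂surface ΓD, trace Ω w x = 0}

/-- The Sobolev space of the `w ∈ H¹(Ω)` whose trace vanishes on `ΓD`. -/
def H10 (Ω ΓD : Set (Sp d)) : Set (L2 Ω) :=
  {w | MemH1 Ω w ∧ ∀ᵐ x ∂surface ΓD, trace Ω w x = 0}

end BrokenSobolev

end

open MeasureTheory Filter Topology Set
open scoped ContDiff ENNReal InnerProductSpace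
noncomputable section
namespace BrokenSobolev
variable {d : ℕ}

/-- `j` parametrises the hyperplane `⟪n, x⟫ = c` isometrically, and moving away from it in the
direction `e` gives coordinates on the whole space, with a constant volume factor `κ`. -/
structure IsChart (n e : Sp d) (c : ℝ) (J : Sp (d - 1) →ₗᵢ[ℝ] Sp d) (j : Sp (d - 1) → Sp d)
    (κ : ℝ≥0∞) : Prop where
  apply_eq : ∀ y, j y = c • n + J y
  range_eq : range j = {x | ⟪n, x⟫_ℝ = c}
  range_linear : ∀ x, ⟪n, x⟫_ℝ = 0 → ∃ y, J y = x
  map_eq : Measure.map j volume =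
    (Measure.euclideanHausdorffMeasure (d - 1) : Measure (Sp d)).restrict {x | ⟪n, x⟫_ℝ = c}
  embed : MeasurableEmbedding fun p : Sp (d - 1) × ℝ => j p.1 + p.2 • e
  map_prod_eq : Measure.map (fun p : Sp (d - 1) × ℝ => j p.1 + p.2 • e)
    ((volume : Measure (Sp (d - 1))).prod volume) = κ • volume
  ne_zero : κ ≠ 0
  ne_top : κ ≠ ⊤

theorem IsChart.isometry {n e : Sp d} {c : ℝ} {J : Sp (d - 1) →ₗᵢ[ℝ] Sp d}
    {j : Sp (d - 1) → Sp d} {κ : ℝ≥0∞} (h : IsChart n e c J j κ) : Isometry j := by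
  rw [show j = fun y => c • n + J y from funext h.apply_eq]
  exact (isometry_add_left (c • n)).comp J.isometry

theorem exists_linearIsometry_range (hd : 1 ≤ d) {n : Sp d} (hn : ‖n‖ = 1) :
    ∃ J : Sp (d - 1) →ₗᵢ[ℝ] Sp d, (∀ y, ⟪n, J y⟫_ℝ = 0) ∧ ∀ x, ⟪n, x⟫_ℝ = 0 → ∃ y, J y = x := by
  have hn0 : n ≠ 0 := by rintro rfl; simp at hn
  have : Fact (Module.finrank ℝ (Sp d) = (d - 1) + 1) := ⟨by simp; omega⟩
  let b := OrthonormalBasis.fromOrthogonalSpanSingleton (𝕜 := ℝ) (d - 1) hn0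
  refine ⟨(ℝ ∙ n)ᗮ.subtypeₗᵢ.comp b.repr.symm.toLinearIsometry, fun y => ?_, fun x hx => ?_⟩
  · exact Submodule.mem_orthogonal_singleton_iff_inner_right.1 (b.repr.symm y).2
  · refine ⟨b.repr ⟨x, Submodule.mem_orthogonal_singleton_iff_inner_right.2 hx⟩, ?_⟩
    simp

theorem exists_isChart (hd : 1 ≤ d) {n e : Sp d} (hn : ‖n‖ = 1) (hne : 0 < ⟪n, e⟫_ℝ) (c : ℝ) :
    ∃ J j κ, IsChart n e c J j κ := by
  obtain ⟨J, hJ, hJr⟩ := exists_linearIsometry_range hd hn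
  let j : Sp (d - 1) → Sp d := fun y => c • n + J y
  have hj : Isometry j := (isometry_add_left (c • n)).comp J.isometry
  have hnn : ⟪n, n⟫_ℝ = 1 := by simp [hn]
  have hrange : range j = {x | ⟪n, x⟫_ℝ = c} := by
    ext x
    constructor
    · rintro ⟨y, rfl⟩
      simp [j, inner_add_right, inner_smul_right, hJ, hn]
    · intro hx
      obtain ⟨y, hy⟩ := hJr (x - c • n) (by
        have : ⟪n, x⟫_ℝ = c := hx
        simp [inner_sub_right, inner_smul_right, hn, this])
      exact ⟨y, by simp [j, hy]⟩
  have hmap : Measure.map j volume =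
      (Measure.euclideanHausdorffMeasure (d - 1) : Measure (Sp d)).restrict
        {x | ⟪n, x⟫_ℝ = c} := by
    rw [← hrange, ← hj.map_euclideanHausdorffMeasure,
      EuclideanSpace.euclideanHausdorffMeasure_eq_volume]
  let Lm : (Sp (d - 1) × ℝ) →ₗ[ℝ] Sp d := J.toLinearMap.coprod (LinearMap.toSpanSingleton ℝ _ e)
  have hLm : ∀ p, Lm p = J p.1 + p.2 • e := fun p => by simp [Lm]
  have hinj : Function.Injective Lm := by
    rw [← LinearMap.ker_eq_bot, LinearMap.ker_eq_bot']
    rintro ⟨y, t⟩ h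
    rw [hLm] at h
    have h1 : ⟪n, J y + t • e⟫_ℝ = 0 := by rw [h]; simp
    rw [inner_add_right, hJ, inner_smul_right, zero_add] at h1
    have ht : t = 0 := by
      rcases mul_eq_zero.1 h1 with h | h
      · exact h
      · exact absurd h hne.ne'
    subst ht
    simp only [zero_smul, add_zero] at h
    have : y = 0 := J.injective (by simpa using h)
    simp [this]
  have hfr : Module.finrank ℝ (Sp (d - 1) × ℝ) = Module.finrank ℝ (Sp d) := by simp; omega
  let Le : (Sp (d - 1) × ℝ) ≃L[ℝ] Sp d :=
    (LinearEquiv.ofInjectiveOfFinrankEq Lm hinj hfr).toContinuousLinearEquiv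
  have hLe : ∀ p, Le p = J p.1 + p.2 • e := fun p => hLm p
  have hΨ : (fun p : Sp (d - 1) × ℝ => j p.1 + p.2 • e) = (fun x => c • n + x) ∘ Le := by
    funext p; simp [j, hLe, add_assoc]
  let κ := Measure.addHaarScalarFactor
    (Measure.map Le ((volume : Measure (Sp (d - 1))).prod (volume : Measure ℝ))) volume
  have hmapL : Measure.map Le ((volume : Measure (Sp (d - 1))).prod (volume : Measure ℝ))
      = κ • volume := Measure.isAddLeftInvariant_eq_smul _ _
  refine ⟨J, j, κ, fun _ => rfl, hrange, hJr, hmap, ?_, ?_, ?_, ENNReal.coe_ne_top⟩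
  · rw [hΨ]
    exact (measurableEmbedding_addLeft _).comp Le.toHomeomorph.measurableEmbedding
  · rw [hΨ, ← Measure.map_map (measurable_const_add _) Le.continuous.measurable, hmapL]
    rw [Measure.map_smul, (measurePreserving_add_left volume (c • n)).map_eq]
    rfl
  · intro h0
    have h1 : Measure.map Le ((volume : Measure (Sp (d - 1))).prod (volume : Measure ℝ)) = 0 := by
      rw [hmapL, ENNReal.coe_eq_zero.1 h0, zero_smul]
    rw [Measure.map_eq_zero_iff Le.continuous.measurable.aemeasurable] at h1
    exact NeZero.ne _ h1

namespace IsChart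

variable {n e : Sp d} {c : ℝ} {J : Sp (d - 1) →ₗᵢ[ℝ] Sp d} {j : Sp (d - 1) → Sp d} {κ : ℝ≥0∞}

theorem mem (h : IsChart n e c J j κ) (y : Sp (d - 1)) : ⟪n, j y⟫_ℝ = c := by
  have : j y ∈ range j := ⟨y, rfl⟩
  rwa [h.range_eq] at this

theorem ae_ae (h : IsChart n e c J j κ) {P : Sp d → Prop} (hP : ∀ᵐ z, P z) :
    ∀ᵐ y, ∀ᵐ t : ℝ, P (j y + t • e) := by
  refine Measure.ae_ae_of_ae_prod (p := fun p : Sp (d - 1) × ℝ => P (j p.1 + p.2 • e)) ?_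
  rw [← h.embed.ae_map_iff, h.map_prod_eq]
  exact Measure.ae_smul_measure hP _

theorem ae_hyperplane (h : IsChart n e c J j κ) {Q : Sp d → Prop} :
    (∀ᵐ z ∂(Measure.euclideanHausdorffMeasure (d - 1) : Measure (Sp d)), ⟪n, z⟫_ℝ = c → Q z) ↔
      ∀ᵐ y, Q (j y) := by
  have hm : MeasurableSet {x : Sp d | ⟪n, x⟫_ℝ = c} :=
    (isClosed_eq (by fun_prop) continuous_const).measurableSet
  have : (∀ᵐ z ∂(Measure.euclideanHausdorffMeasure (d - 1) : Measure (Sp d)),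
      z ∈ {x : Sp d | ⟪n, x⟫_ℝ = c} → Q z) ↔ ∀ᵐ y, Q (j y) := by
    rw [← ae_restrict_iff' hm, ← h.map_eq, h.isometry.isClosedEmbedding.measurableEmbedding.ae_map_iff]
  exact this

theorem ae_line (h : IsChart n e c J j κ) {Q : Sp d → Prop} (hQ : ∀ᵐ y, Q (j y)) :
    ∀ᵐ x, ∀ t : ℝ, ⟪n, x + t • e⟫_ℝ = c → Q (x + t • e) := by
  have h1 : ∀ᵐ p ∂((volume : Measure (Sp (d - 1))).prod (volume : Measure ℝ)), Q (j p.1) :=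
    Measure.quasiMeasurePreserving_fst.ae hQ
  have h2 : ∀ᵐ x ∂(κ • volume : Measure (Sp d)),
      ∀ t : ℝ, ⟪n, x + t • e⟫_ℝ = c → Q (x + t • e) := by
    rw [← h.map_prod_eq, h.embed.ae_map_iff]
    filter_upwards [h1] with p hp t ht
    have hy : j p.1 + p.2 • e + t • e = j p.1 + (p.2 + t) • e := by rw [add_smul, add_assoc]
    obtain ⟨y, hy'⟩ : j p.1 + (p.2 + t) • e ∈ range j := by rw [h.range_eq, ← hy]; exact ht
    have : (p.1, p.2 + t) = (y, (0 : ℝ)) := h.embed.injective (by simp [hy'])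
    simp only [Prod.mk.injEq] at this
    rw [hy, this.2, zero_smul, add_zero]
    exact hp
  exact (Measure.ae_ennreal_smul_measure_iff h.ne_zero).1 h2

theorem lintegral_eq (h : IsChart n e c J j κ) {f : Sp d → ℝ≥0∞} (hf : Measurable f) :
    ∫⁻ y, ∫⁻ t : ℝ, f (j y + t • e) = κ * ∫⁻ z, f z := by
  have hm := h.embed.measurable
  rw [← smul_eq_mul, ← lintegral_smul_measure, ← h.map_prod_eq, lintegral_map hf hm]
  exact (lintegral_prod (fun p : Sp (d - 1) × ℝ => f (j p.1 + p.2 • e))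
    (hf.comp hm).aemeasurable).symm

theorem integral_eq (h : IsChart n e c J j κ) {f : Sp d → ℝ} (hf : Integrable f) :
    ∫ y, ∫ t : ℝ, f (j y + t • e) = κ.toReal * ∫ z, f z := by
  have hi : Integrable f (κ • volume) := hf.smul_measure h.ne_top
  rw [← h.map_prod_eq] at hi
  rw [← smul_eq_mul, ← integral_smul_measure, ← h.map_prod_eq, h.embed.integral_map]
  exact (integral_prod (fun p : Sp (d - 1) × ℝ => f (j p.1 + p.2 • e))
    ((h.embed.integrable_map_iff).1 hi)).symm

theorem integrable_prod (h : IsChart n e c J j κ) {f : Sp d → ℝ} (hf : Integrable f) :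
    Integrable (fun p : Sp (d - 1) × ℝ => f (j p.1 + p.2 • e))
      ((volume : Measure (Sp (d - 1))).prod volume) := by
  have hi : Integrable f (κ • volume) := hf.smul_measure h.ne_top
  rw [← h.map_prod_eq] at hi
  exact (h.embed.integrable_map_iff).1 hi

end IsChart

/-- `G` is the weak derivative of `w` in the direction `e` on the open set `K`. -/
def DirDeriv (K : Set (Sp d)) (w G : Sp d → ℝ) (e : Sp d) : Prop :=
  ∀ φ : Sp d → ℝ, ContDiff ℝ ∞ φ → HasCompactSupport φ → tsupport φ ⊆ K →
    ∫ x, w x * fderiv ℝ φ x e = - ∫ x, G x * φ x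

theorem DirDeriv.smul {K : Set (Sp d)} {w G : Sp d → ℝ} {e : Sp d} (h : DirDeriv K w G e)
    (s : ℝ) : DirDeriv K w (fun x => s * G x) (s • e) := by
  intro φ hφ hc hs
  have := h φ hφ hc hs
  simp only [map_smul, smul_eq_mul, mul_assoc, integral_const_mul, mul_left_comm _ s, this]
  ring

/-- Measurable functions that are both integrable and square integrable. -/
structure L1L2 (w : Sp d → ℝ) : Prop where
  measurable : Measurable w
  integrable : Integrable w
  memLp : MemLp w 2

theorem L1L2.const_mul {w : Sp d → ℝ} (h : L1L2 w) (s : ℝ) : L1L2 fun x => s * w x :=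
  ⟨h.measurable.const_mul s, h.integrable.const_mul s, h.memLp.const_mul s⟩

theorem isOpen_segment_subset {K : Set (Sp d)} (hK : IsOpen K) (e : Sp d) :
    IsOpen {p : Sp d × ℝ | ∀ r ∈ Icc (0 : ℝ) 1, p.1 + (r * p.2) • e ∈ K} := by
  rw [isOpen_iff_mem_nhds]
  intro p hp
  refine isCompact_Icc.eventually_forall_of_forall_eventually fun r hr => ?_
  have hc : Continuous fun z : (Sp d × ℝ) × ℝ => z.1.1 + (z.2 * z.1.2) • e := by fun_prop
  exact hc.continuousAt.eventually (hK.mem_nhds (hp r hr))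

theorem integrable_translate {H : Sp d → ℝ} (hm : Measurable H) (hi : Integrable H) (e : Sp d)
    (ρ : Measure ℝ) [IsFiniteMeasure ρ] :
    Integrable (fun p : Sp d × ℝ => H (p.1 + p.2 • e)) (volume.prod ρ) := by
  have hmm : Measurable fun p : Sp d × ℝ => H (p.1 + p.2 • e) := hm.comp (by fun_prop)
  rw [integrable_prod_iff' hmm.aestronglyMeasurable]
  refine ⟨Eventually.of_forall fun r => hi.comp_add_right (r • e), ?_⟩
  have : (fun r : ℝ => ∫ x, ‖H (x + r • e)‖) = fun _ => ∫ x, ‖H x‖ := by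
    funext r
    exact integral_add_right_eq_self (fun x => ‖H x‖) (r • e)
  simp only [this]
  exact integrable_const _

theorem integral_fderiv_segment {φ : Sp d → ℝ} (hφ : ContDiff ℝ ∞ φ) (x e : Sp d) :
    ∫ r in (0 : ℝ)..1, fderiv ℝ φ (x - r • e) e = φ x - φ (x - e) := by
  have hd : ∀ r ∈ uIcc (0 : ℝ) 1, HasDerivAt (fun r : ℝ => -φ (x - r • e))
      (fderiv ℝ φ (x - r • e) e) r := by
    intro r _
    have h1 : HasDerivAt (fun r : ℝ => x - r • e) (-e) r := by
      simpa using ((hasDerivAt_id r).smul_const e).const_sub x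
    have h2 := ((hφ.differentiable (by simp)) (x - r • e)).hasFDerivAt.comp_hasDerivAt r h1
    have h3 := h2.neg
    rw [map_neg, neg_neg] at h3
    exact h3
  rw [intervalIntegral.integral_eq_sub_of_hasDerivAt hd]
  · simp only [one_smul, zero_smul, sub_zero]; ring
  · refine Continuous.intervalIntegrable ?_ _ _
    exact (continuous_fderiv_apply hφ e).comp (by fun_prop)

theorem DirDeriv.translate {K : Set (Sp d)} (hK : IsOpen K) {w G : Sp d → ℝ} {e : Sp d}
    (hw : L1L2 w) (hG : L1L2 G) (h : DirDeriv K w G e) :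
    ∀ᵐ x, (∀ r ∈ Icc (0 : ℝ) 1, x + r • e ∈ K) →
      w (x + e) - w x = ∫ r in (0 : ℝ)..1, G (x + r • e) := by
  have hKo : IsOpen {x : Sp d | ∀ r ∈ Icc (0 : ℝ) 1, x + r • e ∈ K} := by
    have := (isOpen_segment_subset hK e).preimage (f := fun x : Sp d => (x, (1 : ℝ)))
      (by fun_prop)
    simpa using this
  simp only [intervalIntegral.integral_of_le zero_le_one]
  set ρ := (volume : Measure ℝ).restrict (Ioc 0 1) with hρ
  have hGp := integrable_translate hG.measurable hG.integrable e ρ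
  have hwi : Integrable fun x => w (x + e) := hw.integrable.comp_add_right e
  have hGi : Integrable fun x => ∫ r, G (x + r • e) ∂ρ := hGp.integral_prod_left
  have hfi : Integrable fun x => w (x + e) - w x - ∫ r, G (x + r • e) ∂ρ :=
    (hwi.sub hw.integrable).sub hGi
  have key := hKo.ae_eq_zero_of_integral_contDiff_smul_eq_zero (μ := volume)
    (f := fun x => w (x + e) - w x - ∫ r, G (x + r • e) ∂ρ)
    (hfi.locallyIntegrable.locallyIntegrableOn _) ?_
  · filter_upwards [key] with x hx hxK
    linarith [hx hxK]
  intro φ hφ hc hs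
  obtain ⟨M, hM⟩ := hc.exists_bound_of_continuous hφ.continuous
  obtain ⟨M', hM'⟩ := (hasCompactSupport_fderiv_apply hc e).exists_bound_of_continuous
    (continuous_fderiv_apply hφ e)
  have hφm : AEStronglyMeasurable φ := hφ.continuous.aestronglyMeasurable
  have hφb : ∀ᵐ x, ‖φ x‖ ≤ M := Eventually.of_forall hM
  have i1 : Integrable fun x => φ x * w (x + e) := hwi.bdd_mul hφm hφb
  have i2 : Integrable fun x => φ x * w x := hw.integrable.bdd_mul hφm hφb
  have i3 : Integrable fun x => φ x * ∫ r, G (x + r • e) ∂ρ := hGi.bdd_mul hφm hφb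
  have i1' : Integrable fun x => φ (x - e) * w x :=
    hw.integrable.bdd_mul (hφ.continuous.comp (by fun_prop)).aestronglyMeasurable
      (Eventually.of_forall fun x => hM _)
  have A : ∫ x, φ x * w (x + e) = ∫ x, φ (x - e) * w x := by
    rw [← integral_add_right_eq_self (fun x => φ (x - e) * w x) e]
    simp
  have step : ∀ r ∈ Ioc (0 : ℝ) 1,
      ∫ x, φ x * G (x + r • e) = - ∫ x, w x * fderiv ℝ φ (x - r • e) e := by
    intro r hr
    have hψ : ContDiff ℝ ∞ fun x => φ (x - r • e) := hφ.comp (contDiff_id.sub contDiff_const)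
    have hψc : HasCompactSupport fun x => φ (x - r • e) := by
      have := hc.comp_homeomorph (Homeomorph.subRight (r • e))
      exact this
    have hψs : tsupport (fun x => φ (x - r • e)) ⊆ K := by
      intro x hx
      have hx' : x - r • e ∈ tsupport φ :=
        tsupport_comp_subset_preimage φ (f := fun x => x - r • e) (by fun_prop) hx
      have := hs hx' r ⟨hr.1.le, hr.2⟩
      simpa using this
    have e1 := h _ hψ hψc hψs
    have e2 : ∀ x, fderiv ℝ (fun x => φ (x - r • e)) x = fderiv ℝ φ (x - r • e) := fun x => by
      rw [fderiv_comp_sub]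
    simp only [e2] at e1
    rw [e1, neg_neg, ← integral_add_right_eq_self (fun x => G x * φ (x - r • e)) (r • e)]
    simp [mul_comm]
  have B : ∫ x, φ x * ∫ r, G (x + r • e) ∂ρ = - ∫ x, w x * (φ x - φ (x - e)) := by
    have j1 : Integrable (fun p : Sp d × ℝ => φ p.1 * G (p.1 + p.2 • e)) (volume.prod ρ) :=
      hGp.bdd_mul (hφ.continuous.comp continuous_fst).aestronglyMeasurable
        (Eventually.of_forall fun p => hM _)
    have j2 : Integrable (fun p : Sp d × ℝ => w p.1 * fderiv ℝ φ (p.1 - p.2 • e) e)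
        (volume.prod ρ) :=
      (hw.integrable.comp_fst ρ).mul_bdd (c := M')
        ((continuous_fderiv_apply hφ e).comp
          (f := fun p : Sp d × ℝ => p.1 - p.2 • e) (by fun_prop)).aestronglyMeasurable
        (Eventually.of_forall fun p => hM' _)
    calc ∫ x, φ x * ∫ r, G (x + r • e) ∂ρ
        = ∫ x, ∫ r, φ x * G (x + r • e) ∂ρ := by simp only [integral_const_mul]
      _ = ∫ r, (∫ x, φ x * G (x + r • e)) ∂ρ := integral_integral_swap j1
      _ = ∫ r, (- ∫ x, w x * fderiv ℝ φ (x - r • e) e) ∂ρ := by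
          refine integral_congr_ae ?_
          filter_upwards [ae_restrict_mem measurableSet_Ioc] with r hr using step r hr
      _ = - ∫ x, ∫ r, w x * fderiv ℝ φ (x - r • e) e ∂ρ := by
          rw [integral_neg,
            ← integral_integral_swap (f := fun x r => w x * fderiv ℝ φ (x - r • e) e) j2]
      _ = - ∫ x, w x * (φ x - φ (x - e)) := by
          congr 1
          refine integral_congr_ae (Eventually.of_forall fun x => ?_)
          simp only [integral_const_mul]
          rw [← integral_fderiv_segment hφ x e, intervalIntegral.integral_of_le zero_le_one]
  have i4 : ∫ x, w x * (φ x - φ (x - e)) = (∫ x, φ x * w x) - ∫ x, φ (x - e) * w x := by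
    rw [← integral_sub i2 i1']
    congr 1; funext x; ring
  simp only [smul_eq_mul, mul_sub]
  have e1 : ∫ x, (φ x * w (x + e) - φ x * w x - φ x * ∫ r, G (x + r • e) ∂ρ)
      = (∫ x, φ x * w (x + e)) - (∫ x, φ x * w x) - ∫ x, φ x * ∫ r, G (x + r • e) ∂ρ := by
    rw [← integral_sub i1 i2]
    exact integral_sub (i1.sub i2) i3
  rw [e1, A, B, i4]
  ring

/-- Along the line through `z` in the direction `e`, the function `w` is square integrable and
absolutely continuous with derivative `G` as long as the line stays in `K`. -/
structure LineAC (K : Set (Sp d)) (w G : Sp d → ℝ) (e z : Sp d) : Prop where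
  memLp : MemLp (fun t : ℝ => w (z + t • e)) 2
  memLp_deriv : MemLp (fun t : ℝ => G (z + t • e)) 2
  ae_eq : ∀ᵐ τ : ℝ, ∀ᵐ σ : ℝ, (∀ r ∈ uIcc τ σ, z + r • e ∈ K) →
    w (z + σ • e) - w (z + τ • e) = ∫ r in τ..σ, G (z + r • e)

theorem DirDeriv.ae_ae {K : Set (Sp d)} (hK : IsOpen K) {w G : Sp d → ℝ} {e : Sp d}
    (hw : L1L2 w) (hG : L1L2 G) (h : DirDeriv K w G e) :
    ∀ᵐ x, ∀ᵐ s : ℝ, (∀ r ∈ Icc (0 : ℝ) 1, x + (r * s) • e ∈ K) →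
      w (x + s • e) - w x = ∫ r in (0 : ℝ)..1, s * G (x + (r * s) • e) := by
  have h1 : ∀ s : ℝ, ∀ᵐ x, (∀ r ∈ Icc (0 : ℝ) 1, x + (r * s) • e ∈ K) →
      w (x + s • e) - w x = ∫ r in (0 : ℝ)..1, s * G (x + (r * s) • e) := by
    intro s
    have := (h.smul s).translate hK hw (hG.const_mul s)
    simpa only [smul_smul] using this
  have hms : MeasurableSet {p : Sp d × ℝ | (∀ r ∈ Icc (0 : ℝ) 1, p.1 + (r * p.2) • e ∈ K) →
      w (p.1 + p.2 • e) - w p.1 = ∫ r in (0 : ℝ)..1, p.2 * G (p.1 + (r * p.2) • e)} := by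
    refine (isOpen_segment_subset hK e).measurableSet.imp ?_
    refine measurableSet_eq_fun ?_ ?_
    · exact (hw.measurable.comp (by fun_prop)).sub (hw.measurable.comp measurable_fst)
    · simp only [intervalIntegral.integral_of_le zero_le_one]
      refine (StronglyMeasurable.integral_prod_right' (ν := volume.restrict (Ioc (0 : ℝ) 1))
        (f := fun q : (Sp d × ℝ) × ℝ => q.1.2 * G (q.1.1 + (q.2 * q.1.2) • e)) ?_).measurable
      refine Measurable.stronglyMeasurable ?_
      exact (by fun_prop : Measurable fun q : (Sp d × ℝ) × ℝ => q.1.2).mul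
        (hG.measurable.comp (by fun_prop))
  exact (Measure.ae_ae_comm (p := fun (s : ℝ) (x : Sp d) =>
    (∀ r ∈ Icc (0 : ℝ) 1, x + (r * s) • e ∈ K) →
      w (x + s • e) - w x = ∫ r in (0 : ℝ)..1, s * G (x + (r * s) • e))
      (measurable_swap hms)).1 (Eventually.of_forall h1)

theorem IsChart.ae_memLp {n e : Sp d} {c : ℝ} {J : Sp (d - 1) →ₗᵢ[ℝ] Sp d}
    {j : Sp (d - 1) → Sp d} {κ : ℝ≥0∞} (hj : IsChart n e c J j κ) {w : Sp d → ℝ}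
    (hw : L1L2 w) : ∀ᵐ y, MemLp (fun t : ℝ => w (j y + t • e)) 2 := by
  have h1 := (hj.integrable_prod hw.memLp.integrable_sq).prod_right_ae
  filter_upwards [h1] with y hy
  refine (memLp_two_iff_integrable_sq ?_).2 hy
  exact (hw.measurable.comp (by fun_prop)).aestronglyMeasurable

theorem DirDeriv.ae_lineAC {K : Set (Sp d)} (hK : IsOpen K) {w G : Sp d → ℝ} {n e : Sp d}
    {c : ℝ} {J : Sp (d - 1) →ₗᵢ[ℝ] Sp d} {j : Sp (d - 1) → Sp d} {κ : ℝ≥0∞}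
    (hj : IsChart n e c J j κ) (hw : L1L2 w) (hG : L1L2 G) (h : DirDeriv K w G e) :
    ∀ᵐ y, LineAC K w G e (j y) := by
  filter_upwards [hj.ae_memLp hw, hj.ae_memLp hG, hj.ae_ae (h.ae_ae hK hw hG)] with y h1 h2 h3
  refine ⟨h1, h2, ?_⟩
  filter_upwards [h3] with τ hτ
  have hτ' := (measurePreserving_sub_right (volume : Measure ℝ) τ).quasiMeasurePreserving.ae hτ
  filter_upwards [hτ'] with σ hσ hseg
  have e1 : ∀ r : ℝ, j y + τ • e + (r * (σ - τ)) • e = j y + (τ + (σ - τ) * r) • e := fun r => by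
    rw [add_assoc, ← add_smul, mul_comm]
  have e2 : j y + τ • e + (σ - τ) • e = j y + σ • e := by
    rw [add_assoc, ← add_smul]; simp
  simp only [e1, e2] at hσ
  rw [hσ, intervalIntegral.integral_const_mul,
    intervalIntegral.mul_integral_comp_add_mul (f := fun u => G (j y + u • e))]
  · simp
  · intro r hr
    refine hseg _ ?_
    have := segment_eq_uIcc τ σ
    rw [← this]
    refine ⟨1 - r, r, by linarith [hr.2], hr.1, by ring, ?_⟩
    simp only [smul_eq_mul]; ring

theorem exists_mem_Ioo_of_ae {P : ℝ → Prop} (h : ∀ᵐ t, P t) {a b : ℝ} (hab : a < b) :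
    ∃ t ∈ Ioo a b, P t := by
  by_contra! hc
  have : volume (Ioo a b) ≤ volume {t | ¬ P t} := measure_mono fun t ht => hc t ht
  rw [ae_iff.1 h, Real.volume_Ioo] at this
  simp at this
  linarith

namespace LineAC

variable {K : Set (Sp d)} {w G : Sp d → ℝ} {e z : Sp d}

theorem intervalIntegrable (h : LineAC K w G e z) (a b : ℝ) :
    IntervalIntegrable (fun t : ℝ => G (z + t • e)) volume a b :=
  ((h.memLp_deriv.locallyIntegrable one_le_two).integrableOn_isCompact isCompact_uIcc).intervalIntegrable

theorem abs_integral_le (h : LineAC K w G e z) {t : ℝ} (ht : 0 ≤ t) :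
    |∫ s in (0 : ℝ)..t, G (z + s • e)| ≤ √t * (1 + ∫ s : ℝ, G (z + s • e) ^ 2) := by
  rcases ht.eq_or_lt with rfl | ht
  · simp
  have hs : 0 < √t := Real.sqrt_pos.2 ht
  have hsq := h.memLp_deriv.integrable_sq
  have hss : √t * √t = t := Real.mul_self_sqrt ht.le
  have hpt : ∀ x : ℝ, |x| ≤ (√t)⁻¹ + √t * x ^ 2 := by
    intro x
    have h1 : 0 ≤ (√t)⁻¹ * (1 - √t * |x|) ^ 2 := by positivity
    have h2 : (√t)⁻¹ * (1 - √t * |x|) ^ 2 = (√t)⁻¹ + √t * x ^ 2 - 2 * |x| := by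
      rw [← sq_abs x]; field_simp; ring
    have := abs_nonneg x
    linarith
  calc |∫ s in (0 : ℝ)..t, G (z + s • e)|
      ≤ ∫ s in (0 : ℝ)..t, |G (z + s • e)| := intervalIntegral.abs_integral_le_integral_abs ht.le
    _ ≤ ∫ s in (0 : ℝ)..t, ((√t)⁻¹ + √t * G (z + s • e) ^ 2) :=
        intervalIntegral.integral_mono_on ht.le (h.intervalIntegrable _ _).abs
          ((continuous_const.intervalIntegrable _ _).add
            (hsq.intervalIntegrable.const_mul _)) fun s _ => hpt _
    _ = √t + √t * ∫ s in (0 : ℝ)..t, G (z + s • e) ^ 2 := by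
        rw [intervalIntegral.integral_add (continuous_const.intervalIntegrable _ _)
          (hsq.intervalIntegrable.const_mul _), intervalIntegral.integral_const_mul,
          intervalIntegral.integral_const]
        congr 1
        rw [smul_eq_mul, sub_zero]
        nth_rw 1 [← hss]
        field_simp
    _ ≤ √t * (1 + ∫ s : ℝ, G (z + s • e) ^ 2) := by
        rw [mul_add, mul_one]
        gcongr
        rw [intervalIntegral.integral_of_le ht.le]
        exact setIntegral_le_integral hsq (Eventually.of_forall fun s => sq_nonneg _)

theorem exists_value (h : LineAC K w G e z) {δ : ℝ} (hδ : 0 < δ)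
    (hK : ∀ t ∈ Ioo 0 δ, z + t • e ∈ K) :
    ∃ a, ∀ᵐ t : ℝ, t ∈ Ioo 0 δ → w (z + t • e) = a + ∫ s in (0 : ℝ)..t, G (z + s • e) := by
  obtain ⟨τ, hτ, h'⟩ := exists_mem_Ioo_of_ae h.ae_eq hδ
  refine ⟨w (z + τ • e) - ∫ s in (0 : ℝ)..τ, G (z + s • e), ?_⟩
  filter_upwards [h'] with t ht htδ
  have h1 := ht fun r hr => hK r ((ordConnected_Ioo.uIcc_subset hτ htδ) hr)
  have h2 := intervalIntegral.integral_add_adjacent_intervals (h.intervalIntegrable 0 τ)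
    (h.intervalIntegrable τ t)
  linarith

theorem value_unique {δ δ' a a' : ℝ} (hδ : 0 < δ) (hδ' : 0 < δ')
    (ha : ∀ᵐ t : ℝ, t ∈ Ioo 0 δ → w (z + t • e) = a + ∫ s in (0 : ℝ)..t, G (z + s • e))
    (ha' : ∀ᵐ t : ℝ, t ∈ Ioo 0 δ' → w (z + t • e) = a' + ∫ s in (0 : ℝ)..t, G (z + s • e)) :
    a = a' := by
  obtain ⟨t, ht, h1, h2⟩ := exists_mem_Ioo_of_ae (ha.and ha') (lt_min hδ hδ')
  have e1 := h1 ⟨ht.1, ht.2.trans_le (min_le_left _ _)⟩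
  have e2 := h2 ⟨ht.1, ht.2.trans_le (min_le_right _ _)⟩
  linarith

end LineAC

theorem measurable_line_average {w G : Sp d → ℝ} (hw : Measurable w) (hG : Measurable G)
    (e : Sp d) (j : Sp (d - 1) → Sp d) (hj : Measurable j) (δ : ℝ) :
    Measurable fun y => ∫ t in Ioc 0 δ,
      (w (j y + t • e) - ∫ s in (0 : ℝ)..t, G (j y + s • e)) := by
  have e1 : ∀ y t, ∫ s in (0 : ℝ)..t, G (j y + s • e)
      = ∫ r in Ioc (0 : ℝ) 1, t * G (j y + (t * r) • e) := by
    intro y t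
    rw [← intervalIntegral.integral_of_le zero_le_one, intervalIntegral.integral_const_mul,
      intervalIntegral.mul_integral_comp_mul_left (f := fun u => G (j y + u • e))]
    simp
  simp only [e1]
  have m1 : StronglyMeasurable fun p : Sp (d - 1) × ℝ =>
      ∫ r in Ioc (0 : ℝ) 1, p.2 * G (j p.1 + (p.2 * r) • e) := by
    refine StronglyMeasurable.integral_prod_right' (ν := volume.restrict (Ioc (0 : ℝ) 1))
      (f := fun q : (Sp (d - 1) × ℝ) × ℝ => q.1.2 * G (j q.1.1 + (q.1.2 * q.2) • e)) ?_
    refine Measurable.stronglyMeasurable ?_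
    exact (by fun_prop : Measurable fun q : (Sp (d - 1) × ℝ) × ℝ => q.1.2).mul
      (hG.comp (by fun_prop))
  have m2 : Measurable fun p : Sp (d - 1) × ℝ => w (j p.1 + p.2 • e) := hw.comp (by fun_prop)
  exact (StronglyMeasurable.integral_prod_right' (ν := volume.restrict (Ioc (0 : ℝ) δ))
    (m2.stronglyMeasurable.sub m1)).measurable

theorem measurableSet_side (n x : Sp d) : MeasurableSet (side n x) :=
  (isOpen_lt continuous_const (by fun_prop)).measurableSet

theorem ball_subset_side_inter_ball {n : Sp d} (hn : ‖n‖ = 1) (x : Sp d) {r : ℝ} (hr : 0 < r) :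
    Metric.ball (x + (r / 2) • n) (r / 2) ⊆ side n x ∩ Metric.ball x r := by
  intro z hz
  rw [Metric.mem_ball, dist_eq_norm] at hz
  have hz' : z - x = (z - (x + (r / 2) • n)) + (r / 2) • n := by abel
  have hnn : ⟪n, n⟫_ℝ = 1 := by simp [hn]
  constructor
  · change 0 < ⟪n, z - x⟫_ℝ
    rw [hz', inner_add_right, inner_smul_right, hnn]
    have h1 := neg_abs_le ⟪n, z - (x + (r / 2) • n)⟫_ℝ
    have h2 := abs_real_inner_le_norm n (z - (x + (r / 2) • n))
    rw [hn, one_mul] at h2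
    linarith
  · rw [Metric.mem_ball, dist_eq_norm, hz']
    refine (norm_add_le _ _).trans_lt ?_
    rw [norm_smul, hn, Real.norm_of_nonneg (by positivity)]
    linarith

theorem le_volume_half_ball {n : Sp d} (hn : ‖n‖ = 1) (x : Sp d) {r : ℝ}
    (hr : 0 < r) : (r / 2) ^ d * volume.real (Metric.ball (0 : Sp d) 1)
      ≤ volume.real (side n x ∩ Metric.ball x r) := by
  have : Nontrivial (Sp d) := ⟨n, 0, by rintro rfl; simp at hn⟩
  have h1 : volume.real (Metric.ball (x + (r / 2) • n) (r / 2))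
      = (r / 2) ^ d * volume.real (Metric.ball (0 : Sp d) 1) := by
    rw [measureReal_def, Measure.addHaar_ball _ _ (by positivity)]
    simp only [finrank_euclideanSpace, Fintype.card_fin, ENNReal.toReal_mul, measureReal_def]
    rw [ENNReal.toReal_ofReal (by positivity)]
  rw [← h1]
  exact measureReal_mono (ball_subset_side_inter_ball hn x hr)
    ((measure_mono inter_subset_right).trans_lt measure_ball_lt_top).ne

theorem setAverage_sub_const_le {μ : Measure (Sp d)} {s : Set (Sp d)} {w : Sp d → ℝ}
    (hw : IntegrableOn w s μ) (h0 : μ s ≠ 0) (ht : μ s ≠ ⊤) (b : ℝ) :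
    |(⨍ y in s, w y ∂μ) - b| ≤ (μ.real s)⁻¹ * ∫ y in s, |w y - b| ∂μ := by
  have hpos : 0 < μ.real s := ENNReal.toReal_pos h0 ht
  have h1 : (⨍ y in s, w y ∂μ) - b = (μ.real s)⁻¹ * ∫ y in s, (w y - b) ∂μ := by
    rw [setAverage_eq, integral_sub hw (integrableOn_const ht), setIntegral_const]
    simp only [smul_eq_mul]
    field_simp
  rw [h1, abs_mul, abs_of_pos (inv_pos.2 hpos)]
  gcongr
  exact abs_integral_le_integral_abs

theorem IsChart.half_ball_subset {n e : Sp d} {c : ℝ} {J : Sp (d - 1) →ₗᵢ[ℝ] Sp d}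
    {j : Sp (d - 1) → Sp d} {κ : ℝ≥0∞} (hj : IsChart n e c J j κ) (hn : ‖n‖ = 1)
    (hne : 0 < ⟪n, e⟫_ℝ) {y y₀ : Sp (d - 1)} {t r : ℝ}
    (h : j y + t • e ∈ side n (j y₀) ∩ Metric.ball (j y₀) r) :
    y ∈ Metric.closedBall y₀ ((1 + (1 + ‖e‖) / ⟪n, e⟫_ℝ) * r) ∧
      t ∈ Ioc 0 ((1 + (1 + ‖e‖) / ⟪n, e⟫_ℝ) * r) := by
  obtain ⟨h1, h2⟩ := h
  have h1 : 0 < ⟪n, j y + t • e - j y₀⟫_ℝ := h1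
  rw [Metric.mem_ball, dist_eq_norm] at h2
  have h3 : ⟪n, j y + t • e - j y₀⟫_ℝ = t * ⟪n, e⟫_ℝ := by
    rw [inner_sub_right, inner_add_right, inner_smul_right, hj.mem, hj.mem]; ring
  have h4 := (abs_real_inner_le_norm n (j y + t • e - j y₀)).trans_lt (by rwa [hn, one_mul])
  rw [h3] at h1 h4
  have ht : 0 < t := pos_of_mul_pos_left h1 hne.le
  rw [abs_of_pos h1] at h4
  have hr : 0 < r := h1.trans h4
  have ht' : t < r / ⟪n, e⟫_ℝ := (lt_div_iff₀ hne).2 h4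
  have hd : dist y y₀ ≤ r + t * ‖e‖ := by
    rw [← hj.isometry.dist_eq, dist_eq_norm]
    calc ‖j y - j y₀‖ = ‖(j y + t • e - j y₀) - t • e‖ := by congr 1; abel
      _ ≤ ‖j y + t • e - j y₀‖ + ‖t • e‖ := norm_sub_le _ _
      _ ≤ r + t * ‖e‖ := by
        rw [norm_smul, Real.norm_of_nonneg ht.le]; linarith
  have hE : (1 + (1 + ‖e‖) / ⟪n, e⟫_ℝ) * r = r + r / ⟪n, e⟫_ℝ + r / ⟪n, e⟫_ℝ * ‖e‖ := by ring
  have hp : 0 < r / ⟪n, e⟫_ℝ := by positivity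
  have h5 : t * ‖e‖ ≤ r / ⟪n, e⟫_ℝ * ‖e‖ := by gcongr
  have h6 : 0 ≤ r / ⟪n, e⟫_ℝ * ‖e‖ := by positivity
  refine ⟨?_, ht, ?_⟩
  · rw [Metric.mem_closedBall, hE]; linarith
  · rw [hE]; linarith

theorem IsChart.mul_setIntegral_half_ball_le {n e : Sp d} {c : ℝ} {J : Sp (d - 1) →ₗᵢ[ℝ] Sp d}
    {j : Sp (d - 1) → Sp d} {κ : ℝ≥0∞} (hj : IsChart n e c J j κ) {w : Sp d → ℝ} (hw : L1L2 w)
    {S : Set (Sp d)} (hS : MeasurableSet S) (hSt : volume S ≠ ⊤)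
    {y₀ : Sp (d - 1)} {R b : ℝ} (hR : 0 ≤ R)
    (hsub : ∀ y t, j y + t • e ∈ S → y ∈ Metric.closedBall y₀ R ∧ t ∈ Ioc 0 R)
    {g : Sp (d - 1) → ℝ} (hg : IntegrableOn g (Metric.closedBall y₀ R)) (hg0 : ∀ y, 0 ≤ g y)
    (hle : ∀ᵐ y, y ∈ Metric.closedBall y₀ R →
      ∀ᵐ t : ℝ, t ∈ Ioc 0 R → |w (j y + t • e) - b| ≤ g y) :
    κ.toReal * ∫ z in S, |w z - b| ≤ R * ∫ y in Metric.closedBall y₀ R, g y := by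
  have hwb : IntegrableOn (fun z => |w z - b|) S :=
    (hw.integrable.integrableOn.sub (integrableOn_const hSt)).abs
  have hfi : Integrable (S.indicator fun z => |w z - b|) := (integrable_indicator_iff hS).2 hwb
  rw [← integral_indicator hS, ← hj.integral_eq hfi, ← integral_const_mul,
    ← integral_indicator measurableSet_closedBall]
  have hprod := hj.integrable_prod hfi
  refine integral_mono_ae hprod.integral_prod_left
    ((integrable_indicator_iff measurableSet_closedBall).2 (hg.const_mul R)) ?_
  filter_upwards [hle] with y hy
  by_cases hyB : y ∈ Metric.closedBall y₀ R
  · rw [indicator_of_mem hyB]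
    have h1 : ∫ t : ℝ, S.indicator (fun z => |w z - b|) (j y + t • e)
        ≤ ∫ t : ℝ, (Ioc 0 R).indicator (fun _ => g y) t := by
      refine integral_mono_of_nonneg (Eventually.of_forall fun t => ?_)
        ((integrable_indicator_iff measurableSet_Ioc).2 (integrableOn_const (by simp))) ?_
      · exact indicator_nonneg (fun z _ => abs_nonneg _) _
      · filter_upwards [hy hyB] with t ht
        by_cases hz : j y + t • e ∈ S
        · rw [indicator_of_mem hz, indicator_of_mem (hsub y t hz).2]
          exact ht (hsub y t hz).2
        · rw [indicator_of_notMem hz]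
          exact indicator_nonneg (fun _ _ => hg0 y) _
    refine h1.trans_eq ?_
    rw [integral_indicator measurableSet_Ioc, setIntegral_const]
    simp [hR]
  · rw [indicator_of_notMem hyB]
    refine (integral_eq_zero_of_ae (Eventually.of_forall fun t => ?_)).le
    exact indicator_of_notMem (fun hz => hyB (hsub y t hz).1) _

/-- At a common Lebesgue point of `g` and `M`, a function that differs from `g` by at most
`√t (1 + |M|)` at height `t` has a one-sided trace. -/
theorem IsChart.hasTraceAt {n e : Sp d} {c : ℝ} {J : Sp (d - 1) →ₗᵢ[ℝ] Sp d}
    {j : Sp (d - 1) → Sp d} {κ : ℝ≥0∞} (hd : 1 ≤ d) (hj : IsChart n e c J j κ) (hn : ‖n‖ = 1)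
    (hne : 0 < ⟪n, e⟫_ℝ) {w : Sp d → ℝ} (hw : L1L2 w) {g M : Sp (d - 1) → ℝ}
    (hg : Integrable g) (hM : Integrable M) {y₀ : Sp (d - 1)}
    (hgt : Tendsto (fun r => ⨍ y in Metric.closedBall y₀ r, ‖g y - g y₀‖) (𝓝[>] 0) (𝓝 0))
    (hMt : Tendsto (fun r => ⨍ y in Metric.closedBall y₀ r, ‖M y - M y₀‖) (𝓝[>] 0) (𝓝 0))
    {ρ δ : ℝ} (hρ : 0 < ρ) (hδ : 0 < δ)
    (hle : ∀ᵐ y, y ∈ Metric.ball y₀ ρ → ∀ᵐ t : ℝ, t ∈ Ioo 0 δ →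
      |w (j y + t • e) - g y| ≤ √t * (1 + |M y|)) :
    HasTraceAt (side n (j y₀)) w (j y₀) (g y₀) := by
  set Λ := 1 + (1 + ‖e‖) / ⟪n, e⟫_ℝ with hΛ
  have hΛ0 : 0 < Λ := by positivity
  have hlim : Tendsto (fun r : ℝ => Λ * r) (𝓝[>] 0) (𝓝[>] 0) := by
    refine tendsto_nhdsWithin_iff.2 ⟨?_, ?_⟩
    · have : Tendsto (fun r : ℝ => Λ * r) (𝓝 0) (𝓝 (Λ * 0)) := tendsto_id.const_mul Λ
      rw [mul_zero] at this
      exact this.mono_left nhdsWithin_le_nhds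
    · filter_upwards [self_mem_nhdsWithin] with r hr
      exact mul_pos hΛ0 hr
  let A : ℝ → ℝ := fun R => ⨍ y in Metric.closedBall y₀ R, ‖g y - g y₀‖
  let B : ℝ → ℝ := fun R => ⨍ y in Metric.closedBall y₀ R, ‖M y - M y₀‖
  let E : ℝ → ℝ := fun R => A R + √R * (1 + |M y₀| + B R)
  have hE : Tendsto E (𝓝[>] 0) (𝓝 0) := by
    have hs : Tendsto (fun R : ℝ => √R) (𝓝[>] 0) (𝓝 0) := by
      have := (Real.continuous_sqrt.tendsto 0)
      rw [Real.sqrt_zero] at this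
      exact this.mono_left nhdsWithin_le_nhds
    have h2 := hgt.add (hs.mul (hMt.const_add (1 + |M y₀|)))
    simpa [E, A, B] using h2
  set β := volume.real (Metric.ball (0 : Sp d) 1) with hβ
  set β' := volume.real (Metric.ball (0 : Sp (d - 1)) 1) with hβ'
  have hβp : 0 < β :=
    ENNReal.toReal_pos (Metric.measure_ball_pos _ _ one_pos).ne' measure_ball_lt_top.ne
  have hκ : 0 < κ.toReal := ENNReal.toReal_pos hj.ne_zero hj.ne_top
  have hvol : ∀ R : ℝ, 0 ≤ R → volume.real (Metric.closedBall y₀ R) = R ^ (d - 1) * β' := by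
    intro R hR
    rw [measureReal_def, Measure.addHaar_closedBall _ _ hR]
    simp only [finrank_euclideanSpace, Fintype.card_fin, ENNReal.toReal_mul, hβ', measureReal_def]
    rw [ENNReal.toReal_ofReal (by positivity)]
  rw [HasTraceAt, tendsto_iff_dist_tendsto_zero]
  have hbound : Tendsto (fun r : ℝ => ((2 * Λ) ^ d * β' / (β * κ.toReal)) * E (Λ * r))
      (𝓝[>] 0) (𝓝 0) := by
    simpa using (hE.comp hlim).const_mul ((2 * Λ) ^ d * β' / (β * κ.toReal))
  refine squeeze_zero' (Eventually.of_forall fun r => dist_nonneg) ?_ hbound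
  have hsmall : ∀ᶠ R : ℝ in 𝓝[>] 0, R < min ρ δ :=
    (eventually_lt_nhds (lt_min hρ hδ)).filter_mono nhdsWithin_le_nhds
  filter_upwards [hlim.eventually hsmall, self_mem_nhdsWithin] with r hr hr0
  have hr0 : 0 < r := hr0
  have hR : 0 < Λ * r := mul_pos hΛ0 hr0
  set R := Λ * r with hRdef
  set S := side n (j y₀) ∩ Metric.ball (j y₀) r with hS
  have hSt : volume S ≠ ⊤ := ((measure_mono inter_subset_right).trans_lt measure_ball_lt_top).ne
  have hSv := le_volume_half_ball hn (j y₀) hr0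
  rw [← hS, ← hβ] at hSv
  have hSpos : 0 < volume.real S := lt_of_lt_of_le (by positivity) hSv
  have hS0 : volume S ≠ 0 := fun h0 => by simp [measureReal_def, h0] at hSpos
  have hfin : volume (Metric.closedBall y₀ R) ≠ ⊤ := measure_closedBall_lt_top.ne
  have hcst : ∀ a : ℝ, IntegrableOn (fun _ : Sp (d - 1) => a) (Metric.closedBall y₀ R) :=
    fun a => integrableOn_const hfin
  have i1 : IntegrableOn (fun y => ‖g y - g y₀‖) (Metric.closedBall y₀ R) :=
    (hg.integrableOn.sub (hcst _)).norm
  have i2 : IntegrableOn (fun y => ‖M y - M y₀‖) (Metric.closedBall y₀ R) :=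
    (hM.integrableOn.sub (hcst _)).norm
  have i3 : IntegrableOn (fun y => √R * (1 + |M y₀| + ‖M y - M y₀‖)) (Metric.closedBall y₀ R) :=
    ((hcst _).add i2).const_mul _
  have key := hj.mul_setIntegral_half_ball_le hw (S := S)
    ((measurableSet_side _ _).inter measurableSet_ball) hSt (y₀ := y₀) (R := R) (b := g y₀) hR.le
    (fun y t h => hj.half_ball_subset hn hne h)
    (g := fun y => ‖g y - g y₀‖ + √R * (1 + |M y₀| + ‖M y - M y₀‖)) (i1.add i3)
    (fun y => by positivity) ?_
  swap
  · filter_upwards [hle] with y hy hyR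
    have hy' : y ∈ Metric.ball y₀ ρ :=
      Metric.closedBall_subset_ball (hr.trans_le (min_le_left _ _)) hyR
    filter_upwards [hy hy'] with t ht htR
    have h1 := ht ⟨htR.1, htR.2.trans_lt (hr.trans_le (min_le_right _ _))⟩
    have h2 : √t ≤ √R := Real.sqrt_le_sqrt htR.2
    have h3 : |M y| ≤ |M y₀| + ‖M y - M y₀‖ := by
      have := abs_add_le (M y₀) (M y - M y₀)
      simpa using this
    have h4 : √t * (1 + |M y|) ≤ √R * (1 + |M y₀| + ‖M y - M y₀‖) :=
      mul_le_mul h2 (by linarith) (by positivity) (by positivity)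
    have h5 := abs_sub_le (w (j y + t • e)) (g y) (g y₀)
    simp only [Real.norm_eq_abs] at h4 ⊢
    linarith
  have hint : ∫ y in Metric.closedBall y₀ R, (‖g y - g y₀‖ + √R * (1 + |M y₀| + ‖M y - M y₀‖))
      = volume.real (Metric.closedBall y₀ R) * E R := by
    have hv0 : volume.real (Metric.closedBall y₀ R) ≠ 0 :=
      (ENNReal.toReal_pos (Metric.measure_closedBall_pos _ _ hR).ne' hfin).ne'
    rw [integral_add i1 i3, integral_const_mul, integral_add (hcst _) i2, setIntegral_const]
    simp only [E, A, B, setAverage_eq, smul_eq_mul]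
    field_simp
  rw [hint, hvol R hR.le] at key
  have h1 := setAverage_sub_const_le (hw.integrable.integrableOn (s := S)) hS0 hSt (g y₀)
  rw [Real.dist_eq]
  refine h1.trans ?_
  set X := ∫ z in S, |w z - g y₀| with hX
  have hX0 : 0 ≤ X := integral_nonneg fun _ => abs_nonneg _
  have hdd : R * R ^ (d - 1) = R ^ d := by rw [← pow_succ', Nat.sub_add_cancel hd]
  have hXle : X ≤ R ^ d * β' * E R / κ.toReal := by
    rw [le_div_iff₀ hκ, ← hdd]
    linarith
  calc (volume.real S)⁻¹ * X ≤ ((r / 2) ^ d * β)⁻¹ * X := by gcongr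
    _ ≤ ((r / 2) ^ d * β)⁻¹ * (R ^ d * β' * E R / κ.toReal) := by gcongr
    _ = ((2 * Λ) ^ d * β' / (β * κ.toReal)) * E R := by
      rw [hRdef, mul_pow, mul_pow, div_pow]
      field_simp

theorem value_eq_line_average {w G : Sp d → ℝ} {e z : Sp d} {δ a : ℝ}
    (hδ : 0 < δ) (ha : ∀ᵐ t : ℝ, t ∈ Ioo 0 δ →
      w (z + t • e) = a + ∫ s in (0 : ℝ)..t, G (z + s • e)) :
    a = δ⁻¹ * ∫ t in Ioc 0 δ, (w (z + t • e) - ∫ s in (0 : ℝ)..t, G (z + s • e)) := by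
  have h1 : ∫ t in Ioc 0 δ, (w (z + t • e) - ∫ s in (0 : ℝ)..t, G (z + s • e))
      = ∫ _ in Ioc 0 δ, a := by
    rw [integral_Ioc_eq_integral_Ioo, integral_Ioc_eq_integral_Ioo]
    refine setIntegral_congr_ae measurableSet_Ioo ?_
    filter_upwards [ha] with t ht h
    rw [ht h]; ring
  rw [h1, setIntegral_const]
  simp only [measureReal_def, Real.volume_Ioc, sub_zero, smul_eq_mul,
    ENNReal.toReal_ofReal hδ.le]
  field_simp

theorem LineAC.abs_value_le {K : Set (Sp d)} {w G : Sp d → ℝ} {e z : Sp d} {δ a : ℝ}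
    (h : LineAC K w G e z) (hδ : 0 < δ) (hwi : Integrable fun t : ℝ => w (z + t • e))
    (ha : ∀ᵐ t : ℝ, t ∈ Ioo 0 δ → w (z + t • e) = a + ∫ s in (0 : ℝ)..t, G (z + s • e)) :
    |a| ≤ δ⁻¹ * (∫ t : ℝ, |w (z + t • e)|) + √δ * (1 + ∫ s : ℝ, G (z + s • e) ^ 2) := by
  set M := ∫ s : ℝ, G (z + s • e) ^ 2 with hM
  have hM0 : 0 ≤ M := integral_nonneg fun _ => sq_nonneg _
  have h1 : ∫ _ in Ioo 0 δ, |a| ≤ ∫ t in Ioo 0 δ, (|w (z + t • e)| + √δ * (1 + M)) := by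
    refine integral_mono_ae (integrableOn_const (by simp))
      (hwi.abs.integrableOn.add (integrableOn_const (by simp))) ?_
    filter_upwards [ae_restrict_of_ae ha, ae_restrict_mem measurableSet_Ioo] with t ht htδ
    have e1 := ht htδ
    have e2 := h.abs_integral_le htδ.1.le
    have e3 : √t * (1 + M) ≤ √δ * (1 + M) := by
      have := Real.sqrt_le_sqrt htδ.2.le
      gcongr
    have e4 := abs_add_le (w (z + t • e)) (-∫ s in (0 : ℝ)..t, G (z + s • e))
    rw [abs_neg, e1, add_neg_cancel_right] at e4
    rw [← e1] at e4
    linarith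
  have hv : volume.real (Ioo 0 δ) = δ := by simp [measureReal_def, hδ.le]
  rw [setIntegral_const, integral_add hwi.abs.integrableOn (integrableOn_const (by simp)),
    setIntegral_const, hv, smul_eq_mul, smul_eq_mul] at h1
  have h2 : ∫ t in Ioo 0 δ, |w (z + t • e)| ≤ ∫ t : ℝ, |w (z + t • e)| :=
    setIntegral_le_integral hwi.abs (Eventually.of_forall fun _ => abs_nonneg _)
  have h3 : δ * |a| ≤ δ * (δ⁻¹ * (∫ t : ℝ, |w (z + t • e)|) + √δ * (1 + M)) := by
    have : δ * (δ⁻¹ * (∫ t : ℝ, |w (z + t • e)|) + √δ * (1 + M))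
        = (∫ t : ℝ, |w (z + t • e)|) + δ * (√δ * (1 + M)) := by
      field_simp
    rw [this]; linarith
  exact le_of_mul_le_mul_left h3 hδ

/-- The trace `a` of `w` at `z` from the side `n`, with the values of `w` along the direction `e`. -/
def HasLineTrace (K : Set (Sp d)) (w G : Sp d → ℝ) (n e z : Sp d) (a : ℝ) : Prop :=
  HasTraceAt (side n z) w z a ∧ ∀ δ > 0, (∀ t ∈ Ioo (0 : ℝ) δ, z + t • e ∈ K) →
    ∀ᵐ t : ℝ, t ∈ Ioo 0 δ → w (z + t • e) = a + ∫ s in (0 : ℝ)..t, G (z + s • e)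

theorem IsChart.ae_tendsto_average {f : Sp (d - 1) → ℝ} (hf : Integrable f) :
    ∀ᵐ y₀, Tendsto (fun r => ⨍ y in Metric.closedBall y₀ r, ‖f y - f y₀‖) (𝓝[>] 0) (𝓝 0) := by
  filter_upwards [IsUnifLocDoublingMeasure.ae_tendsto_average_norm_sub (μ := volume)
    hf.locallyIntegrable 1] with y₀ hy
  refine hy (fun _ => y₀) id tendsto_id ?_
  filter_upwards [self_mem_nhdsWithin] with r hr
  have hr : 0 < r := hr
  simp [hr.le]

theorem DirDeriv.ae_hasLineTrace_of_ball (hd : 1 ≤ d) {K : Set (Sp d)} (hK : IsOpen K)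
    {w G : Sp d → ℝ} {n e : Sp d} (hn : ‖n‖ = 1) (hne : 0 < ⟪n, e⟫_ℝ) {c : ℝ}
    {J : Sp (d - 1) →ₗᵢ[ℝ] Sp d} {j : Sp (d - 1) → Sp d} {κ : ℝ≥0∞}
    (hj : IsChart n e c J j κ) (hw : L1L2 w) (hG : L1L2 G) (h : DirDeriv K w G e)
    {y₀ : Sp (d - 1)} {ρ δ : ℝ} (hδ : 0 < δ)
    (hsub : ∀ y ∈ Metric.ball y₀ ρ, ∀ t ∈ Ioo 0 δ, j y + t • e ∈ K) :
    ∀ᵐ y, y ∈ Metric.ball y₀ ρ → ∃ a, HasLineTrace K w G n e (j y) a := by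
  let a : Sp (d - 1) → ℝ := fun y => δ⁻¹ * ∫ t in Ioc 0 δ,
    (w (j y + t • e) - ∫ s in (0 : ℝ)..t, G (j y + s • e))
  have ham : Measurable a := (measurable_line_average hw.measurable hG.measurable e j
    hj.isometry.continuous.measurable δ).const_mul _
  let M : Sp (d - 1) → ℝ := fun y => ∫ s : ℝ, G (j y + s • e) ^ 2
  have hM : Integrable M := (hj.integrable_prod hG.memLp.integrable_sq).integral_prod_left
  have hM0 : ∀ y, 0 ≤ M y := fun y => integral_nonneg fun _ => sq_nonneg _
  have hwp := hj.integrable_prod hw.integrable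
  have hval : ∀ᵐ y, y ∈ Metric.ball y₀ ρ → LineAC K w G e (j y) ∧ ∀ᵐ t : ℝ, t ∈ Ioo 0 δ →
      w (j y + t • e) = a y + ∫ s in (0 : ℝ)..t, G (j y + s • e) := by
    filter_upwards [h.ae_lineAC hK hj hw hG] with y hy hyB
    obtain ⟨b, hb⟩ := hy.exists_value hδ (hsub y hyB)
    have : b = a y := value_eq_line_average hδ hb
    exact ⟨hy, this ▸ hb⟩
  let g : Sp (d - 1) → ℝ := (Metric.ball y₀ ρ).indicator a
  have hg : Integrable g := by
    rw [integrable_indicator_iff measurableSet_ball]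
    have hb : IntegrableOn (fun y => δ⁻¹ * (∫ t : ℝ, |w (j y + t • e)|) + √δ * (1 + M y))
        (Metric.ball y₀ ρ) :=
      (hwp.abs.integral_prod_left.integrableOn.const_mul _).add
        (((integrableOn_const measure_ball_lt_top.ne).add hM.integrableOn).const_mul _)
    refine Integrable.mono' hb ham.aestronglyMeasurable ?_
    filter_upwards [ae_restrict_of_ae hval, ae_restrict_of_ae hwp.prod_right_ae,
      ae_restrict_mem measurableSet_ball] with y hy hyw hyB
    exact (hy hyB).1.abs_value_le hδ hyw (hy hyB).2
  have hle : ∀ᵐ y, y ∈ Metric.ball y₀ ρ → ∀ᵐ t : ℝ, t ∈ Ioo 0 δ →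
      |w (j y + t • e) - g y| ≤ √t * (1 + |M y|) := by
    filter_upwards [hval] with y hy hyB
    filter_upwards [(hy hyB).2] with t ht htδ
    rw [ht htδ, show g y = a y from indicator_of_mem hyB _, add_sub_cancel_left,
      abs_of_nonneg (hM0 y)]
    exact (hy hyB).1.abs_integral_le htδ.1.le
  filter_upwards [hval, IsChart.ae_tendsto_average hg, IsChart.ae_tendsto_average hM]
    with y hy hyg hyM hyB
  refine ⟨a y, ?_, fun δ' hδ' hK' => ?_⟩
  · have hρ' : 0 < ρ - dist y y₀ := sub_pos.2 hyB
    have := hj.hasTraceAt hd hn hne hw hg hM hyg hyM hρ' hδ (by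
      filter_upwards [hle] with y' hy' hB
      refine hy' ?_
      have := dist_triangle y' y y₀
      have hB : dist y' y < ρ - dist y y₀ := hB
      rw [Metric.mem_ball]; linarith)
    rwa [show g y = a y from indicator_of_mem hyB _] at this
  · obtain ⟨b, hb⟩ := (hy hyB).1.exists_value hδ' hK'
    rwa [LineAC.value_unique hδ hδ' (hy hyB).2 hb]

/-- Traces of Sobolev functions on a hyperplane bounding half-balls contained in `K`. -/
theorem DirDeriv.ae_exists_hasLineTrace (hd : 1 ≤ d) {K : Set (Sp d)} (hK : IsOpen K)
    {w G : Sp d → ℝ} {n e : Sp d} (hn : ‖n‖ = 1) (hne : 0 < ⟪n, e⟫_ℝ) (c : ℝ)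
    (hw : L1L2 w) (hG : L1L2 G) (h : DirDeriv K w G e) :
    ∀ᵐ z ∂(Measure.euclideanHausdorffMeasure (d - 1) : Measure (Sp d)), ⟪n, z⟫_ℝ = c →
      (∃ r > 0, side n z ∩ Metric.ball z r ⊆ K) → ∃ a, HasLineTrace K w G n e z a := by
  obtain ⟨J, j, κ, hj⟩ := exists_isChart hd hn hne c
  rw [hj.ae_hyperplane, ae_iff]
  refine measure_null_of_locally_null _ fun y₀ hy₀ => ?_
  simp only [mem_ofPred_eq, not_forall] at hy₀
  obtain ⟨⟨r, hr, hrK⟩, -⟩ := hy₀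
  have hρ : 0 < r / 2 := by positivity
  have hδ : 0 < r / (2 * (‖e‖ + 1)) := by positivity
  have hsub : ∀ y ∈ Metric.ball y₀ (r / 2), ∀ t ∈ Ioo 0 (r / (2 * (‖e‖ + 1))),
      j y + t • e ∈ K := by
    intro y hy t ht
    refine hrK ⟨?_, ?_⟩
    · change 0 < ⟪n, j y + t • e - j y₀⟫_ℝ
      rw [inner_sub_right, inner_add_right, inner_smul_right, hj.mem, hj.mem]
      have := mul_pos ht.1 hne
      linarith
    · rw [Metric.mem_ball]
      have h1 : dist (j y + t • e) (j y) = t * ‖e‖ := by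
        rw [dist_eq_norm, add_sub_cancel_left, norm_smul, Real.norm_of_nonneg ht.1.le]
      have h2 : dist (j y) (j y₀) < r / 2 := by rw [hj.isometry.dist_eq]; exact hy
      have h3 : t * ‖e‖ ≤ r / 2 := by
        have h4 : t * (2 * (‖e‖ + 1)) < r := (lt_div_iff₀ (by positivity)).1 ht.2
        have := ht.1
        nlinarith
      have := dist_triangle (j y + t • e) (j y) (j y₀)
      linarith
  refine ⟨Metric.ball y₀ (r / 2) ∩ {y | ¬ ((∃ r > 0, side n (j y) ∩ Metric.ball (j y) r ⊆ K) →
    ∃ a, HasLineTrace K w G n e (j y) a)}, ?_, ?_⟩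
  · exact inter_mem (mem_nhdsWithin_of_mem_nhds (Metric.ball_mem_nhds _ hρ)) self_mem_nhdsWithin
  · have := h.ae_hasLineTrace_of_ball hd hK hn hne hj hw hG hδ hsub
    rw [ae_iff] at this
    refine measure_mono_null ?_ this
    rintro y ⟨hyB, hy⟩ hc
    exact hy fun _ => hc hyB

theorem eq_or_eq_neg_of_orthogonal {m n : Sp d} (hn : ‖n‖ = 1) (hm : ‖m‖ = 1)
    (h : ∀ v, ⟪n, v⟫_ℝ = 0 → ⟪m, v⟫_ℝ = 0) : m = n ∨ m = -n := by
  have hnn : ⟪n, n⟫_ℝ = 1 := by simp [hn]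
  have hmm : ⟪m, m⟫_ℝ = 1 := by simp [hm]
  set s := ⟪n, m⟫_ℝ with hs
  have hs' : ⟪m, n⟫_ℝ = s := real_inner_comm _ _
  have h1 : ⟪n, m - s • n⟫_ℝ = 0 := by
    rw [inner_sub_right, inner_smul_right, hnn]; simp [hs]
  have h2 := h _ h1
  have h3 : ⟪m - s • n, m - s • n⟫_ℝ = 0 := by
    rw [inner_sub_left, inner_smul_left, h1, h2]; simp
  have h4 : m = s • n := sub_eq_zero.1 (inner_self_eq_zero.1 h3)
  have h5 : s * s = 1 := by
    rw [inner_sub_right, inner_smul_right, hmm, hs'] at h2; linarith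
  rcases mul_self_eq_one_iff.1 h5 with h | h
  · left; rw [h4, h, one_smul]
  · right; rw [h4, h, neg_one_smul]

theorem volume_hyperplane {m : ℕ} {b : Sp m} (hb : b ≠ 0) (c : ℝ) :
    volume {y : Sp m | ⟪b, y⟫_ℝ = c} = 0 := by
  let s : AffineSubspace ℝ (Sp m) :=
    { carrier := {y : Sp m | ⟪b, y⟫_ℝ = c}
      smul_vsub_vadd_mem' := by
        intro r p₁ p₂ p₃ h₁ h₂ h₃
        simp only [mem_ofPred_eq] at h₁ h₂ h₃ ⊢
        simp [inner_add_right, inner_smul_right, inner_sub_right, h₁, h₂, h₃] }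
  refine Measure.addHaar_affineSubspace volume s fun hs => ?_
  have hmem : ∀ y : Sp m, ⟪b, y⟫_ℝ = c := fun y => by
    have : y ∈ s := hs ▸ AffineSubspace.mem_top ℝ _ y
    exact this
  have h0 := hmem 0
  have h1 := hmem b
  rw [inner_zero_right] at h0
  rw [← h0] at h1
  exact hb (inner_self_eq_zero.1 h1)

/-- A finite set of oriented hyperplanes `⟪n, x⟫ = c`, stored as pairs `(n, c)`, that contains each
of its members with both orientations. -/
structure IsArrangement (N : Finset (Sp d × ℝ)) : Prop where
  norm_eq : ∀ q ∈ N, ‖q.1‖ = 1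
  neg_mem : ∀ q ∈ N, -q ∈ N

/-- The union of the hyperplanes of an arrangement. -/
def walls (N : Finset (Sp d × ℝ)) : Set (Sp d) := {x | ∃ q ∈ N, ⟪q.1, x⟫_ℝ = q.2}

/-- The points that lie on at most one hyperplane of the arrangement. -/
def IsSimplePoint (N : Finset (Sp d × ℝ)) (x : Sp d) : Prop :=
  ∀ q ∈ N, ∀ q' ∈ N, ⟪q.1, x⟫_ℝ = q.2 → ⟪q'.1, x⟫_ℝ = q'.2 → q' = q ∨ q' = -q

theorem exists_isArrangement {α : Type*} [Finite α] {K : α → Set (Sp d)}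
    (hK : ∀ i, IsPolytope (K i)) :
    ∃ N, IsArrangement N ∧ ∀ i, frontier (K i) ⊆ walls N := by
  classical
  have := Fintype.ofFinite α
  choose H hH0 hH using fun i => (hK i).frontier_subset
  let f : Sp d × ℝ → Sp d × ℝ := fun h => (‖h.1‖⁻¹ • h.1, ‖h.1‖⁻¹ * h.2)
  let A := Finset.univ.biUnion fun i => (H i).image f
  have hA : ∀ q ∈ A, ‖q.1‖ = 1 := by
    intro q hq
    simp only [A, Finset.mem_biUnion, Finset.mem_univ, true_and, Finset.mem_image] at hq
    obtain ⟨i, h, hh, rfl⟩ := hq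
    have : ‖h.1‖ ≠ 0 := norm_ne_zero_iff.2 (hH0 i h hh)
    simp [f, norm_smul, this]
  refine ⟨A ∪ A.image Neg.neg, ⟨?_, ?_⟩, ?_⟩
  · intro q hq
    rcases Finset.mem_union.1 hq with hq | hq
    · exact hA q hq
    · obtain ⟨p, hp, rfl⟩ := Finset.mem_image.1 hq
      simpa using hA p hp
  · intro q hq
    rcases Finset.mem_union.1 hq with hq | hq
    · exact Finset.mem_union_right _ (Finset.mem_image_of_mem _ hq)
    · obtain ⟨p, hp, rfl⟩ := Finset.mem_image.1 hq
      rw [neg_neg]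
      exact Finset.mem_union_left _ hp
  · intro i x hx
    obtain ⟨h, hh, hx'⟩ := mem_iUnion₂.1 (hH i hx)
    refine ⟨f h, Finset.mem_union_left _ (Finset.mem_biUnion.2
      ⟨i, Finset.mem_univ _, Finset.mem_image_of_mem _ hh⟩), ?_⟩
    have hx' : ⟪h.1, x⟫_ℝ = h.2 := hx'
    simp [f, inner_smul_left, hx']

theorem ae_not_mem_inter_hyperplane (hd : 1 ≤ d) {q q' : Sp d × ℝ} (hq : ‖q.1‖ = 1)
    (hq' : ‖q'.1‖ = 1) (h1 : q' ≠ q) (h2 : q' ≠ -q) :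
    ∀ᵐ z ∂(Measure.euclideanHausdorffMeasure (d - 1) : Measure (Sp d)),
      ⟪q.1, z⟫_ℝ = q.2 → ⟪q'.1, z⟫_ℝ ≠ q'.2 := by
  have hqq : ⟪q.1, q.1⟫_ℝ = 1 := by simp [hq]
  obtain ⟨J, j, κ, hj⟩ := exists_isChart hd hq (hqq ▸ one_pos : 0 < ⟪q.1, q.1⟫_ℝ) q.2
  rw [hj.ae_hyperplane]
  let b := J.toContinuousLinearMap.adjoint q'.1
  have hb : ∀ y, ⟪b, y⟫_ℝ = ⟪q'.1, J y⟫_ℝ := fun y =>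
    ContinuousLinearMap.adjoint_inner_left _ _ _
  have hjb : ∀ y, ⟪q'.1, j y⟫_ℝ = q.2 * ⟪q'.1, q.1⟫_ℝ + ⟪b, y⟫_ℝ := fun y => by
    rw [hj.apply_eq, inner_add_right, inner_smul_right, hb]
  by_cases hb0 : b = 0
  · refine Eventually.of_forall fun y hy => ?_
    have h3 : q'.1 = q.1 ∨ q'.1 = -q.1 := by
      refine eq_or_eq_neg_of_orthogonal hq hq' fun v hv => ?_
      obtain ⟨y, rfl⟩ := hj.range_linear v hv
      rw [← hb, hb0, inner_zero_left]
    rw [hjb, hb0, inner_zero_left, add_zero] at hy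
    rcases h3 with h | h
    · refine h1 (Prod.ext h ?_)
      rw [h, hqq] at hy; linarith
    · refine h2 (Prod.ext h ?_)
      rw [h, inner_neg_left, hqq] at hy
      simp only [Prod.snd_neg]; linarith
  · rw [ae_iff]
    refine measure_mono_null ?_ (volume_hyperplane hb0 (q'.2 - q.2 * ⟪q'.1, q.1⟫_ℝ))
    intro y hy
    simp only [ne_eq, not_not, mem_ofPred_eq] at hy ⊢
    rw [hjb] at hy
    linarith

theorem IsArrangement.ae_isSimplePoint (hd : 1 ≤ d) {N : Finset (Sp d × ℝ)}
    (hN : IsArrangement N) :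
    ∀ᵐ z ∂(Measure.euclideanHausdorffMeasure (d - 1) : Measure (Sp d)), IsSimplePoint N z := by
  have h : ∀ q ∈ N, ∀ q' ∈ N,
      ∀ᵐ z ∂(Measure.euclideanHausdorffMeasure (d - 1) : Measure (Sp d)),
        ⟪q.1, z⟫_ℝ = q.2 → ⟪q'.1, z⟫_ℝ = q'.2 → q' = q ∨ q' = -q := by
    intro q hq q' hq'
    by_cases h1 : q' = q
    · exact Eventually.of_forall fun _ _ _ => Or.inl h1
    by_cases h2 : q' = -q
    · exact Eventually.of_forall fun _ _ _ => Or.inr h2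
    filter_upwards [ae_not_mem_inter_hyperplane hd (hN.norm_eq q hq) (hN.norm_eq q' hq') h1 h2]
      with z hz a b using absurd b (hz a)
  unfold IsSimplePoint
  rw [Filter.eventually_all_finset]
  intro q hq
  rw [Filter.eventually_all_finset]
  intro q' hq'
  exact h q hq q' hq'

theorem exists_ball_walls (N : Finset (Sp d × ℝ)) (x : Sp d) :
    ∃ r > 0, ∀ z ∈ Metric.ball x r, ∀ q ∈ N, ⟪q.1, z⟫_ℝ = q.2 → ⟪q.1, x⟫_ℝ = q.2 := by
  have h : ∀ᶠ z in 𝓝 x, ∀ q ∈ N, ⟪q.1, z⟫_ℝ = q.2 → ⟪q.1, x⟫_ℝ = q.2 := by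
    rw [Filter.eventually_all_finset]
    intro q _
    by_cases hx : ⟪q.1, x⟫_ℝ = q.2
    · exact Eventually.of_forall fun _ _ => hx
    · have ho : IsOpen {z : Sp d | ⟪q.1, z⟫_ℝ ≠ q.2} :=
        isOpen_ne_fun (by fun_prop) continuous_const
      filter_upwards [ho.mem_nhds hx] with z hz h using absurd h hz
  obtain ⟨r, hr, h⟩ := Metric.eventually_nhds_iff_ball.1 h
  exact ⟨r, hr, h⟩

theorem subset_of_disjoint_frontier {S K : Set (Sp d)} (hS : IsPreconnected S) (hK : IsOpen K)
    (hd : Disjoint S (frontier K)) (hne : (S ∩ K).Nonempty) : S ⊆ K := by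
  have hcov : S ⊆ K ∪ (closure K)ᶜ := by
    intro x hx
    by_cases hxc : x ∈ closure K
    · rw [closure_eq_self_union_frontier] at hxc
      exact hxc.elim Or.inl fun h => absurd h (disjoint_left.1 hd hx)
    · exact Or.inr hxc
  rcases hS.subset_or_subset hK isClosed_closure.isOpen_compl
    (disjoint_compl_right_iff_subset.2 subset_closure) hcov with h | h
  · exact h
  · obtain ⟨x, hxS, hxK⟩ := hne
    exact absurd (subset_closure hxK) (h hxS)

theorem convex_side (n x : Sp d) : Convex ℝ (side n x) := by
  have : side n x = {y | ⟪n, x⟫_ℝ < innerSL ℝ n y} := by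
    ext y; simp [side, inner_sub_right]
  rw [this]
  exact convex_halfSpace_gt (innerSL ℝ n).toLinearMap.isLinear _

theorem convex_half_ball (n x : Sp d) (r : ℝ) : Convex ℝ (side n x ∩ Metric.ball x r) :=
  (convex_side n x).inter (convex_ball x r)

theorem half_ball_nonempty {n : Sp d} (hn : ‖n‖ = 1) (x : Sp d) {r : ℝ} (hr : 0 < r) :
    (side n x ∩ Metric.ball x r).Nonempty :=
  (Metric.nonempty_ball.2 (half_pos hr)).mono (ball_subset_side_inter_ball hn x hr)

theorem mem_closure_side {n : Sp d} (hn : ‖n‖ = 1) {x z : Sp d} (hz : 0 ≤ ⟪n, z - x⟫_ℝ) :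
    z ∈ closure (side n x) := by
  have hnn : ⟪n, n⟫_ℝ = 1 := by simp [hn]
  have hlim : Tendsto (fun t : ℝ => z + t • n) (𝓝[>] 0) (𝓝 z) := by
    have : Continuous fun t : ℝ => z + t • n := by fun_prop
    have h := this.tendsto 0
    rw [zero_smul, add_zero] at h
    exact h.mono_left nhdsWithin_le_nhds
  refine mem_closure_of_tendsto hlim ?_
  filter_upwards [self_mem_nhdsWithin] with t ht
  have ht : 0 < t := ht
  change 0 < ⟪n, z + t • n - x⟫_ℝ
  rw [add_sub_right_comm, inner_add_right, inner_smul_right, hnn]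
  linarith

theorem mem_closure_side_inter {n : Sp d} (hn : ‖n‖ = 1) {x z : Sp d}
    (hz : 0 ≤ ⟪n, z - x⟫_ℝ) {U : Set (Sp d)} (hU : IsOpen U) (hzU : z ∈ U) :
    z ∈ closure (side n x ∩ U) := by
  have := hU.inter_closure ⟨hzU, mem_closure_side hn hz⟩
  rwa [inter_comm] at this

/-- Near a boundary point that lies on one hyperplane only, an open set with boundary in the walls
that lies on one side of its boundary is a half-ball. -/
theorem exists_half_ball_of_mem_frontier {N : Finset (Sp d × ℝ)} (hN : IsArrangement N)
    {K : Set (Sp d)} (hK : IsOpen K) (hKi : interior (closure K) = K)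
    (hKN : frontier K ⊆ walls N) {x : Sp d} (hx : x ∈ frontier K) (hxs : IsSimplePoint N x) :
    ∃ q ∈ N, ⟪q.1, x⟫_ℝ = q.2 ∧ ∃ r > 0, K ∩ Metric.ball x r = side q.1 x ∩ Metric.ball x r ∧
      Disjoint (side q.1 x ∩ Metric.ball x r) (walls N) := by
  obtain ⟨q, hq, hqx⟩ := hKN hx
  obtain ⟨r, hr, hw⟩ := exists_ball_walls N x
  have hx0 : ∀ n : Sp d, ⟪n, x - x⟫_ℝ = 0 := fun n => by simp
  have hdisj : ∀ p ∈ N, ⟪p.1, x⟫_ℝ = p.2 →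
      Disjoint (side p.1 x ∩ Metric.ball x r) (walls N) := by
    intro p hp hpx
    refine disjoint_left.2 fun z hz hzN => ?_
    obtain ⟨q', hq', hz'⟩ := hzN
    have h1 : 0 < ⟪p.1, z - x⟫_ℝ := hz.1
    have h2 := hw z hz.2 q' hq' hz'
    rw [inner_sub_right] at h1
    rcases hxs p hp q' hq' hpx h2 with rfl | rfl
    · linarith
    · simp only [Prod.fst_neg, inner_neg_left] at hz' h2
      linarith
  have hnq : ⟪(-q).1, x⟫_ℝ = (-q).2 := by simp [hqx]
  have key : ∀ p ∈ N, ⟪p.1, x⟫_ℝ = p.2 → side p.1 x ∩ Metric.ball x r ⊆ K ∨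
      Disjoint (side p.1 x ∩ Metric.ball x r) K := by
    intro p hp hpx
    by_cases hne : ((side p.1 x ∩ Metric.ball x r) ∩ K).Nonempty
    · exact Or.inl (subset_of_disjoint_frontier (convex_half_ball _ _ _).isPreconnected hK
        ((hdisj p hp hpx).mono_right hKN) hne)
    · exact Or.inr (disjoint_iff_inter_eq_empty.2 (not_nonempty_iff_eq_empty.1 hne))
  have conclude : ∀ p ∈ N, ⟪p.1, x⟫_ℝ = p.2 → side p.1 x ∩ Metric.ball x r ⊆ K →
      Disjoint (side (-p).1 x ∩ Metric.ball x r) K →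
      K ∩ Metric.ball x r = side p.1 x ∩ Metric.ball x r := by
    intro p hp hpx hin hout
    refine Subset.antisymm (fun z hz => ⟨?_, hz.2⟩) fun z hz => ⟨hin hz, hz.2⟩
    by_contra hzs
    have h1 : ¬ 0 < ⟪p.1, z - x⟫_ℝ := hzs
    have h2 : z ∈ closure (side (-p).1 x ∩ (Metric.ball x r ∩ K)) := by
      refine mem_closure_side_inter (hN.norm_eq _ (hN.neg_mem p hp)) ?_
        (Metric.isOpen_ball.inter hK) ⟨hz.2, hz.1⟩
      simp only [Prod.fst_neg, inner_neg_left]; linarith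
    obtain ⟨y, hy⟩ := closure_nonempty_iff.1 ⟨z, h2⟩
    exact disjoint_left.1 hout ⟨hy.1, hy.2.1⟩ hy.2.2
  have hcover : Metric.ball x r ⊆ closure (side q.1 x ∩ Metric.ball x r) ∪
      closure (side (-q).1 x ∩ Metric.ball x r) := by
    intro z hz
    rcases le_total 0 ⟪q.1, z - x⟫_ℝ with h | h
    · exact Or.inl (mem_closure_side_inter (hN.norm_eq q hq) h Metric.isOpen_ball hz)
    · refine Or.inr (mem_closure_side_inter (hN.norm_eq _ (hN.neg_mem q hq)) ?_
        Metric.isOpen_ball hz)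
      simp only [Prod.fst_neg, inner_neg_left]; linarith
  rcases key q hq hqx with h1 | h1 <;> rcases key (-q) (hN.neg_mem q hq) hnq with h2 | h2
  · exfalso
    have h3 : Metric.ball x r ⊆ closure K :=
      hcover.trans (union_subset (closure_mono h1) (closure_mono h2))
    have h4 : x ∈ interior (closure K) :=
      mem_interior.2 ⟨_, h3, Metric.isOpen_ball, Metric.mem_ball_self hr⟩
    rw [hKi] at h4
    rw [hK.frontier_eq] at hx
    exact hx.2 h4
  · exact ⟨q, hq, hqx, r, hr, conclude q hq hqx h1 h2, hdisj q hq hqx⟩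
  · exact ⟨-q, hN.neg_mem q hq, hnq, r, hr,
      conclude (-q) (hN.neg_mem q hq) hnq h2 (by rwa [neg_neg]), hdisj _ (hN.neg_mem q hq) hnq⟩
  · exfalso
    obtain ⟨z, hzb, hzK⟩ := mem_closure_iff.1 (frontier_subset_closure hx) _ Metric.isOpen_ball
      (Metric.mem_ball_self hr)
    rcases hcover hzb with h | h
    · obtain ⟨y, hyK, hy⟩ := mem_closure_iff.1 h K hK hzK
      exact disjoint_left.1 h1 hy hyK
    · obtain ⟨y, hyK, hy⟩ := mem_closure_iff.1 h K hK hzK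
      exact disjoint_left.1 h2 hy hyK

/-- The open cell cut out by a finite set of oriented hyperplanes. -/
def chamber (Q : Finset (Sp d × ℝ)) : Set (Sp d) := {z | ∀ q ∈ Q, q.2 < ⟪q.1, z⟫_ℝ}

theorem convex_chamber (Q : Finset (Sp d × ℝ)) : Convex ℝ (chamber Q) := by
  have : chamber Q = ⋂ q ∈ Q, {z | q.2 < innerSL ℝ q.1 z} := by
    ext z; simp [chamber]
  rw [this]
  exact convex_iInter₂ fun q _ => convex_halfSpace_gt (innerSL ℝ q.1).toLinearMap.isLinear _

theorem isOpen_chamber (Q : Finset (Sp d × ℝ)) : IsOpen (chamber Q) := by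
  have : chamber Q = ⋂ q ∈ Q, {z | q.2 < ⟪q.1, z⟫_ℝ} := by
    ext z; simp [chamber]
  rw [this]
  exact isOpen_biInter_finset fun q _ => isOpen_lt continuous_const (by fun_prop)

/-- Finitely many directions suffice to enter a bounded convex open set from its closure. -/
theorem exists_directions_of_convex {C : Set (Sp d)} (hC : Convex ℝ C) (ho : IsOpen C)
    (hb : Bornology.IsBounded C) (hne : C.Nonempty) :
    ∃ E : Finset (Sp d), ∀ x ∈ closure C, ∃ e ∈ E, ∀ t ∈ Ioo (0 : ℝ) 1, x + t • e ∈ C := by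
  classical
  obtain ⟨x₀, hx₀⟩ := hne
  obtain ⟨ρ, hρ, hρC⟩ := Metric.isOpen_iff.1 ho x₀ hx₀
  obtain ⟨s, -, hsf, hs⟩ := hb.isCompact_closure.finite_cover_balls hρ
  refine ⟨hsf.toFinset.image fun y => x₀ - y, fun x hx => ?_⟩
  obtain ⟨y, hy, hxy⟩ := mem_iUnion₂.1 (hs hx)
  refine ⟨x₀ - y, Finset.mem_image_of_mem _ (hsf.mem_toFinset.2 hy), fun t ht => ?_⟩
  have h1 : x₀ + (x - y) ∈ interior C := by
    rw [ho.interior_eq]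
    refine hρC ?_
    rw [Metric.mem_ball, dist_eq_norm] at hxy ⊢
    simpa using hxy
  have h2 := hC.combo_closure_interior_mem_interior hx h1 (by linarith [ht.2] : 0 ≤ 1 - t) ht.1
    (by ring)
  rw [ho.interior_eq] at h2
  convert h2 using 1
  module

theorem exists_directions {N : Finset (Sp d × ℝ)} (hN : IsArrangement N)
    {K : Set (Sp d)} (hK : IsOpen K) (hb : Bornology.IsBounded K)
    (hKN : frontier K ⊆ walls N) :
    ∃ E : Finset (Sp d), ∀ x, ∀ q ∈ N, ⟪q.1, x⟫_ℝ = q.2 → ∀ r > 0,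
      side q.1 x ∩ Metric.ball x r ⊆ K → Disjoint (side q.1 x ∩ Metric.ball x r) (walls N) →
      ∃ e ∈ E, 0 < ⟪q.1, e⟫_ℝ ∧ ∀ t ∈ Ioo (0 : ℝ) 1, x + t • e ∈ K := by
  classical
  have hex : ∀ Q : Finset (Sp d × ℝ), ∃ E : Finset (Sp d), (chamber Q).Nonempty →
      Bornology.IsBounded (chamber Q) →
      ∀ x ∈ closure (chamber Q), ∃ e ∈ E, ∀ t ∈ Ioo (0 : ℝ) 1, x + t • e ∈ chamber Q := by
    intro Q
    by_cases h : (chamber Q).Nonempty ∧ Bornology.IsBounded (chamber Q)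
    · obtain ⟨E, hE⟩ :=
        exists_directions_of_convex (convex_chamber Q) (isOpen_chamber Q) h.2 h.1
      exact ⟨E, fun _ _ => hE⟩
    · exact ⟨∅, fun h1 h2 => absurd ⟨h1, h2⟩ h⟩
  choose E hE using hex
  refine ⟨N.powerset.biUnion E, fun x q hq hqx r hr hin hdis => ?_⟩
  have hq1 := hN.norm_eq q hq
  obtain ⟨z₀, hz₀⟩ := half_ball_nonempty hq1 x hr
  let Q := N.filter fun p => p.2 < ⟪p.1, z₀⟫_ℝ
  have hz₀Q : z₀ ∈ chamber Q := fun p hp => (Finset.mem_filter.1 hp).2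
  have hQw : Disjoint (chamber Q) (walls N) := by
    refine disjoint_left.2 fun z hz => ?_
    rintro ⟨p, hp, hpz⟩
    rcases lt_trichotomy p.2 ⟪p.1, z₀⟫_ℝ with h | h | h
    · exact (hz p (Finset.mem_filter.2 ⟨hp, h⟩)).ne' hpz
    · exact disjoint_left.1 hdis hz₀ ⟨p, hp, h.symm⟩
    · have := hz (-p) (Finset.mem_filter.2 ⟨hN.neg_mem p hp, by simpa using h⟩)
      simp only [Prod.snd_neg, Prod.fst_neg, inner_neg_left, neg_lt_neg_iff] at this
      exact this.ne hpz
  have hsub : side q.1 x ∩ Metric.ball x r ⊆ chamber Q := by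
    intro z hz p hp
    obtain ⟨hpN, hp⟩ := Finset.mem_filter.1 hp
    have ho : IsOpen {z : Sp d | p.2 < ⟪p.1, z⟫_ℝ} := isOpen_lt continuous_const (by fun_prop)
    refine subset_of_disjoint_frontier (convex_half_ball q.1 x r).isPreconnected ho ?_
      ⟨z₀, hz₀, hp⟩ hz
    refine hdis.mono_right fun y hy => ?_
    have := frontier_lt_subset_eq continuous_const (by fun_prop) hy
    exact ⟨p, hpN, (this : p.2 = ⟪p.1, y⟫_ℝ).symm⟩
  have hQK : chamber Q ⊆ K := subset_of_disjoint_frontier (convex_chamber Q).isPreconnected hK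
    (hQw.mono_right hKN) ⟨z₀, hz₀Q, hin hz₀⟩
  have hxc : x ∈ closure (chamber Q) := by
    refine closure_mono hsub (mem_closure_side_inter hq1 ?_ Metric.isOpen_ball
      (Metric.mem_ball_self hr))
    simp
  obtain ⟨e, he, het⟩ := hE Q ⟨z₀, hz₀Q⟩ (hb.subset hQK) x hxc
  refine ⟨e, Finset.mem_biUnion.2 ⟨Q, Finset.mem_powerset.2 (Finset.filter_subset _ _), he⟩, ?_,
    fun t ht => hQK (het t ht)⟩
  have hqQ : q ∈ Q := by
    refine Finset.mem_filter.2 ⟨hq, ?_⟩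
    have : 0 < ⟪q.1, z₀ - x⟫_ℝ := hz₀.1
    rw [inner_sub_right] at this
    linarith
  have := het (1 / 2) ⟨by norm_num, by norm_num⟩ q hqQ
  rw [inner_add_right, inner_smul_right] at this
  linarith

theorem eq_of_half_ball_subset_side {n m x : Sp d} (hn : ‖n‖ = 1) (hm : ‖m‖ = 1) {r : ℝ}
    (hr : 0 < r) (h : side n x ∩ Metric.ball x r ⊆ side m x) : n = m := by
  by_contra hne
  have hnn : ⟪n, n⟫_ℝ = 1 := by simp [hn]
  have hmm : ⟪m, m⟫_ℝ = 1 := by simp [hm]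
  have h1 : ⟪n, m⟫_ℝ < 1 := (inner_lt_one_iff_real_of_norm_eq_one hn hm).2 hne
  have h2 : ⟪m, n⟫_ℝ = ⟪n, m⟫_ℝ := real_inner_comm _ _
  have hz : x + (r / 4) • (n - m) ∈ side n x ∩ Metric.ball x r := by
    constructor
    · change 0 < ⟪n, x + (r / 4) • (n - m) - x⟫_ℝ
      rw [add_sub_cancel_left, inner_smul_right, inner_sub_right, hnn]
      exact mul_pos (by positivity) (by linarith)
    · rw [Metric.mem_ball, dist_eq_norm, add_sub_cancel_left, norm_smul,
        Real.norm_of_nonneg (by positivity)]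
      have := norm_sub_le n m
      rw [hn, hm] at this
      nlinarith
  have h3 : 0 < ⟪m, x + (r / 4) • (n - m) - x⟫_ℝ := h hz
  rw [add_sub_cancel_left, inner_smul_right, inner_sub_right, hmm, h2] at h3
  have := pos_of_mul_pos_right h3 (by positivity)
  linarith

theorem exists_wall_of_half_ball {N : Finset (Sp d × ℝ)} (hN : IsArrangement N)
    {K : Set (Sp d)} (hK : IsPolytope K) (hKN : frontier K ⊆ walls N) {x : Sp d}
    (hx : x ∈ frontier K) (hxs : IsSimplePoint N x) {n : Sp d} (hn : ‖n‖ = 1) {r : ℝ}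
    (hr : 0 < r) (hnK : side n x ∩ Metric.ball x r ⊆ K) :
    ∃ q ∈ N, q.1 = n ∧ ⟪q.1, x⟫_ℝ = q.2 ∧ ∃ r > 0, side q.1 x ∩ Metric.ball x r ⊆ K ∧
      Disjoint (side q.1 x ∩ Metric.ball x r) (walls N) := by
  obtain ⟨q, hq, hqx, s, hs, heq, hdis⟩ :=
    exists_half_ball_of_mem_frontier hN hK.isOpen hK.interior_closure hKN hx hxs
  refine ⟨q, hq, ?_, hqx, s, hs, heq ▸ inter_subset_left, hdis⟩
  refine (eq_of_half_ball_subset_side (x := x) hn (hN.norm_eq q hq) (lt_min hr hs) fun z hz => ?_).symm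
  have hz1 := hnK ⟨hz.1, Metric.ball_subset_ball (min_le_left _ _) hz.2⟩
  have hz2 : z ∈ K ∩ Metric.ball x s :=
    ⟨hz1, Metric.ball_subset_ball (min_le_right _ _) hz.2⟩
  rw [heq] at hz2
  exact hz2.1

variable {Ω : Set (Sp d)} {ι : Type*}

theorem Mesh.exists_cell_of_disjoint (T : Mesh Ω ι) {S : Set (Sp d)} (hS : IsPreconnected S)
    (hne : S.Nonempty) (hSΩ : S ⊆ Ω) (hd : ∀ i, Disjoint S (frontier (T.cell i))) :
    ∃ i, S ⊆ T.cell i := by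
  obtain ⟨z, hz⟩ := hne
  obtain ⟨i, hi⟩ := mem_iUnion.1 (T.cover (hSΩ hz))
  refine ⟨i, subset_of_disjoint_frontier hS (T.isPolytope i).isOpen (hd i) ⟨z, hz, ?_⟩⟩
  rw [closure_eq_self_union_frontier] at hi
  exact hi.resolve_right (disjoint_left.1 (hd i) hz)

theorem Mesh.not_mem_cell_of_mem_frontier (T : Mesh Ω ι) {i k : ι} {x : Sp d}
    (hx : x ∈ frontier (T.cell k)) : x ∉ T.cell i := by
  intro hi
  by_cases h : i = k
  · subst h
    rw [(T.isPolytope i).isOpen.frontier_eq] at hx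
    exact hx.2 hi
  · obtain ⟨z, hzi, hzk⟩ := mem_closure_iff.1 (frontier_subset_closure hx) _
      (T.isPolytope i).isOpen hi
    exact disjoint_left.1 (T.disjoint h) hzi hzk

theorem mem_frontier_of_half_ball {K : Set (Sp d)} (hK : IsOpen K) {n x : Sp d} (hn : ‖n‖ = 1)
    {r : ℝ} (hr : 0 < r) (h : side n x ∩ Metric.ball x r ⊆ K) (hx : x ∉ K) :
    x ∈ frontier K := by
  rw [hK.frontier_eq]
  refine ⟨closure_mono h (mem_closure_side_inter hn ?_ Metric.isOpen_ball
    (Metric.mem_ball_self hr)), hx⟩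
  simp

theorem Mesh.exists_half_ball_of_mem_skeleton (T : Mesh Ω ι) (hΩ : IsOpen Ω) {n x : Sp d}
    (hx : x ∈ T.skeleton) (hn : IsUnitNormalAt T.skeleton n x) :
    ∃ i, x ∈ frontier (T.cell i) ∧ ∃ r > 0, side n x ∩ Metric.ball x r ⊆ T.cell i := by
  obtain ⟨hn1, r, hr, hS⟩ := hn
  obtain ⟨s, hs, hsΩ⟩ := Metric.isOpen_iff.1 hΩ x hx.1
  have hr' : 0 < min r s := lt_min hr hs
  have hsub : side n x ∩ Metric.ball x (min r s) ⊆ Ω := fun z hz =>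
    hsΩ (Metric.ball_subset_ball (min_le_right _ _) hz.2)
  obtain ⟨i, hi⟩ := T.exists_cell_of_disjoint (convex_half_ball n x _).isPreconnected
    (half_ball_nonempty hn1 x hr') hsub (fun i => disjoint_left.2 fun z hz hzi => by
      have h1 : z ∈ T.skeleton ∩ Metric.ball x r :=
        ⟨⟨hsub hz, mem_iUnion.2 ⟨i, hzi⟩⟩, Metric.ball_subset_ball (min_le_left _ _) hz.2⟩
      rw [hS] at h1
      have h2 : ⟪n, z - x⟫_ℝ = 0 := h1.1
      have h3 : 0 < ⟪n, z - x⟫_ℝ := hz.1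
      linarith)
  obtain ⟨k, hk⟩ := mem_iUnion.1 hx.2
  exact ⟨i, mem_frontier_of_half_ball (T.isPolytope i).isOpen hn1 hr' hi
    (T.not_mem_cell_of_mem_frontier hk), _, hr', hi⟩

theorem IsUnitNormalAt.neg {S : Set (Sp d)} {n x : Sp d} (h : IsUnitNormalAt S n x) :
    IsUnitNormalAt S (-n) x := by
  obtain ⟨h1, r, hr, h2⟩ := h
  exact ⟨by rwa [norm_neg], r, hr, by simpa [inner_neg_left] using h2⟩

theorem Mesh.exists_half_ball_of_mem_frontier (T : Mesh Ω ι) (hΩ : IsPolytope Ω)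
    {N : Finset (Sp d × ℝ)} (hN : IsArrangement N) (hΩN : frontier Ω ⊆ walls N)
    (hTN : ∀ i, frontier (T.cell i) ⊆ walls N) {x : Sp d} (hx : x ∈ frontier Ω)
    (hxs : IsSimplePoint N x) :
    ∃ i n, ‖n‖ = 1 ∧ x ∈ frontier (T.cell i) ∧ ∃ r > 0, side n x ∩ Metric.ball x r ⊆ T.cell i ∧
      Ω ∩ Metric.ball x r = side n x ∩ Metric.ball x r := by
  obtain ⟨q, hq, hqx, r, hr, heq, hdis⟩ :=
    BrokenSobolev.exists_half_ball_of_mem_frontier hN hΩ.isOpen hΩ.interior_closure hΩN hx hxs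
  have hq1 := hN.norm_eq q hq
  obtain ⟨i, hi⟩ := T.exists_cell_of_disjoint (convex_half_ball q.1 x r).isPreconnected
    (half_ball_nonempty hq1 x hr) (heq ▸ inter_subset_left) fun i => hdis.mono_right (hTN i)
  refine ⟨i, q.1, hq1, mem_frontier_of_half_ball (T.isPolytope i).isOpen hq1 hr hi fun h => ?_,
    r, hr, hi, heq⟩
  rw [hΩ.isOpen.frontier_eq] at hx
  exact hx.2 (T.subset i h)

theorem sq_intervalIntegral_le {f : ℝ → ℝ} (hf : MemLp f 2) {t : ℝ} (ht : 0 < t) :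
    (∫ s in (0 : ℝ)..t, f s) ^ 2 ≤ t * ∫ s in (0 : ℝ)..t, f s ^ 2 := by
  have hi : IntervalIntegrable f volume 0 t :=
    ((hf.locallyIntegrable one_le_two).integrableOn_isCompact isCompact_uIcc).intervalIntegrable
  have hi2 : IntervalIntegrable (fun s => f s ^ 2) volume 0 t :=
    hf.integrable_sq.intervalIntegrable
  set I := ∫ s in (0 : ℝ)..t, f s with hI
  have h0 : 0 ≤ ∫ s in (0 : ℝ)..t, (f s ^ 2 - 2 * (I / t) * f s + (I / t) ^ 2) := by
    refine intervalIntegral.integral_nonneg ht.le fun s _ => ?_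
    have : f s ^ 2 - 2 * (I / t) * f s + (I / t) ^ 2 = (f s - I / t) ^ 2 := by ring
    rw [this]
    exact sq_nonneg _
  rw [intervalIntegral.integral_add (hi2.sub (hi.const_mul _))
    (continuous_const.intervalIntegrable _ _), intervalIntegral.integral_sub hi2 (hi.const_mul _),
    intervalIntegral.integral_const_mul, intervalIntegral.integral_const, ← hI, smul_eq_mul,
    sub_zero] at h0
  have h1 : 2 * (I / t) * I = 2 * I ^ 2 / t := by ring
  have h2 : t * (I / t) ^ 2 = I ^ 2 / t := by field_simp
  rw [h1, h2] at h0
  have h3 : I ^ 2 / t ≤ ∫ s in (0 : ℝ)..t, f s ^ 2 := by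
    have : 2 * I ^ 2 / t = 2 * (I ^ 2 / t) := by ring
    linarith
  rw [div_le_iff₀ ht] at h3
  linarith

theorem sq_value_le {f γ : ℝ → ℝ} (hf : MemLp f 2) (hγ : MemLp γ 2) {a : ℝ}
    (h : ∀ᵐ t : ℝ, t ∈ Ioo (0 : ℝ) 1 → f t = a + ∫ s in (0 : ℝ)..t, γ s) :
    a ^ 2 ≤ ∫ t in Ioo (0 : ℝ) 1, (2 * f t ^ 2 + 2 * γ t ^ 2) := by
  have hγi : IntegrableOn (fun t => γ t ^ 2) (Ioo 0 1) := hγ.integrable_sq.integrableOn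
  have hfi : IntegrableOn (fun t => f t ^ 2) (Ioo 0 1) := hf.integrable_sq.integrableOn
  set D := ∫ t in Ioo (0 : ℝ) 1, γ t ^ 2 with hD
  have h1 : ∫ _ in Ioo (0 : ℝ) 1, a ^ 2 ≤ ∫ t in Ioo (0 : ℝ) 1, (2 * f t ^ 2 + 2 * D) := by
    refine integral_mono_ae (integrableOn_const (by simp))
      ((hfi.const_mul 2).add (integrableOn_const (by simp))) ?_
    filter_upwards [ae_restrict_of_ae h, ae_restrict_mem measurableSet_Ioo] with t ht htI
    have e1 := ht htI
    have e2 := sq_intervalIntegral_le hγ htI.1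
    have e3 : ∫ s in (0 : ℝ)..t, γ s ^ 2 ≤ D := by
      rw [intervalIntegral.integral_of_le htI.1.le]
      exact setIntegral_mono_set hγi (Eventually.of_forall fun _ => sq_nonneg _)
        (LE.le.eventuallyLE (Ioc_subset_Ioo_right htI.2))
    have e4 : 0 ≤ ∫ s in (0 : ℝ)..t, γ s ^ 2 :=
      intervalIntegral.integral_nonneg htI.1.le fun _ _ => sq_nonneg _
    have e5 : (∫ s in (0 : ℝ)..t, γ s) ^ 2 ≤ D := by nlinarith [htI.2]
    have e6 : a = f t - ∫ s in (0 : ℝ)..t, γ s := by linarith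
    have e7 := sq_nonneg (f t + ∫ s in (0 : ℝ)..t, γ s)
    rw [e6]
    nlinarith
  have hv : volume.real (Ioo (0 : ℝ) 1) = 1 := by simp [measureReal_def]
  rw [setIntegral_const, hv, one_smul, integral_add (hfi.const_mul 2)
    (integrableOn_const (by simp)), setIntegral_const, hv, one_smul] at h1
  rwa [integral_add (hfi.const_mul 2) (hγi.const_mul 2), integral_const_mul (μ := _) (2 : ℝ)
    (fun t => γ t ^ 2)]

/-- `w` is piecewise `H¹` on the mesh, with the broken gradient `g`. -/
structure IsBrokenPair (T : Mesh Ω ι) (w : Sp d → ℝ) (g : Sp d → Sp d) : Prop where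
  l1l2 : L1L2 w
  measurable : Measurable g
  l1l2_inner : ∀ e, L1L2 fun x => ⟪g x, e⟫_ℝ
  dirDeriv : ∀ i e, DirDeriv (T.cell i) w (fun x => ⟪g x, e⟫_ℝ) e

theorem exists_trace_bound (hd : 1 ≤ d) [Fintype ι] (T : Mesh Ω ι)
    {N : Finset (Sp d × ℝ)} (hN : IsArrangement N)
    (hTN : ∀ i, frontier (T.cell i) ⊆ walls N) :
    ∃ C : ℝ≥0∞, C ≠ ⊤ ∧ ∀ w g, IsBrokenPair T w g → ∃ B : Sp d → ℝ≥0∞, Measurable B ∧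
      ∫⁻ x, B x ∂(Measure.euclideanHausdorffMeasure (d - 1) : Measure (Sp d)) ≤
        C * ∫⁻ x, ENNReal.ofReal (w x ^ 2 + ‖g x‖ ^ 2) ∧
      ∀ᵐ x ∂(Measure.euclideanHausdorffMeasure (d - 1) : Measure (Sp d)),
        ∀ i, x ∈ frontier (T.cell i) → ∀ n, ‖n‖ = 1 →
          (∃ r > 0, side n x ∩ Metric.ball x r ⊆ T.cell i) →
          ∃ a, HasTraceAt (side n x) w x a ∧ ENNReal.ofReal (a ^ 2) ≤ B x := by
  classical
  choose E hE using fun i => exists_directions hN (T.isPolytope i).isOpen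
    (T.isPolytope i).isBounded (hTN i)
  let F : Finset ((Sp d × ℝ) × Sp d) :=
    (N ×ˢ Finset.univ.biUnion E).filter fun f => 0 < ⟪f.1.1, f.2⟫_ℝ
  have hF : ∀ f ∈ F, ‖f.1.1‖ = 1 ∧ 0 < ⟪f.1.1, f.2⟫_ℝ := by
    intro f hf
    obtain ⟨h1, h2⟩ := Finset.mem_filter.1 hf
    exact ⟨hN.norm_eq _ (Finset.mem_product.1 h1).1, h2⟩
  have hchart : ∀ f : (Sp d × ℝ) × Sp d, ∃ κ : ℝ≥0∞, κ ≠ ⊤ ∧ (f ∈ F →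
      ∃ J j, IsChart f.1.1 f.2 f.1.2 J j κ) := by
    intro f
    by_cases hf : f ∈ F
    · obtain ⟨J, j, κ, hj⟩ := exists_isChart hd (hF f hf).1 (hF f hf).2 f.1.2
      exact ⟨κ, hj.ne_top, fun _ => ⟨J, j, hj⟩⟩
    · exact ⟨0, by simp, fun h => absurd h hf⟩
  choose κ hκt hκ using hchart
  let c : (Sp d × ℝ) × Sp d → ℝ≥0∞ := fun f => ENNReal.ofReal (2 * (1 + ‖f.2‖ ^ 2))
  refine ⟨∑ f ∈ F, c f * κ f, (ENNReal.sum_lt_top.2 fun f _ =>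
    ENNReal.mul_lt_top ENNReal.ofReal_lt_top (hκt f).lt_top).ne, fun w g hwg => ?_⟩
  let u : Sp d → ℝ≥0∞ := fun x => ENNReal.ofReal (w x ^ 2 + ‖g x‖ ^ 2)
  have hu : Measurable u :=
    ((hwg.l1l2.measurable.pow_const 2).add (hwg.measurable.norm.pow_const 2)).ennreal_ofReal
  have hms : ∀ f : (Sp d × ℝ) × Sp d, MeasurableSet {x : Sp d | ⟪f.1.1, x⟫_ℝ = f.1.2} := fun f =>
    (isClosed_eq (by fun_prop) continuous_const).measurableSet
  let v : (Sp d × ℝ) × Sp d → Sp d → ℝ≥0∞ := fun f x =>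
    c f * ∫⁻ t in Ioo (0 : ℝ) 1, u (x + t • f.2)
  have hv : ∀ f, Measurable (v f) := by
    intro f
    refine Measurable.const_mul ?_ _
    exact Measurable.lintegral_prod_right' (ν := volume.restrict (Ioo (0 : ℝ) 1))
      (f := fun p : Sp d × ℝ => u (p.1 + p.2 • f.2)) (hu.comp (by fun_prop))
  refine ⟨fun x => ∑ f ∈ F, {x : Sp d | ⟪f.1.1, x⟫_ℝ = f.1.2}.indicator (v f) x, ?_, ?_, ?_⟩
  · exact Finset.measurable_sum _ fun f _ => (hv f).indicator (hms f)
  · rw [lintegral_finsetSum _ fun f _ => (hv f).indicator (hms f), Finset.sum_mul]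
    refine Finset.sum_le_sum fun f hf => ?_
    obtain ⟨J, j, hj⟩ := hκ f hf
    rw [lintegral_indicator (hms f), ← hj.map_eq,
      lintegral_map (hv f) hj.isometry.continuous.measurable, mul_assoc, ← hj.lintegral_eq hu,
      lintegral_const_mul _ ?_]
    · gcongr with y
      exact Measure.restrict_le_self
    · exact Measurable.lintegral_prod_right' (ν := volume.restrict (Ioo (0 : ℝ) 1))
        (f := fun p : Sp (d - 1) × ℝ => u (j p.1 + p.2 • f.2))
        (hu.comp ((hj.isometry.continuous.measurable.comp measurable_fst).add
          (measurable_snd.smul_const _)))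
  · have h1 : ∀ᵐ x ∂(Measure.euclideanHausdorffMeasure (d - 1) : Measure (Sp d)),
        ∀ f ∈ F, ∀ i, ⟪f.1.1, x⟫_ℝ = f.1.2 →
          (∃ r > 0, side f.1.1 x ∩ Metric.ball x r ⊆ T.cell i) →
          LineAC (T.cell i) w (fun x => ⟪g x, f.2⟫_ℝ) f.2 x ∧
          ∃ a, HasLineTrace (T.cell i) w (fun x => ⟪g x, f.2⟫_ℝ) f.1.1 f.2 x a := by
      rw [Filter.eventually_all_finset]
      intro f hf
      rw [Filter.eventually_all]
      intro i
      obtain ⟨J, j, hj⟩ := hκ f hf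
      have hl := hj.ae_hyperplane.2 ((hwg.dirDeriv i f.2).ae_lineAC (T.isPolytope i).isOpen hj
        hwg.l1l2 (hwg.l1l2_inner f.2))
      filter_upwards [(hwg.dirDeriv i f.2).ae_exists_hasLineTrace hd (T.isPolytope i).isOpen
        (hF f hf).1 (hF f hf).2 f.1.2 hwg.l1l2 (hwg.l1l2_inner f.2), hl] with x hx hx' hxf hr
      exact ⟨hx' hxf, hx hxf hr⟩
    filter_upwards [h1, hN.ae_isSimplePoint hd] with x hx hxs i hxi n hn hr
    obtain ⟨r, hr, hrK⟩ := hr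
    obtain ⟨q, hq, rfl, hqx, s, hs, hsK, hdis⟩ :=
      exists_wall_of_half_ball hN (T.isPolytope i) (hTN i) hxi hxs hn hr hrK
    obtain ⟨e, he, hqe, het⟩ := hE i x q hq hqx s hs hsK hdis
    have hfF : (q, e) ∈ F := Finset.mem_filter.2 ⟨Finset.mem_product.2
      ⟨hq, Finset.mem_biUnion.2 ⟨i, Finset.mem_univ _, he⟩⟩, hqe⟩
    obtain ⟨hl, a, ha1, ha2⟩ := hx _ hfF i hqx ⟨r, hr, hrK⟩
    refine ⟨a, ha1, ?_⟩
    refine le_trans ?_ (Finset.single_le_sum (f := fun f : (Sp d × ℝ) × Sp d =>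
      {x : Sp d | ⟪f.1.1, x⟫_ℝ = f.1.2}.indicator (v f) x) (fun _ _ => zero_le) hfF)
    have hmem : x ∈ {x : Sp d | ⟪q.1, x⟫_ℝ = q.2} := hqx
    change _ ≤ {x : Sp d | ⟪q.1, x⟫_ℝ = q.2}.indicator (v (q, e)) x
    rw [indicator_of_mem hmem]
    have h2 := sq_value_le hl.memLp hl.memLp_deriv (ha2 1 one_pos het)
    have hii : IntegrableOn (fun t : ℝ => 2 * w (x + t • e) ^ 2 + 2 * ⟪g (x + t • e), e⟫_ℝ ^ 2)
        (Ioo 0 1) :=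
      ((hl.memLp.integrable_sq.const_mul 2).add
        (hl.memLp_deriv.integrable_sq.const_mul 2)).integrableOn
    refine (ENNReal.ofReal_le_ofReal h2).trans ?_
    rw [ofReal_integral_eq_lintegral_ofReal hii (Eventually.of_forall fun t => by positivity)]
    have hut : Measurable fun t : ℝ => u (x + t • e) := hu.comp (by fun_prop)
    change _ ≤ c (q, e) * ∫⁻ t in Ioo (0 : ℝ) 1, u (x + t • e)
    rw [← lintegral_const_mul _ hut]
    refine lintegral_mono fun t => ?_
    rw [← ENNReal.ofReal_mul (by positivity)]
    refine ENNReal.ofReal_le_ofReal ?_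
    have h3 := abs_real_inner_le_norm (g (x + t • e)) e
    have h4 : ⟪g (x + t • e), e⟫_ℝ ^ 2 ≤ ‖g (x + t • e)‖ ^ 2 * ‖e‖ ^ 2 := by
      rw [← sq_abs, ← mul_pow]
      gcongr
    have h5 : 0 ≤ ‖e‖ ^ 2 * w (x + t • e) ^ 2 := by positivity
    have h6 : 0 ≤ ‖g (x + t • e)‖ ^ 2 := by positivity
    change 2 * w (x + t • e) ^ 2 + 2 * ⟪g (x + t • e), e⟫_ℝ ^ 2 ≤ _
    nlinarith

/-- Near `t`, the function `f` is an antiderivative of `γ`, up to a constant and a null set. -/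
def IsACNear (f γ : ℝ → ℝ) (t : ℝ) : Prop :=
  ∃ δ > 0, ∃ a, ∀ᵐ s : ℝ, s ∈ Ioo (t - δ) (t + δ) → f s = a + ∫ r in (0 : ℝ)..s, γ r

/-- Near points where `f` is an antiderivative of `γ`, the difference of `f` and a global
antiderivative of `γ` is locally constant. -/
theorem exists_locally_constant (f γ : ℝ → ℝ) :
    ∃ F : ℝ → ℝ, ∀ t, IsACNear f γ t → ∃ δ > 0, ∃ a, (∀ s ∈ Ioo (t - δ) (t + δ), F s = a) ∧
      ∀ᵐ s : ℝ, s ∈ Ioo (t - δ) (t + δ) → f s = a + ∫ r in (0 : ℝ)..s, γ r := by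
  classical
  have h : ∀ t, ∃ b, ∀ δ > 0, ∀ a,
      (∀ᵐ s : ℝ, s ∈ Ioo (t - δ) (t + δ) → f s = a + ∫ r in (0 : ℝ)..s, γ r) → b = a := by
    intro t
    by_cases ht : IsACNear f γ t
    · obtain ⟨δ, hδ, b, hb⟩ := ht
      refine ⟨b, fun δ' hδ' a ha => ?_⟩
      obtain ⟨s, hs, h1, h2⟩ := exists_mem_Ioo_of_ae (hb.and ha)
        (show t < t + min δ δ' by have := lt_min hδ hδ'; linarith)
      have e1 := h1 ⟨by linarith [hs.1], by linarith [hs.2, min_le_left δ δ']⟩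
      have e2 := h2 ⟨by linarith [hs.1], by linarith [hs.2, min_le_right δ δ']⟩
      linarith
    · exact ⟨0, fun δ hδ a ha => absurd ⟨δ, hδ, a, ha⟩ ht⟩
  choose F hF using h
  refine ⟨F, fun t ht => ?_⟩
  obtain ⟨δ, hδ, a, ha⟩ := ht
  refine ⟨δ, hδ, a, fun s hs => ?_, ha⟩
  have h1 : 0 < min (s - (t - δ)) (t + δ - s) := lt_min (by linarith [hs.1]) (by linarith [hs.2])
  refine hF s _ h1 a ?_
  filter_upwards [ha] with r hr hrs
  refine hr ⟨?_, ?_⟩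
  · linarith [hrs.1, min_le_left (s - (t - δ)) (t + δ - s)]
  · linarith [hrs.2, min_le_right (s - (t - δ)) (t + δ - s)]

theorem Ioo_sub_add_mem_nhds (t : ℝ) {δ : ℝ} (hδ : 0 < δ) : Ioo (t - δ) (t + δ) ∈ 𝓝 t :=
  Ioo_mem_nhds (by linarith) (by linarith)

theorem integral_locally_constant_mul_deriv {F ψ : ℝ → ℝ} (hψ : ContDiff ℝ 1 ψ)
    (hc : HasCompactSupport ψ)
    (hF : ∀ t ∈ tsupport ψ, ∃ δ > 0, ∃ a, ∀ s ∈ Ioo (t - δ) (t + δ), F s = a) :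
    Integrable (fun t => F t * deriv ψ t) ∧ ∫ t, F t * deriv ψ t = 0 := by
  have hFe : ∀ t ∈ tsupport ψ, ∃ a, F =ᶠ[𝓝 t] fun _ => a := by
    intro t ht
    obtain ⟨δ, hδ, a, ha⟩ := hF t ht
    exact ⟨a, by filter_upwards [Ioo_sub_add_mem_nhds t hδ] with s hs using ha s hs⟩
  have hψ0 : ∀ t ∉ tsupport ψ, ψ =ᶠ[𝓝 t] fun _ => 0 := by
    intro t ht
    exact notMem_tsupport_iff_eventuallyEq.1 ht
  have hd : ∀ t, HasDerivAt (fun s => F s * ψ s) (F t * deriv ψ t) t := by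
    intro t
    have hψd : HasDerivAt ψ (deriv ψ t) t := (hψ.differentiable (by simp) t).hasDerivAt
    by_cases ht : t ∈ tsupport ψ
    · obtain ⟨a, ha⟩ := hFe t ht
      have h1 : HasDerivAt F 0 t := (hasDerivAt_const t a).congr_of_eventuallyEq ha
      have h2 := h1.mul hψd
      rw [zero_mul, zero_add] at h2
      exact h2
    · have h0 := hψ0 t ht
      have h1 : deriv ψ t = 0 := by rw [h0.deriv_eq]; simp
      rw [h1, mul_zero]
      refine (hasDerivAt_const t (0 : ℝ)).congr_of_eventuallyEq ?_
      filter_upwards [h0] with s hs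
      rw [hs, mul_zero]
  have hcont : Continuous fun t => F t * deriv ψ t := by
    refine continuous_iff_continuousAt.2 fun t => ?_
    have hψc : ContinuousAt (deriv ψ) t := (hψ.continuous_deriv le_rfl).continuousAt
    by_cases ht : t ∈ tsupport ψ
    · obtain ⟨a, ha⟩ := hFe t ht
      exact (continuousAt_const.congr ha.symm).mul hψc
    · have h0 := (hψ0 t ht).deriv
      refine (continuousAt_const (y := (0 : ℝ))).congr ?_
      filter_upwards [h0] with s hs
      rw [hs]; simp
  have hi : Integrable fun t => F t * deriv ψ t :=
    hcont.integrable_of_hasCompactSupport hc.deriv.mul_left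
  refine ⟨hi, integral_eq_zero_of_hasDerivAt_of_integrable hd hi ?_⟩
  exact (continuous_iff_continuousAt.2 fun t => (hd t).continuousAt).integrable_of_hasCompactSupport
    hc.mul_left

theorem integral_antideriv_mul_deriv {γ ψ : ℝ → ℝ} (hγ : LocallyIntegrable γ)
    (hψ : ContDiff ℝ 1 ψ) (hc : HasCompactSupport ψ) :
    Integrable (fun t => (∫ r in (0 : ℝ)..t, γ r) * deriv ψ t + γ t * ψ t) ∧
      ∫ t, ((∫ r in (0 : ℝ)..t, γ r) * deriv ψ t + γ t * ψ t) = 0 := by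
  have hγi : ∀ a b, IntervalIntegrable γ volume a b := fun a b =>
    (hγ.integrableOn_isCompact isCompact_uIcc).intervalIntegrable
  set Γ : ℝ → ℝ := fun t => ∫ r in (0 : ℝ)..t, γ r with hΓ
  have hΓc : Continuous Γ := intervalIntegral.continuous_primitive hγi 0
  have i1 : Integrable fun t => Γ t * deriv ψ t :=
    (hΓc.mul (hψ.continuous_deriv le_rfl)).integrable_of_hasCompactSupport hc.deriv.mul_left
  have i2 : Integrable fun t => γ t * ψ t := by
    simpa [mul_comm] using hγ.integrable_smul_left_of_hasCompactSupport hψ.continuous hc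
  refine ⟨i1.add i2, ?_⟩
  obtain ⟨R, hR⟩ := hc.isCompact.isBounded.subset_ball (0 : ℝ)
  have hR' : tsupport ψ ⊆ Ioo (-R) R := by
    intro t ht
    have := hR ht
    rw [Real.ball_eq_Ioo] at this
    simpa using this
  have hRR : ψ R = 0 ∧ ψ (-R) = 0 :=
    ⟨image_eq_zero_of_notMem_tsupport fun h => (hR' h).2.false,
      image_eq_zero_of_notMem_tsupport fun h => (hR' h).1.false⟩
  have hsupp : Function.support (fun t => Γ t * deriv ψ t + γ t * ψ t) ⊆ Ioc (-R) R := by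
    intro t ht
    by_contra hcon
    have h1 : t ∉ tsupport ψ := fun h => hcon (Ioo_subset_Ioc_self (hR' h))
    have h2 : deriv ψ t = 0 := by
      rw [(notMem_tsupport_iff_eventuallyEq.1 h1).deriv_eq]; simp
    exact ht (by simp [h2, image_eq_zero_of_notMem_tsupport h1])
  rw [← intervalIntegral.integral_eq_integral_of_support_subset hsupp]
  by_cases hR0 : (0 : ℝ) ≤ R
  · have hΓac : AbsolutelyContinuousOnInterval Γ (-R) R :=
      (hγi (-R) R).absolutelyContinuousOnInterval_intervalIntegral
        (by rw [uIcc_of_le (by linarith)]; exact ⟨by linarith, hR0⟩)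
    obtain ⟨C, hC⟩ := hψ.lipschitzWith_of_hasCompactSupport hc one_ne_zero
    have hψac : AbsolutelyContinuousOnInterval ψ (-R) R :=
      hC.lipschitzOnWith.absolutelyContinuousOnInterval
    have h1 := hΓac.integral_deriv_mul_eq_sub hψac
    rw [hRR.1, hRR.2, mul_zero, mul_zero, sub_zero] at h1
    rw [← h1]
    refine intervalIntegral.integral_congr_ae ?_
    filter_upwards [(hγi (-R) R).ae_hasDerivAt_integral] with t ht htR
    have h2 : HasDerivAt Γ (γ t) t := ht (uIoc_subset_uIcc htR) 0
      (by rw [uIcc_of_le (by linarith)]; exact ⟨by linarith, hR0⟩)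
    rw [h2.deriv, add_comm]
  · have hz : ∀ t, ψ t = 0 := fun t => image_eq_zero_of_notMem_tsupport fun h => by
      have := hR' h
      linarith [this.1, this.2]
    have hz' : ψ = fun _ => 0 := funext hz
    simp [hz']

theorem integral_mul_deriv_add_eq_zero {f γ ψ : ℝ → ℝ} (hγ : LocallyIntegrable γ)
    (hψ : ContDiff ℝ 1 ψ) (hc : HasCompactSupport ψ) (h : ∀ t ∈ tsupport ψ, IsACNear f γ t) :
    ∫ t, (f t * deriv ψ t + γ t * ψ t) = 0 := by
  obtain ⟨F, hF⟩ := exists_locally_constant f γ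
  have h1 := integral_locally_constant_mul_deriv (F := F) hψ hc fun t ht => by
    obtain ⟨δ, hδ, a, ha, -⟩ := hF t (h t ht)
    exact ⟨δ, hδ, a, ha⟩
  have h2 := integral_antideriv_mul_deriv hγ hψ hc
  have hae : ∀ᵐ t, t ∈ tsupport ψ → f t = F t + ∫ r in (0 : ℝ)..t, γ r := by
    rw [ae_iff]
    refine measure_null_of_locally_null _ fun t ht => ?_
    simp only [mem_ofPred_eq, Classical.not_imp] at ht
    obtain ⟨δ, hδ, a, ha, hae⟩ := hF t (h t ht.1)
    refine ⟨Ioo (t - δ) (t + δ) ∩ {s | ¬ (s ∈ tsupport ψ → f s = F s + ∫ r in (0 : ℝ)..s, γ r)},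
      inter_mem (mem_nhdsWithin_of_mem_nhds (Ioo_sub_add_mem_nhds t hδ)) self_mem_nhdsWithin, ?_⟩
    refine measure_mono_null ?_ (ae_iff.1 hae)
    rintro s ⟨hs, hs'⟩ hcon
    exact hs' fun _ => by rw [ha s hs]; exact hcon hs
  have h3 : ∫ t, (f t * deriv ψ t + γ t * ψ t) = ∫ t, (F t * deriv ψ t +
      ((∫ r in (0 : ℝ)..t, γ r) * deriv ψ t + γ t * ψ t)) := by
    refine integral_congr_ae ?_
    filter_upwards [hae] with t ht
    by_cases hts : t ∈ tsupport ψ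
    · rw [ht hts]; ring
    · have : deriv ψ t = 0 := by
        rw [(notMem_tsupport_iff_eventuallyEq.1 hts).deriv_eq]; simp
      rw [this]; ring
  rw [h3, integral_add h1.1 h2.1, h1.2, h2.2, add_zero]

theorem IsACNear.shift {f γ : ℝ → ℝ} (hγ : LocallyIntegrable γ) {t : ℝ}
    (h : IsACNear (fun s => f (t + s)) (fun s => γ (t + s)) 0) : IsACNear f γ t := by
  obtain ⟨δ, hδ, a, ha⟩ := h
  refine ⟨δ, hδ, a - ∫ r in (0 : ℝ)..t, γ r, ?_⟩
  have hγi : ∀ a b, IntervalIntegrable γ volume a b := fun a b =>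
    (hγ.integrableOn_isCompact isCompact_uIcc).intervalIntegrable
  filter_upwards [(measurePreserving_sub_right (volume : Measure ℝ) t).quasiMeasurePreserving.ae
    ha] with s hs hst
  have h1 := hs ⟨by linarith [hst.1], by linarith [hst.2]⟩
  rw [add_sub_cancel, intervalIntegral.integral_comp_add_left, add_zero, add_sub_cancel] at h1
  have h2 := intervalIntegral.integral_add_adjacent_intervals (hγi 0 t) (hγi t s)
  linarith

theorem LineAC.isACNear {K : Set (Sp d)} (hK : IsOpen K) {w G : Sp d → ℝ} {e z : Sp d}
    (h : LineAC K w G e z) {t : ℝ} (ht : z + t • e ∈ K) :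
    IsACNear (fun s => w (z + s • e)) (fun s => G (z + s • e)) t := by
  have hcont : Continuous fun s : ℝ => z + s • e := by fun_prop
  obtain ⟨δ, hδ, hδK⟩ := Metric.isOpen_iff.1 (hK.preimage hcont) t ht
  rw [Real.ball_eq_Ioo] at hδK
  obtain ⟨τ, hτ, h'⟩ := exists_mem_Ioo_of_ae h.ae_eq (show t - δ < t + δ by linarith)
  refine ⟨δ, hδ, w (z + τ • e) - ∫ s in (0 : ℝ)..τ, G (z + s • e), ?_⟩
  filter_upwards [h'] with s hs hst
  have h1 := hs fun r hr => hδK ((ordConnected_Ioo.uIcc_subset hτ hst) hr)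
  have h2 := intervalIntegral.integral_add_adjacent_intervals (h.intervalIntegrable 0 τ)
    (h.intervalIntegrable τ s)
  linarith

/-- Equal line traces from both sides of a point. -/
theorem isACNear_of_hasLineTrace {K K' : Set (Sp d)} {w G G' : Sp d → ℝ} {n e z : Sp d} {a : ℝ}
    (hG : ∀ x, G' x = - G x) {δ δ' : ℝ} (hδ : 0 < δ) (hδ' : 0 < δ')
    (hK : ∀ t ∈ Ioo 0 δ, z + t • e ∈ K) (hK' : ∀ t ∈ Ioo 0 δ', z + t • (-e) ∈ K')
    (h : HasLineTrace K w G n e z a) (h' : HasLineTrace K' w G' (-n) (-e) z a) :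
    IsACNear (fun s => w (z + s • e)) (fun s => G (z + s • e)) 0 := by
  have h1 := h.2 δ hδ hK
  have h2 := (Measure.measurePreserving_neg (volume : Measure ℝ)).quasiMeasurePreserving.ae
    (h'.2 δ' hδ' hK')
  have h3 : ∀ᵐ s : ℝ, s ≠ 0 := by simp [ae_iff]
  refine ⟨min δ δ', lt_min hδ hδ', a, ?_⟩
  filter_upwards [h1, h2, h3] with s hs1 hs2 hs3 hs
  rcases lt_or_gt_of_ne hs3 with h0 | h0
  · have := hs2 ⟨by linarith, by linarith [hs.1, min_le_right δ δ']⟩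
    rw [smul_neg, neg_smul, neg_neg] at this
    rw [this]
    congr 1
    have e1 : ∀ r : ℝ, G' (z + r • (-e)) = - G (z + (-r) • e) := fun r => by
      rw [hG, smul_neg, neg_smul]
    simp only [e1]
    rw [intervalIntegral.integral_neg,
      intervalIntegral.integral_comp_neg (fun r => G (z + r • e)), neg_neg, neg_zero,
      intervalIntegral.integral_symm, neg_neg]
  · exact hs1 ⟨h0, by linarith [hs.2, min_le_left δ δ']⟩

theorem HasTraceAt.trace_eq {S : Set (Sp d)} {w : Sp d → ℝ} {x : Sp d} {a : ℝ}
    (h : HasTraceAt S w x a) : trace S w x = a :=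
  h.limUnder_eq

theorem exists_line_in_half_ball {n e : Sp d} (hne : 0 < ⟪n, e⟫_ℝ) {z : Sp d} {r : ℝ} (hr : 0 < r) :
    ∃ δ > 0, ∀ t ∈ Ioo (0 : ℝ) δ, z + t • e ∈ side n z ∩ Metric.ball z r := by
  refine ⟨r / (‖e‖ + 1), by positivity, fun t ht => ⟨?_, ?_⟩⟩
  · change 0 < ⟪n, z + t • e - z⟫_ℝ
    rw [add_sub_cancel_left, inner_smul_right]
    exact mul_pos ht.1 hne
  · rw [Metric.mem_ball, dist_eq_norm, add_sub_cancel_left, norm_smul,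
      Real.norm_of_nonneg ht.1.le]
    have := (lt_div_iff₀ (by positivity)).1 ht.2
    nlinarith [ht.1]

theorem Mesh.measurableSet_skeleton [Finite ι] (T : Mesh Ω ι) (hΩ : IsOpen Ω) :
    MeasurableSet T.skeleton :=
  hΩ.measurableSet.inter (isClosed_iUnion_of_finite fun _ => isClosed_frontier).measurableSet

theorem IsUnitNormalField.ae_mem [Finite ι] {T : Mesh Ω ι} (hΩ : IsOpen Ω) {ν : Sp d → Sp d}
    (hν : IsUnitNormalField T.skeleton ν) :
    ∀ᵐ x ∂(Measure.euclideanHausdorffMeasure (d - 1) : Measure (Sp d)),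
      x ∈ T.skeleton → IsUnitNormalAt T.skeleton (ν x) x :=
  (ae_restrict_iff' (T.measurableSet_skeleton hΩ)).1 hν.2

/-- A simple point of the skeleton lies between two cells, and its normal is that of a wall. -/
theorem Mesh.exists_cells_of_mem_skeleton (T : Mesh Ω ι) (hΩ : IsOpen Ω)
    {N : Finset (Sp d × ℝ)} (hN : IsArrangement N)
    (hTN : ∀ i, frontier (T.cell i) ⊆ walls N) {q : Sp d × ℝ} (hq : q ∈ N) {n x : Sp d}
    (hqx : ⟪q.1, x⟫_ℝ = q.2) (hx : x ∈ T.skeleton) (hxs : IsSimplePoint N x)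
    (hn : IsUnitNormalAt T.skeleton n x) :
    (n = q.1 ∨ n = -q.1) ∧ (∃ i, ∃ r > 0, side q.1 x ∩ Metric.ball x r ⊆ T.cell i) ∧
      ∃ i, ∃ r > 0, side (-q.1) x ∩ Metric.ball x r ⊆ T.cell i := by
  obtain ⟨i, hi, r, hr, hri⟩ := T.exists_half_ball_of_mem_skeleton hΩ hx hn
  obtain ⟨k, hk, s, hs, hsk⟩ := T.exists_half_ball_of_mem_skeleton hΩ hx hn.neg
  obtain ⟨p, hp, hpn, hpx, -⟩ :=
    exists_wall_of_half_ball hN (T.isPolytope i) (hTN i) hi hxs hn.1 hr hri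
  have hnq : n = q.1 ∨ n = -q.1 := by
    rcases hxs q hq p hp hqx hpx with rfl | rfl
    · exact Or.inl hpn.symm
    · exact Or.inr hpn.symm
  refine ⟨hnq, ?_⟩
  rcases hnq with rfl | rfl
  · exact ⟨⟨i, r, hr, hri⟩, ⟨k, s, hs, hsk⟩⟩
  · rw [neg_neg] at hsk
    exact ⟨⟨k, s, hs, hsk⟩, ⟨i, r, hr, hri⟩⟩

theorem jump_eq {ν : Sp d → Sp d} {w : Sp d → ℝ} {x : Sp d} {a b : ℝ}
    (ha : HasTraceAt (side (ν x) x) w x a) (hb : HasTraceAt (side (-ν x) x) w x b) :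
    jump ν w x = a - b := by
  rw [jump, ha.trace_eq, hb.trace_eq]

theorem jump_eq_zero_iff {ν : Sp d → Sp d} {w : Sp d → ℝ} {x n : Sp d} {a b : ℝ}
    (hν : ν x = n ∨ ν x = -n) (ha : HasTraceAt (side n x) w x a)
    (hb : HasTraceAt (side (-n) x) w x b) : jump ν w x = 0 ↔ a = b := by
  rcases hν with h | h
  · rw [jump_eq (h ▸ ha) (h ▸ hb), sub_eq_zero]
  · have h' : -ν x = n := by rw [h, neg_neg]
    rw [jump_eq (by rwa [h]) (by rwa [h']), sub_eq_zero, eq_comm]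

/-- Traces on both sides of a wall. -/
theorem ae_hasLineTrace_both (hd : 1 ≤ d) [Finite ι] {K : ι → Set (Sp d)}
    (hK : ∀ i, IsOpen (K i)) {w : Sp d → ℝ} {g : Sp d → Sp d} {n e : Sp d} (hn : ‖n‖ = 1)
    (hne : 0 < ⟪n, e⟫_ℝ) (c : ℝ) (hw : L1L2 w) (hg : ∀ e, L1L2 fun x => ⟪g x, e⟫_ℝ)
    (h : ∀ i e, DirDeriv (K i) w (fun x => ⟪g x, e⟫_ℝ) e) :
    ∀ᵐ z ∂(Measure.euclideanHausdorffMeasure (d - 1) : Measure (Sp d)), ⟪n, z⟫_ℝ = c →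
      ∀ i k, (∃ r > 0, side n z ∩ Metric.ball z r ⊆ K i) →
        (∃ r > 0, side (-n) z ∩ Metric.ball z r ⊆ K k) → ∃ a b,
          HasLineTrace (K i) w (fun x => ⟪g x, e⟫_ℝ) n e z a ∧
          HasLineTrace (K k) w (fun x => ⟪g x, -e⟫_ℝ) (-n) (-e) z b := by
  have h1 := ae_all_iff.2 fun i =>
    (h i e).ae_exists_hasLineTrace hd (hK i) hn hne c hw (hg e)
  have h2 := ae_all_iff.2 fun i =>
    (h i (-e)).ae_exists_hasLineTrace hd (hK i) (by rwa [norm_neg])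
      (by rwa [inner_neg_neg] : 0 < ⟪-n, -e⟫_ℝ) (-c) hw (hg (-e))
  filter_upwards [h1, h2] with z hz1 hz2 hzc i k hi hk
  obtain ⟨a, ha⟩ := hz1 i hzc hi
  obtain ⟨b, hb⟩ := hz2 k (by rw [inner_neg_left, hzc]) hk
  exact ⟨a, b, ha, hb⟩

theorem IsBrokenPair.ae_isACNear_skeleton (hd : 1 ≤ d) [Finite ι] (hΩ : IsOpen Ω)
    {T : Mesh Ω ι} {N : Finset (Sp d × ℝ)} (hN : IsArrangement N)
    (hTN : ∀ i, frontier (T.cell i) ⊆ walls N) {ν : Sp d → Sp d}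
    (hν : IsUnitNormalField T.skeleton ν) {w : Sp d → ℝ} {g : Sp d → Sp d}
    (h : IsBrokenPair T w g) (hj : ∀ᵐ x ∂surface T.skeleton, jump ν w x = 0)
    {q : Sp d × ℝ} (hq : q ∈ N) {e : Sp d} (hqe : 0 < ⟪q.1, e⟫_ℝ) :
    ∀ᵐ z ∂(Measure.euclideanHausdorffMeasure (d - 1) : Measure (Sp d)),
      ⟪q.1, z⟫_ℝ = q.2 → z ∈ T.skeleton →
        IsACNear (fun s => w (z + s • e)) (fun s => ⟪g (z + s • e), e⟫_ℝ) 0 := by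
  have hj' := (ae_restrict_iff' (T.measurableSet_skeleton hΩ)).1 hj
  filter_upwards [ae_hasLineTrace_both hd (fun i => (T.isPolytope i).isOpen) (hN.norm_eq q hq) hqe
    q.2 h.l1l2 h.l1l2_inner h.dirDeriv, hj', hν.ae_mem hΩ, hN.ae_isSimplePoint hd]
    with z hz hzj hzν hzs hzq hzS
  obtain ⟨hνq, ⟨i, r, hr, hi⟩, ⟨k, s, hs, hk⟩⟩ :=
    T.exists_cells_of_mem_skeleton hΩ hN hTN hq hzq hzS hzs (hzν hzS)
  obtain ⟨a, b, ha, hb⟩ := hz hzq i k ⟨r, hr, hi⟩ ⟨s, hs, hk⟩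
  have hab : a = b := (jump_eq_zero_iff hνq ha.1 hb.1).1 (hzj hzS)
  subst hab
  obtain ⟨δ, hδ, hδi⟩ := exists_line_in_half_ball hqe (z := z) hr
  obtain ⟨δ', hδ', hδk⟩ := exists_line_in_half_ball
    (by rwa [inner_neg_neg] : 0 < ⟪-q.1, -e⟫_ℝ) (z := z) hs
  exact isACNear_of_hasLineTrace (fun x => inner_neg_right _ _) hδ hδ'
    (fun t ht => hi (hδi t ht)) (fun t ht => hk (hδk t ht)) ha hb

theorem IsBrokenPair.ae_line_isACNear (hd : 1 ≤ d) [Finite ι] (hΩ : IsOpen Ω)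
    {T : Mesh Ω ι} {N : Finset (Sp d × ℝ)} (hN : IsArrangement N)
    (hTN : ∀ i, frontier (T.cell i) ⊆ walls N) {ν : Sp d → Sp d}
    (hν : IsUnitNormalField T.skeleton ν) {w : Sp d → ℝ} {g : Sp d → Sp d}
    (h : IsBrokenPair T w g) (hj : ∀ᵐ x ∂surface T.skeleton, jump ν w x = 0) (e : Sp d) :
    ∀ᵐ x, ∀ t : ℝ, x + t • e ∈ T.skeleton →
      IsACNear (fun s => w (x + t • e + s • e)) (fun s => ⟪g (x + t • e + s • e), e⟫_ℝ) 0 := by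
  have key : ∀ q ∈ N, ∀ᵐ x, ∀ t : ℝ, ⟪q.1, x + t • e⟫_ℝ = q.2 → 0 ≤ ⟪q.1, e⟫_ℝ →
      x + t • e ∈ T.skeleton →
      IsACNear (fun s => w (x + t • e + s • e)) (fun s => ⟪g (x + t • e + s • e), e⟫_ℝ) 0 := by
    intro q hq
    rcases lt_trichotomy 0 ⟪q.1, e⟫_ℝ with hqe | hqe | hqe
    · obtain ⟨J, j, κ, hch⟩ := exists_isChart hd (hN.norm_eq q hq) hqe q.2
      have h1 := hch.ae_hyperplane.1
        (h.ae_isACNear_skeleton hd hΩ hN hTN hν hj hq hqe)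
      filter_upwards [hch.ae_line (Q := fun z => z ∈ T.skeleton →
        IsACNear (fun s => w (z + s • e)) (fun s => ⟪g (z + s • e), e⟫_ℝ) 0) h1] with x hx t ht _ using hx t ht
    · have hq0 : q.1 ≠ 0 := fun h0 => by have := hN.norm_eq q hq; simp [h0] at this
      have h1 : ∀ᵐ x : Sp d, ⟪q.1, x⟫_ℝ ≠ q.2 := by
        rw [ae_iff]
        simpa using volume_hyperplane hq0 q.2
      filter_upwards [h1] with x hx t ht
      rw [inner_add_right, inner_smul_right, ← hqe, mul_zero, add_zero] at ht
      exact absurd ht hx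
    · exact Eventually.of_forall fun x t _ h0 => absurd hqe h0.not_gt
  filter_upwards [(Filter.eventually_all_finset N).2 key] with x hx t ht
  obtain ⟨i, hi⟩ := mem_iUnion.1 ht.2
  obtain ⟨q, hq, hqx⟩ := hTN i hi
  rcases le_total 0 ⟪q.1, e⟫_ℝ with h0 | h0
  · exact hx q hq t hqx h0 ht
  · exact hx (-q) (hN.neg_mem q hq) t (by simp only [Prod.fst_neg, Prod.snd_neg, inner_neg_left, hqx])
      (by simp only [Prod.fst_neg, inner_neg_left]; linarith) ht

/-- A piecewise `H¹` function without jumps has a weak gradient on the whole domain. -/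
theorem IsBrokenPair.dirDeriv_of_jump_eq_zero (hd : 1 ≤ d) [Finite ι] (hΩ : IsOpen Ω)
    {T : Mesh Ω ι} {N : Finset (Sp d × ℝ)} (hN : IsArrangement N)
    (hTN : ∀ i, frontier (T.cell i) ⊆ walls N) {ν : Sp d → Sp d}
    (hν : IsUnitNormalField T.skeleton ν) {w : Sp d → ℝ} {g : Sp d → Sp d}
    (h : IsBrokenPair T w g) (hj : ∀ᵐ x ∂surface T.skeleton, jump ν w x = 0) (e : Sp d) :
    DirDeriv Ω w (fun x => ⟪g x, e⟫_ℝ) e := by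
  intro φ hφ hc hs
  by_cases he : e = 0
  · subst he; simp
  have hen : 0 < ‖e‖ := norm_pos_iff.2 he
  have hn : ‖‖e‖⁻¹ • e‖ = 1 := by rw [norm_smul, norm_inv, norm_norm, inv_mul_cancel₀ hen.ne']
  have hne : 0 < ⟪‖e‖⁻¹ • e, e⟫_ℝ := by
    rw [inner_smul_left, real_inner_self_eq_norm_sq]
    simp only [conj_trivial]
    positivity
  obtain ⟨J, j, κ, hch⟩ := exists_isChart hd hn hne 0
  obtain ⟨M, hM⟩ := hc.exists_bound_of_continuous hφ.continuous
  obtain ⟨M', hM'⟩ := (hasCompactSupport_fderiv_apply hc e).exists_bound_of_continuous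
    (continuous_fderiv_apply hφ e)
  have i1 : Integrable fun x => w x * fderiv ℝ φ x e :=
    h.l1l2.integrable.mul_bdd (c := M') (continuous_fderiv_apply hφ e).aestronglyMeasurable
      (Eventually.of_forall hM')
  have i2 : Integrable fun x => ⟪g x, e⟫_ℝ * φ x :=
    (h.l1l2_inner e).integrable.mul_bdd (c := M) hφ.continuous.aestronglyMeasurable
      (Eventually.of_forall hM)
  have hline : ∀ᵐ y, ∫ t : ℝ, (w (j y + t • e) * fderiv ℝ φ (j y + t • e) e
      + ⟪g (j y + t • e), e⟫_ℝ * φ (j y + t • e)) = 0 := by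
    have h1 := ae_all_iff.2 fun i => (h.dirDeriv i e).ae_lineAC (T.isPolytope i).isOpen hch
      h.l1l2 (h.l1l2_inner e)
    filter_upwards [h1, hch.ae_memLp (h.l1l2_inner e),
      hch.ae_ae (h.ae_line_isACNear hd hΩ hN hTN hν hj e)] with y hy1 hy2 hy3
    obtain ⟨t₀, -, ht₀⟩ := exists_mem_Ioo_of_ae hy3 one_pos
    have hγ := hy2.locallyIntegrable one_le_two
    have hψ : ContDiff ℝ ∞ fun t : ℝ => φ (j y + t • e) :=
      hφ.comp (contDiff_const.add (contDiff_id.smul contDiff_const))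
    have hcl : Topology.IsClosedEmbedding fun t : ℝ => j y + t • e :=
      (Homeomorph.addLeft (j y)).isClosedEmbedding.comp (isClosedEmbedding_smul_left he)
    have hψc : HasCompactSupport fun t : ℝ => φ (j y + t • e) := hc.comp_isClosedEmbedding hcl
    have hder : ∀ t : ℝ, deriv (fun t : ℝ => φ (j y + t • e)) t
        = fderiv ℝ φ (j y + t • e) e := by
      intro t
      have h2 : HasDerivAt (fun t : ℝ => j y + t • e) e t := by
        simpa using ((hasDerivAt_id t).smul_const e).const_add (j y)
      exact (((hφ.differentiable (by simp)) _).hasFDerivAt.comp_hasDerivAt t h2).deriv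
    have h4 := integral_mul_deriv_add_eq_zero (f := fun t : ℝ => w (j y + t • e)) hγ
      (hψ.of_le (by simp)) hψc fun t ht => ?_
    · simpa only [hder] using h4
    · have htΩ : j y + t • e ∈ Ω := hs (tsupport_comp_subset_preimage φ hcl.continuous ht)
      obtain ⟨i, hi⟩ := mem_iUnion.1 (T.cover htΩ)
      rw [closure_eq_self_union_frontier] at hi
      rcases hi with hi | hi
      · exact (hy1 i).isACNear (T.isPolytope i).isOpen hi
      · have e1 : ∀ s : ℝ, j y + t₀ • e + (t - t₀) • e + s • e = j y + (t + s) • e := fun s => by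
          module
        have e2 : j y + t₀ • e + (t - t₀) • e = j y + t • e := by module
        have h5 := ht₀ (t - t₀) (by rw [e2]; exact ⟨htΩ, mem_iUnion.2 ⟨i, hi⟩⟩)
        simp only [e1] at h5
        exact IsACNear.shift hγ h5
  have h6 := hch.integral_eq (i1.add i2)
  have h7 : ∫ y, ∫ t : ℝ, ((fun x => w x * fderiv ℝ φ x e) + fun x => ⟪g x, e⟫_ℝ * φ x)
      (j y + t • e) = 0 := integral_eq_zero_of_ae hline
  rw [h7] at h6
  have hκ : κ.toReal ≠ 0 := (ENNReal.toReal_pos hch.ne_zero hch.ne_top).ne'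
  have h8 := (mul_eq_zero.1 h6.symm).resolve_left hκ
  have h9 : ∫ z, ((fun x => w x * fderiv ℝ φ x e) + fun x => ⟪g x, e⟫_ℝ * φ x) z
      = (∫ x, w x * fderiv ℝ φ x e) + ∫ x, ⟪g x, e⟫_ℝ * φ x := integral_add i1 i2
  rw [h9] at h8
  linarith

/-- An `H¹` function on the whole domain has no jumps. -/
theorem ae_jump_eq_zero (hd : 1 ≤ d) [Finite ι] (hΩ : IsOpen Ω)
    {T : Mesh Ω ι} {N : Finset (Sp d × ℝ)} (hN : IsArrangement N)
    (hTN : ∀ i, frontier (T.cell i) ⊆ walls N) {ν : Sp d → Sp d}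
    (hν : IsUnitNormalField T.skeleton ν) {w : Sp d → ℝ} {g : Sp d → Sp d}
    (hw : L1L2 w) (hg : ∀ e, L1L2 fun x => ⟪g x, e⟫_ℝ)
    (h : ∀ e, DirDeriv Ω w (fun x => ⟪g x, e⟫_ℝ) e) :
    ∀ᵐ x ∂surface T.skeleton, jump ν w x = 0 := by
  rw [surface, ae_restrict_iff' (T.measurableSet_skeleton hΩ)]
  have key : ∀ q ∈ N, ∀ᵐ z ∂(Measure.euclideanHausdorffMeasure (d - 1) : Measure (Sp d)),
      ⟪q.1, z⟫_ℝ = q.2 → z ∈ Ω → ∃ a, HasTraceAt (side q.1 z) w z a ∧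
        HasTraceAt (side (-q.1) z) w z a := by
    intro q hq
    have hq1 := hN.norm_eq q hq
    have hqq : 0 < ⟪q.1, q.1⟫_ℝ := by
      rw [real_inner_self_eq_norm_sq, hq1]; norm_num
    obtain ⟨J, j, κ, hch⟩ := exists_isChart hd hq1 hqq q.2
    have hl := hch.ae_hyperplane.2 ((h q.1).ae_lineAC hΩ hch hw (hg q.1))
    filter_upwards [ae_hasLineTrace_both hd (ι := Unit) (K := fun _ => Ω) (fun _ => hΩ) hq1 hqq
      q.2 hw hg (fun _ e => h e), hl] with z hz hzl hzq hzΩ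
    obtain ⟨r, hr, hrΩ⟩ := Metric.isOpen_iff.1 hΩ z hzΩ
    have hs : ∀ n : Sp d, side n z ∩ Metric.ball z r ⊆ Ω := fun n =>
      inter_subset_right.trans hrΩ
    obtain ⟨a, b, ha, hb⟩ := hz hzq () () ⟨r, hr, hs _⟩ ⟨r, hr, hs _⟩
    have hab : a = b := by
      obtain ⟨δ, hδ, hδi⟩ := exists_line_in_half_ball hqq (z := z) hr
      obtain ⟨δ', hδ', hδk⟩ := exists_line_in_half_ball
        (by rwa [inner_neg_neg] : 0 < ⟪-q.1, -q.1⟫_ℝ) (z := z) hr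
      obtain ⟨ε, hε, c, hc⟩ := (hzl hzq).isACNear hΩ (t := 0) (by simpa using hzΩ)
      have hc1 : ∀ᵐ t : ℝ, t ∈ Ioo 0 ε → w (z + t • q.1) = c + ∫ s in (0 : ℝ)..t,
          ⟪g (z + s • q.1), q.1⟫_ℝ := by
        filter_upwards [hc] with t ht hte using ht ⟨by linarith [hte.1], by linarith [hte.2]⟩
      have hc2 : ∀ᵐ t : ℝ, t ∈ Ioo 0 ε → w (z + t • (-q.1)) = c + ∫ s in (0 : ℝ)..t,
          ⟪g (z + s • (-q.1)), -q.1⟫_ℝ := by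
        filter_upwards [(Measure.measurePreserving_neg
          (volume : Measure ℝ)).quasiMeasurePreserving.ae hc] with t ht hte
        have h1 := ht ⟨by linarith [hte.2], by linarith [hte.1]⟩
        have e1 : ∀ s : ℝ, ⟪g (z + s • (-q.1)), -q.1⟫_ℝ = -⟪g (z + (-s) • q.1), q.1⟫_ℝ :=
          fun s => by rw [smul_neg, neg_smul, inner_neg_right]
        simp only [e1]
        rw [smul_neg, ← neg_smul, h1, intervalIntegral.integral_neg,
          intervalIntegral.integral_comp_neg (fun s => ⟪g (z + s • q.1), q.1⟫_ℝ), neg_zero,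
          intervalIntegral.integral_symm]
      have ha' := ha.2 δ hδ fun t ht => hs _ (hδi t ht)
      have hb' := hb.2 δ' hδ' fun t ht => hs _ (hδk t ht)
      have e1 : a = c := LineAC.value_unique (w := w) (G := fun x => ⟪g x, q.1⟫_ℝ) (e := q.1)
        (z := z) hδ hε ha' hc1
      have e2 : b = c := LineAC.value_unique (w := w) (G := fun x => ⟪g x, -q.1⟫_ℝ)
        (e := -q.1) (z := z) hδ' hε hb' hc2
      rw [e1, e2]
    exact ⟨a, ha.1, hab ▸ hb.1⟩
  filter_upwards [(Filter.eventually_all_finset N).2 key, hν.ae_mem hΩ, hN.ae_isSimplePoint hd]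
    with x hx hxν hxs hxS
  obtain ⟨i, hi⟩ := mem_iUnion.1 hxS.2
  obtain ⟨q, hq, hqx⟩ := hTN i hi
  obtain ⟨hνq, -⟩ := T.exists_cells_of_mem_skeleton hΩ hN hTN hq hqx hxS hxs (hxν hxS)
  obtain ⟨a, ha, hb⟩ := hx q hq hqx hxS.1
  exact (jump_eq_zero_iff hνq ha hb).2 rfl

theorem L1L2.indicator {K : Set (Sp d)} (hK : MeasurableSet K) (ht : volume K ≠ ⊤)
    {f : Sp d → ℝ} (hm : Measurable f) (hf : MemLp f 2 (volume.restrict K)) :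
    L1L2 (K.indicator f) := by
  have : IsFiniteMeasure (volume.restrict K) := ⟨by simpa using ht.lt_top⟩
  exact ⟨hm.indicator hK, (integrable_indicator_iff hK).2 (hf.integrable one_le_two),
    (memLp_indicator_iff_restrict hK).2 hf⟩

theorem IsWeakGradient.dirDeriv {K : Set (Sp d)} {u w : Sp d → ℝ}
    {g g' : Sp d → Sp d} (h : IsWeakGradient K u g) (hw : w =ᵐ[volume.restrict K] u)
    (hg : g' =ᵐ[volume.restrict K] g) (e : Sp d) : DirDeriv K w (fun x => ⟪g' x, e⟫_ℝ) e := by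
  intro φ hφ hc hs
  have h1 : ∫ x, w x * fderiv ℝ φ x e = ∫ x in K, u x * fderiv ℝ φ x e := by
    rw [← setIntegral_eq_integral_of_forall_compl_eq_zero (s := K) fun x hx => ?_]
    · refine integral_congr_ae ?_
      filter_upwards [hw] with x hx
      rw [hx]
    · rw [show fderiv ℝ φ x = 0 from image_eq_zero_of_notMem_tsupport
        fun hx' => hx (hs (tsupport_fderiv_subset ℝ hx'))]
      simp
  have h2 : ∫ x, ⟪g' x, e⟫_ℝ * φ x = ∫ x in K, ⟪g x, e⟫_ℝ * φ x := by
    rw [← setIntegral_eq_integral_of_forall_compl_eq_zero (s := K) fun x hx => ?_]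
    · refine integral_congr_ae ?_
      filter_upwards [hg] with x hx
      rw [hx]
    · rw [image_eq_zero_of_notMem_tsupport fun hx' => hx (hs hx'), mul_zero]
  rw [h1, h2, h.2 φ hφ hc hs e]

theorem isWeakGradient_of_dirDeriv {K : Set (Sp d)} {u w : Sp d → ℝ} {g : Sp d → Sp d}
    (hg : MemLp g 2) (hw : w =ᵐ[volume.restrict K] u)
    (h : ∀ e, DirDeriv K w (fun x => ⟪g x, e⟫_ℝ) e) : IsWeakGradient K u g := by
  refine ⟨hg.restrict K, fun φ hφ hc hs e => ?_⟩
  have h1 : ∫ x, w x * fderiv ℝ φ x e = ∫ x in K, u x * fderiv ℝ φ x e := by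
    rw [← setIntegral_eq_integral_of_forall_compl_eq_zero (s := K) fun x hx => ?_]
    · refine integral_congr_ae ?_
      filter_upwards [hw] with x hx
      rw [hx]
    · rw [show fderiv ℝ φ x = 0 from image_eq_zero_of_notMem_tsupport
        fun hx' => hx (hs (tsupport_fderiv_subset ℝ hx'))]
      simp
  have h2 : ∫ x, ⟪g x, e⟫_ℝ * φ x = ∫ x in K, ⟪g x, e⟫_ℝ * φ x := by
    rw [setIntegral_eq_integral_of_forall_compl_eq_zero]
    intro x hx
    rw [image_eq_zero_of_notMem_tsupport fun hx' => hx (hs hx'), mul_zero]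
  rw [← h1, ← h2, h e φ hφ hc hs]

theorem IsWeakGradient.mono {K Ω : Set (Sp d)} {u : Sp d → ℝ} {g : Sp d → Sp d}
    (h : IsWeakGradient Ω u g) (hK : K ⊆ Ω) : IsWeakGradient K u g := by
  refine ⟨h.1.mono_measure (Measure.restrict_mono_set _ hK), fun φ hφ hc hs e => ?_⟩
  have h0 : ∀ x, x ∉ K → fderiv ℝ φ x = 0 ∧ φ x = 0 := fun x hx =>
    ⟨image_eq_zero_of_notMem_tsupport fun hx' => hx (hs (tsupport_fderiv_subset ℝ hx')),
      image_eq_zero_of_notMem_tsupport fun hx' => hx (hs hx')⟩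
  have h1 : ∀ L : Set (Sp d), K ⊆ L → ∫ x in L, u x * fderiv ℝ φ x e
      = ∫ x, u x * fderiv ℝ φ x e := fun L hL =>
    setIntegral_eq_integral_of_forall_compl_eq_zero fun x hx => by
      simp [(h0 x fun h => hx (hL h)).1]
  have h2 : ∀ L : Set (Sp d), K ⊆ L → ∫ x in L, ⟪g x, e⟫_ℝ * φ x
      = ∫ x, ⟪g x, e⟫_ℝ * φ x := fun L hL =>
    setIntegral_eq_integral_of_forall_compl_eq_zero fun x hx => by
      simp [(h0 x fun h => hx (hL h)).2]
  rw [h1 K subset_rfl, h2 K subset_rfl, ← h1 Ω hK, ← h2 Ω hK]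
  exact h.2 φ hφ hc (hs.trans hK) e

theorem MemH1.mono {K Ω : Set (Sp d)} {u : Sp d → ℝ} (h : MemH1 Ω u) (hK : K ⊆ Ω) :
    MemH1 K u := by
  obtain ⟨h1, g, hg⟩ := h
  exact ⟨h1.mono_measure (Measure.restrict_mono_set _ hK), g, hg.mono hK⟩

theorem MemH1.isWeakGradient {K : Set (Sp d)} {u : Sp d → ℝ} (h : MemH1 K u) :
    IsWeakGradient K u (weakGradient K u) := by
  classical
  unfold weakGradient
  rw [dif_pos h.2]
  exact h.2.choose_spec

theorem IsPolytope.volume_ne_top {K : Set (Sp d)} (h : IsPolytope K) : volume K ≠ ⊤ :=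
  h.isBounded.measure_lt_top.ne

/-- A measurable vector field vanishing off `K` that agrees with `g` almost everywhere on `K`. -/
theorem exists_global_field {K : Set (Sp d)} (hK : MeasurableSet K) (ht : volume K ≠ ⊤)
    {g : Sp d → Sp d} (hg : MemLp g 2 (volume.restrict K)) :
    ∃ g' : Sp d → Sp d, Measurable g' ∧ (∀ x ∉ K, g' x = 0) ∧ MemLp g' 2 ∧ Integrable g' ∧
      g' =ᵐ[volume.restrict K] g := by
  have : IsFiniteMeasure (volume.restrict K) := ⟨by simpa using ht.lt_top⟩
  have hm := hg.1.stronglyMeasurable_mk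
  have he := hg.1.ae_eq_mk
  have h2 := hg.ae_eq he
  refine ⟨K.indicator (hg.1.mk g), hm.measurable.indicator hK,
    fun x hx => indicator_of_notMem hx _, (memLp_indicator_iff_restrict hK).2 h2,
    (integrable_indicator_iff hK).2 (h2.integrable one_le_two), ?_⟩
  exact (indicator_ae_eq_restrict hK).trans he.symm

theorem exists_isBrokenPair [Fintype ι] (hΩ : IsPolytope Ω) (T : Mesh Ω ι) (w : brokenH1 T) :
    ∃ g : Sp d → Sp d, IsBrokenPair T (Ω.indicator ((w : L2 Ω) : Sp d → ℝ)) g ∧ MemLp g 2 ∧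
      ∫⁻ x, ENNReal.ofReal (Ω.indicator ((w : L2 Ω) : Sp d → ℝ) x ^ 2 + ‖g x‖ ^ 2) ≤
        ENNReal.ofReal (brokenNorm T ((w : L2 Ω) : Sp d → ℝ) ^ 2) := by
  classical
  set u : Sp d → ℝ := ((w : L2 Ω) : Sp d → ℝ) with hu
  have hΩm := hΩ.isOpen.measurableSet
  have hum : Measurable u := (Lp.stronglyMeasurable (w : L2 Ω)).measurable
  have hu2 : MemLp u 2 (volume.restrict Ω) := Lp.memLp (w : L2 Ω)
  have hW : L1L2 (Ω.indicator u) := L1L2.indicator hΩm hΩ.volume_ne_top hum hu2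
  have hKm : ∀ i, MeasurableSet (T.cell i) := fun i => (T.isPolytope i).isOpen.measurableSet
  have hwg : ∀ i, IsWeakGradient (T.cell i) u (weakGradient (T.cell i) u) := fun i =>
    (w.2 i).isWeakGradient
  choose γ hγm hγ0 hγ2 hγi hγe using fun i =>
    exists_global_field (hKm i) (T.isPolytope i).volume_ne_top (hwg i).1
  let g : Sp d → Sp d := fun x => ∑ i, γ i x
  have hgcell : ∀ i, ∀ x ∈ T.cell i, g x = γ i x := fun i x hx =>
    Finset.sum_eq_single i (fun k _ hk => hγ0 k x fun hxk =>
      disjoint_left.1 (T.disjoint hk) hxk hx) (by simp)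
  have hgm : Measurable g := Finset.measurable_sum _ fun i _ => hγm i
  have hg2 : MemLp g 2 := memLp_finsetSum _ fun i _ => hγ2 i
  have hgi : Integrable g := integrable_finsetSum _ fun i _ => hγi i
  have hsq : ∀ x, ‖g x‖ ^ 2 = ∑ i, ‖γ i x‖ ^ 2 := by
    intro x
    by_cases hx : ∃ i, x ∈ T.cell i
    · obtain ⟨i, hi⟩ := hx
      rw [hgcell i x hi, Finset.sum_eq_single i (fun k _ hk => ?_) (by simp)]
      rw [hγ0 k x fun hxk => disjoint_left.1 (T.disjoint hk) hxk hi]; simp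
    · have h0 : ∀ i, γ i x = 0 := fun i => hγ0 i x fun h => hx ⟨i, h⟩
      simp [g, h0]
  refine ⟨g, ⟨hW, hgm, fun e => ⟨hgm.inner_const, hgi.inner_const e, hg2.inner_const e⟩,
    fun i e => (hwg i).dirDeriv ?_ ?_ e⟩, hg2, ?_⟩
  · exact (ae_restrict_mem (hKm i)).mono fun x hx => indicator_of_mem (T.subset i hx) _
  · filter_upwards [ae_restrict_mem (hKm i), hγe i] with x hx hx'
    rw [hgcell i x hx, hx']
  · have iW : Integrable fun x => Ω.indicator u x ^ 2 := hW.memLp.integrable_sq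
    have iγ : ∀ i, Integrable fun x => ‖γ i x‖ ^ 2 := fun i =>
      (hγ2 i).norm.integrable_sq
    have ig : Integrable fun x => ‖g x‖ ^ 2 := hg2.norm.integrable_sq
    have hint := ofReal_integral_eq_lintegral_ofReal
      (f := fun x => Ω.indicator u x ^ 2 + ‖g x‖ ^ 2) (iW.add ig)
      (Eventually.of_forall fun x => add_nonneg (sq_nonneg _) (sq_nonneg _))
    rw [← hint]
    refine ENNReal.ofReal_le_ofReal ?_
    have e1 : ∫ x, Ω.indicator u x ^ 2 = ∫ x in Ω, u x ^ 2 := by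
      rw [← integral_indicator hΩm]
      congr 1; funext x
      by_cases hx : x ∈ Ω <;> simp [hx]
    have e2 : ∀ i, ∫ x, ‖γ i x‖ ^ 2 = ∫ x in T.cell i, ‖weakGradient (T.cell i) u x‖ ^ 2 := by
      intro i
      rw [← setIntegral_eq_integral_of_forall_compl_eq_zero (s := T.cell i)
        fun x hx => by rw [hγ0 i x hx]; simp]
      refine integral_congr_ae ?_
      filter_upwards [hγe i] with x hx
      rw [hx]
    have hnn : 0 ≤ (∫ x in Ω, u x ^ 2) + ∑ i, ∫ x in T.cell i,
        ‖weakGradient (T.cell i) u x‖ ^ 2 :=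
      add_nonneg (integral_nonneg fun _ => sq_nonneg _)
        (Finset.sum_nonneg fun i _ => integral_nonneg fun _ => sq_nonneg _)
    rw [brokenNorm, Real.sq_sqrt hnn, integral_add iW ig, e1]
    simp only [hsq]
    rw [integral_finsetSum _ fun i _ => iγ i]
    simp only [e2]
    exact le_rfl

/-! ### Dependence of traces on the function and on the set -/

theorem eventually_average_congr {S : Set (Sp d)} {u v : Sp d → ℝ} {x : Sp d}
    {r : ℝ} (hr : 0 < r) (hsub : S ∩ Metric.ball x r ⊆ Ω) (h : u =ᵐ[volume.restrict Ω] v) :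
    (fun s : ℝ => ⨍ y in S ∩ Metric.ball x s, u y) =ᶠ[𝓝[>] 0]
      fun s : ℝ => ⨍ y in S ∩ Metric.ball x s, v y := by
  filter_upwards [Ioo_mem_nhdsGT hr] with s hs
  rw [setAverage_eq, setAverage_eq]
  congr 1
  exact integral_congr_ae (ae_restrict_of_ae_restrict_of_subset
    ((inter_subset_inter_right _ (Metric.ball_subset_ball hs.2.le)).trans hsub) h)

theorem HasTraceAt.congr_ae {S : Set (Sp d)} {u v : Sp d → ℝ} {x : Sp d}
    {r a : ℝ} (hr : 0 < r) (hsub : S ∩ Metric.ball x r ⊆ Ω) (h : u =ᵐ[volume.restrict Ω] v)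
    (hu : HasTraceAt S u x a) : HasTraceAt S v x a :=
  Tendsto.congr' (eventually_average_congr hr hsub h) hu

theorem trace_congr_ae {S : Set (Sp d)} {u v : Sp d → ℝ} {x : Sp d}
    {r : ℝ} (hr : 0 < r) (hsub : S ∩ Metric.ball x r ⊆ Ω) (h : u =ᵐ[volume.restrict Ω] v) :
    trace S u x = trace S v x := by
  unfold trace limUnder
  rw [Filter.map_congr (eventually_average_congr hr hsub h)]

theorem jump_congr_ae (hΩ : IsOpen Ω) {ν : Sp d → Sp d} {u v : Sp d → ℝ} {x : Sp d} (hx : x ∈ Ω)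
    (h : u =ᵐ[volume.restrict Ω] v) : jump ν u x = jump ν v x := by
  obtain ⟨r, hr, hrΩ⟩ := Metric.isOpen_iff.1 hΩ x hx
  rw [jump, jump, trace_congr_ae hr (inter_subset_right.trans hrΩ) h,
    trace_congr_ae hr (inter_subset_right.trans hrΩ) h]

theorem HasTraceAt.congr_set {S S' : Set (Sp d)} {u : Sp d → ℝ} {x : Sp d} {r a : ℝ} (hr : 0 < r)
    (h : S ∩ Metric.ball x r = S' ∩ Metric.ball x r) (hu : HasTraceAt S u x a) :
    HasTraceAt S' u x a := by
  refine Tendsto.congr' ?_ hu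
  filter_upwards [Ioo_mem_nhdsGT hr] with s hs
  have hb : Metric.ball x r ∩ Metric.ball x s = Metric.ball x s :=
    inter_eq_right.2 (Metric.ball_subset_ball hs.2.le)
  rw [← hb, ← inter_assoc, h, inter_assoc]

theorem HasTraceAt.add {S : Set (Sp d)} {u v : Sp d → ℝ} {x : Sp d} {r a b : ℝ} (hr : 0 < r)
    (hsub : S ∩ Metric.ball x r ⊆ Ω) (hui : IntegrableOn u Ω) (hvi : IntegrableOn v Ω)
    (hu : HasTraceAt S u x a) (hv : HasTraceAt S v x b) : HasTraceAt S (u + v) x (a + b) := by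
  refine Tendsto.congr' ?_ (Tendsto.add hu hv)
  filter_upwards [Ioo_mem_nhdsGT hr] with s hs
  have hss : S ∩ Metric.ball x s ⊆ Ω :=
    (inter_subset_inter_right _ (Metric.ball_subset_ball hs.2.le)).trans hsub
  simp only [setAverage_eq, Pi.add_apply]
  rw [integral_add (hui.mono_set hss) (hvi.mono_set hss), smul_add]

theorem HasTraceAt.const_smul {S : Set (Sp d)} {u : Sp d → ℝ} {x : Sp d} {a : ℝ} (c : ℝ)
    (hu : HasTraceAt S u x a) : HasTraceAt S (c • u) x (c * a) := by
  refine Tendsto.congr' (Eventually.of_forall fun s => ?_) (Tendsto.const_mul c hu)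
  simp only [setAverage_eq, Pi.smul_apply, smul_eq_mul]
  rw [integral_const_mul]
  ring

/-! ### Measurability of traces -/

theorem measurable_average_section {M : Set (Sp d × Sp d)} (hM : MeasurableSet M) {w : Sp d → ℝ}
    (hw : Measurable w) : Measurable fun x => ⨍ y in {y | (x, y) ∈ M}, w y := by
  simp only [setAverage_eq]
  have h1 : Measurable fun x : Sp d => volume.real {y | (x, y) ∈ M} :=
    (measurable_measure_prodMk_left hM).ennreal_toReal
  have h2 : Measurable fun x : Sp d => ∫ y in {y | (x, y) ∈ M}, w y := by
    have h3 : ∀ x : Sp d, ∫ y in {y | (x, y) ∈ M}, w y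
        = ∫ y, M.indicator (fun p => w p.2) (x, y) := by
      intro x
      have hm : MeasurableSet {y | (x, y) ∈ M} := measurable_prodMk_left hM
      rw [← integral_indicator hm]
      rfl
    simp only [h3]
    exact (StronglyMeasurable.integral_prod_right'
      ((hw.comp measurable_snd).indicator hM).stronglyMeasurable).measurable
  exact h1.inv.smul h2

theorem aestronglyMeasurable_trace {μ : Measure (Sp d)} {M : Set (Sp d × Sp d)}
    (hM : MeasurableSet M) {w : Sp d → ℝ} (hw : Measurable w)
    (h : ∀ᵐ x ∂μ, ∃ a, HasTraceAt {y | (x, y) ∈ M} w x a) :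
    AEStronglyMeasurable (fun x => trace {y | (x, y) ∈ M} w x) μ := by
  have hlim : Tendsto (fun k : ℕ => 1 / ((k : ℝ) + 1)) atTop (𝓝[>] 0) :=
    tendsto_nhdsWithin_iff.2 ⟨tendsto_one_div_add_atTop_nhds_zero_nat,
      Eventually.of_forall fun k => by simp only [mem_Ioi]; positivity⟩
  refine aestronglyMeasurable_of_tendsto_ae atTop (f := fun (k : ℕ) x =>
    ⨍ y in {y | (x, y) ∈ M} ∩ Metric.ball x (1 / ((k : ℝ) + 1)), w y) (fun k => ?_) ?_
  · have hm : MeasurableSet (M ∩ {p : Sp d × Sp d | dist p.2 p.1 < 1 / ((k : ℝ) + 1)}) :=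
      hM.inter (measurableSet_lt (by fun_prop) measurable_const)
    exact (measurable_average_section hm hw).aestronglyMeasurable
  · filter_upwards [h] with x hx
    obtain ⟨a, ha⟩ := hx
    rw [ha.trace_eq]
    exact Tendsto.comp ha hlim

theorem aestronglyMeasurable_jump {μ : Measure (Sp d)} {ν : Sp d → Sp d} (hν : Measurable ν)
    {w : Sp d → ℝ} (hw : Measurable w)
    (h : ∀ᵐ x ∂μ, ∃ a b, HasTraceAt (side (ν x) x) w x a ∧ HasTraceAt (side (-ν x) x) w x b) :
    AEStronglyMeasurable (jump ν w) μ := by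
  have key : ∀ n : Sp d → Sp d, Measurable n → (∀ᵐ x ∂μ, ∃ a, HasTraceAt (side (n x) x) w x a) →
      AEStronglyMeasurable (fun x => trace (side (n x) x) w x) μ := fun n hn hx =>
    aestronglyMeasurable_trace (M := {p | 0 < ⟪n p.1, p.2 - p.1⟫_ℝ})
      (measurableSet_lt measurable_const
        ((hn.comp measurable_fst).inner (measurable_snd.sub measurable_fst))) hw hx
  exact (key ν hν (h.mono fun x ⟨a, _, ha, _⟩ => ⟨a, ha⟩)).sub
    (key (fun x => -ν x) hν.neg (h.mono fun x ⟨_, b, _, hb⟩ => ⟨b, hb⟩))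

/-- The boundaries of the domain and of the cells of a mesh lie in finitely many walls. -/
theorem Mesh.exists_isArrangement [Finite ι] (hΩ : IsPolytope Ω) (T : Mesh Ω ι) :
    ∃ N : Finset (Sp d × ℝ), IsArrangement N ∧ frontier Ω ⊆ walls N ∧
      ∀ i, frontier (T.cell i) ⊆ walls N := by
  obtain ⟨N, hN, h⟩ := BrokenSobolev.exists_isArrangement (K := fun o : Option ι => o.elim Ω T.cell)
    (by rintro (_ | i); exacts [hΩ, T.isPolytope i])
  exact ⟨N, hN, h none, fun i => h (some i)⟩

/-- Broken Sobolev functions have one-sided traces, controlled in `L²` by the broken norm. -/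
theorem exists_traces (hd : 1 ≤ d) [Fintype ι] (hΩ : IsPolytope Ω) (T : Mesh Ω ι)
    {ν : Sp d → Sp d} (hν : IsUnitNormalField T.skeleton ν) {ΓD : Set (Sp d)}
    (hΓD : ΓD ⊆ frontier Ω) (hmeas : MeasurableSet ΓD) :
    ∃ C : ℝ≥0∞, C ≠ ⊤ ∧ ∀ w : brokenH1 T, ∃ B : Sp d → ℝ≥0∞,
      ∫⁻ x, B x ∂(Measure.euclideanHausdorffMeasure (d - 1) : Measure (Sp d)) ≤
        C * ENNReal.ofReal (brokenNorm T ((w : L2 Ω) : Sp d → ℝ) ^ 2) ∧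
      (∀ᵐ x ∂surface T.skeleton, ∃ a b,
        HasTraceAt (side (ν x) x) ((w : L2 Ω) : Sp d → ℝ) x a ∧
        HasTraceAt (side (-ν x) x) ((w : L2 Ω) : Sp d → ℝ) x b ∧
        ENNReal.ofReal (a ^ 2) ≤ B x ∧ ENNReal.ofReal (b ^ 2) ≤ B x) ∧
      ∀ᵐ x ∂surface ΓD, ∃ a, HasTraceAt Ω ((w : L2 Ω) : Sp d → ℝ) x a ∧
        ENNReal.ofReal (a ^ 2) ≤ B x := by
  obtain ⟨N, hN, hΩN, hTN⟩ := T.exists_isArrangement hΩ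
  obtain ⟨C, hC, hCB⟩ := exists_trace_bound hd T hN hTN
  refine ⟨C, hC, fun w => ?_⟩
  obtain ⟨g, hg, -, hgN⟩ := exists_isBrokenPair hΩ T w
  obtain ⟨B, -, hBC, hB⟩ := hCB _ g hg
  have hW : Ω.indicator ((w : L2 Ω) : Sp d → ℝ) =ᵐ[volume.restrict Ω] ((w : L2 Ω) : Sp d → ℝ) :=
    indicator_ae_eq_restrict hΩ.isOpen.measurableSet
  refine ⟨B, hBC.trans (mul_le_mul_right hgN C), ?_, ?_⟩
  · rw [surface, ae_restrict_iff' (T.measurableSet_skeleton hΩ.isOpen)]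
    filter_upwards [hB, hν.ae_mem hΩ.isOpen] with x hx hxν hxS
    have hn := hxν hxS
    obtain ⟨i, hi, r, hr, hri⟩ := T.exists_half_ball_of_mem_skeleton hΩ.isOpen hxS hn
    obtain ⟨k, hk, s, hs, hsk⟩ := T.exists_half_ball_of_mem_skeleton hΩ.isOpen hxS hn.neg
    obtain ⟨a, ha, hab⟩ := hx i hi _ hn.1 ⟨r, hr, hri⟩
    obtain ⟨b, hb, hbb⟩ := hx k hk _ hn.neg.1 ⟨s, hs, hsk⟩
    exact ⟨a, b, ha.congr_ae hr (hri.trans (T.subset i)) hW,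
      hb.congr_ae hs (hsk.trans (T.subset k)) hW, hab, hbb⟩
  · rw [surface, ae_restrict_iff' hmeas]
    filter_upwards [hB, hN.ae_isSimplePoint hd] with x hx hxs hxS
    obtain ⟨i, n, hn, hi, r, hr, hri, he⟩ :=
      T.exists_half_ball_of_mem_frontier hΩ hN hΩN hTN (hΓD hxS) hxs
    obtain ⟨a, ha, hab⟩ := hx i hi n hn ⟨r, hr, hri⟩
    exact ⟨a, (ha.congr_ae hr (hri.trans (T.subset i)) hW).congr_set hr he.symm, hab⟩

theorem eLpNorm_two_le {α : Type*} [MeasurableSpace α] {μ : Measure α} {f : α → ℝ} {b : ℝ}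
    (hb : 0 ≤ b) (h : ∫⁻ x, ENNReal.ofReal (f x ^ 2) ∂μ ≤ ENNReal.ofReal (b ^ 2)) :
    eLpNorm f 2 μ ≤ ENNReal.ofReal b := by
  rw [eLpNorm_eq_lintegral_rpow_enorm_toReal two_ne_zero ENNReal.ofNat_ne_top]
  have h1 : ∀ x, ‖f x‖ₑ ^ (ENNReal.toReal 2) = ENNReal.ofReal (f x ^ 2) := fun x => by
    rw [ENNReal.toReal_ofNat, ENNReal.rpow_ofNat, Real.enorm_eq_ofReal_abs,
      ← ENNReal.ofReal_pow (abs_nonneg _), sq_abs]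
  simp only [h1]
  refine (ENNReal.rpow_le_rpow h (by simp)).trans ?_
  rw [ENNReal.toReal_ofNat, ENNReal.ofReal_pow hb, one_div, ← ENNReal.rpow_natCast,
    ← ENNReal.rpow_mul]
  norm_num

/-- A family of functions that depends linearly, up to null sets, on a parameter and is bounded in
`L²` induces a bounded linear map to `L²`. -/
theorem exists_linearMap_Lp {V α : Type*} [AddCommGroup V] [Module ℝ V] [MeasurableSpace α]
    {μ : Measure α} {J : V → α → ℝ} {b : V → ℝ} {C : ℝ≥0∞} (hC : C ≠ ⊤) (hb : ∀ v, 0 ≤ b v)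
    (hm : ∀ v, AEStronglyMeasurable (J v) μ)
    (hJ : ∀ v, ∫⁻ x, ENNReal.ofReal (J v x ^ 2) ∂μ ≤ C * ENNReal.ofReal (b v ^ 2))
    (hadd : ∀ u v, J (u + v) =ᵐ[μ] J u + J v) (hsmul : ∀ (c : ℝ) v, J (c • v) =ᵐ[μ] c • J v) :
    (∀ v, MemLp (J v) 2 μ) ∧ ∃ L : V →ₗ[ℝ] Lp ℝ 2 μ, ∃ c : ℝ, 0 ≤ c ∧ (∀ v, L v =ᵐ[μ] J v) ∧
      ∀ v, ‖L v‖ ≤ c * b v := by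
  have hle : ∀ v, eLpNorm (J v) 2 μ ≤ ENNReal.ofReal (√C.toReal * b v) := fun v => by
    refine eLpNorm_two_le (mul_nonneg (Real.sqrt_nonneg _) (hb v)) ((hJ v).trans_eq ?_)
    rw [mul_pow, Real.sq_sqrt ENNReal.toReal_nonneg, ENNReal.ofReal_mul ENNReal.toReal_nonneg,
      ENNReal.ofReal_toReal hC]
  have hL : ∀ v, MemLp (J v) 2 μ := fun v => ⟨hm v, (hle v).trans_lt ENNReal.ofReal_lt_top⟩
  refine ⟨hL, ⟨⟨fun v => (hL v).toLp, fun u v => ?_⟩, fun c v => ?_⟩, √C.toReal,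
    Real.sqrt_nonneg _, fun v => (hL v).coeFn_toLp, fun v => ?_⟩
  · rw [← MemLp.toLp_add]
    exact MemLp.toLp_congr _ _ (hadd u v)
  · exact (MemLp.toLp_congr (hL (c • v)) ((hL v).const_smul c) (hsmul c v)).trans
      (MemLp.toLp_const_smul c (hL v))
  · change ‖(hL v).toLp‖ ≤ _
    rw [Lp.norm_toLp]
    exact ENNReal.toReal_le_of_le_ofReal (mul_nonneg (Real.sqrt_nonneg _) (hb v)) (hle v)

theorem integrableOn_coeFn (hΩ : IsPolytope Ω) (u : L2 Ω) : IntegrableOn (u : Sp d → ℝ) Ω := by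
  have : IsFiniteMeasure (volume.restrict Ω) := ⟨by simpa using hΩ.volume_ne_top.lt_top⟩
  exact (Lp.memLp u).integrable one_le_two

theorem HasTraceAt.coeFn_add (hΩ : IsPolytope Ω) {S : Set (Sp d)} {x : Sp d} {r a b : ℝ}
    (hr : 0 < r) (hsub : S ∩ Metric.ball x r ⊆ Ω) {u v : L2 Ω} (hu : HasTraceAt S u x a)
    (hv : HasTraceAt S v x b) : HasTraceAt S ((u + v : L2 Ω) : Sp d → ℝ) x (a + b) :=
  (hu.add hr hsub (integrableOn_coeFn hΩ u) (integrableOn_coeFn hΩ v) hv).congr_ae hr hsub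
    (Lp.coeFn_add u v).symm

theorem HasTraceAt.coeFn_smul {S : Set (Sp d)} {x : Sp d} {r a : ℝ} (c : ℝ)
    (hr : 0 < r) (hsub : S ∩ Metric.ball x r ⊆ Ω) {u : L2 Ω} (hu : HasTraceAt S u x a) :
    HasTraceAt S ((c • u : L2 Ω) : Sp d → ℝ) x (c * a) :=
  (hu.const_smul c).congr_ae hr hsub (Lp.coeFn_smul c u).symm

theorem brokenNorm_nonneg [Fintype ι] (T : Mesh Ω ι) (w : Sp d → ℝ) : 0 ≤ brokenNorm T w :=
  Real.sqrt_nonneg _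

/-- The jump as a bounded linear map. -/
theorem exists_jump_linearMap (hd : 1 ≤ d) [Fintype ι] (hΩ : IsPolytope Ω) (T : Mesh Ω ι)
    {ν : Sp d → Sp d} (hν : IsUnitNormalField T.skeleton ν) :
    (∀ w : brokenH1 T, MemLp (jump ν ((w : L2 Ω) : Sp d → ℝ)) 2 (surface T.skeleton)) ∧
      ∃ L : brokenH1 T →ₗ[ℝ] Lp ℝ 2 (surface T.skeleton), ∃ c : ℝ, 0 ≤ c ∧
        (∀ w : brokenH1 T, L w =ᵐ[surface T.skeleton] jump ν ((w : L2 Ω) : Sp d → ℝ)) ∧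
        ∀ w : brokenH1 T, ‖L w‖ ≤ c * brokenNorm T ((w : L2 Ω) : Sp d → ℝ) := by
  obtain ⟨C, hC, h⟩ := exists_traces hd hΩ T hν (empty_subset (frontier Ω)) MeasurableSet.empty
  have hmem : ∀ᵐ x ∂surface T.skeleton, x ∈ Ω :=
    (ae_restrict_mem (T.measurableSet_skeleton hΩ.isOpen)).mono fun x hx => hx.1
  refine exists_linearMap_Lp (C := 4 * C) (by finiteness)
    (fun w => brokenNorm_nonneg T ((w : L2 Ω) : Sp d → ℝ)) (fun w => ?_) (fun w => ?_)
    (fun u v => ?_) fun c w => ?_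
  · obtain ⟨B, -, hB, -⟩ := h w
    exact aestronglyMeasurable_jump hν.1 (Lp.stronglyMeasurable (w : L2 Ω)).measurable
      (hB.mono fun x ⟨a, b, ha, hb, _⟩ => ⟨a, b, ha, hb⟩)
  · obtain ⟨B, hBC, hB, -⟩ := h w
    have h1 : ∫⁻ x, ENNReal.ofReal (jump ν ((w : L2 Ω) : Sp d → ℝ) x ^ 2) ∂surface T.skeleton
        ≤ ∫⁻ x, 4 * B x ∂surface T.skeleton := by
      refine lintegral_mono_ae (hB.mono fun x ⟨a, b, ha, hb, hab, hbb⟩ => ?_)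
      rw [jump_eq ha hb]
      calc ENNReal.ofReal ((a - b) ^ 2) ≤ ENNReal.ofReal (2 * a ^ 2 + 2 * b ^ 2) :=
            ENNReal.ofReal_le_ofReal (by nlinarith [sq_nonneg (a + b)])
        _ = 2 * ENNReal.ofReal (a ^ 2) + 2 * ENNReal.ofReal (b ^ 2) := by
            rw [ENNReal.ofReal_add (by positivity) (by positivity),
              ENNReal.ofReal_mul zero_le_two, ENNReal.ofReal_mul zero_le_two]
            simp
        _ ≤ 2 * B x + 2 * B x := by gcongr
        _ = 4 * B x := by rw [← add_mul]; norm_num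
    rw [lintegral_const_mul' _ _ (by simp)] at h1
    rw [mul_assoc]
    exact h1.trans (mul_le_mul_right ((setLIntegral_le_lintegral _ _).trans hBC) 4)
  · obtain ⟨_, -, hu, -⟩ := h u
    obtain ⟨_, -, hv, -⟩ := h v
    filter_upwards [hu, hv, hmem] with x ⟨a, b, ha, hb, _⟩ ⟨a', b', ha', hb', _⟩ hx
    obtain ⟨r, hr, hrΩ⟩ := Metric.isOpen_iff.1 hΩ.isOpen x hx
    rw [Pi.add_apply, Submodule.coe_add, jump_eq ha hb, jump_eq ha' hb',
      jump_eq (ha.coeFn_add hΩ hr (inter_subset_right.trans hrΩ) ha')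
        (hb.coeFn_add hΩ hr (inter_subset_right.trans hrΩ) hb')]
    ring
  · obtain ⟨_, -, hw, -⟩ := h w
    filter_upwards [hw, hmem] with x ⟨a, b, ha, hb, _⟩ hx
    obtain ⟨r, hr, hrΩ⟩ := Metric.isOpen_iff.1 hΩ.isOpen x hx
    rw [Pi.smul_apply, Submodule.coe_smul, jump_eq ha hb,
      jump_eq (ha.coeFn_smul c hr (inter_subset_right.trans hrΩ))
        (hb.coeFn_smul c hr (inter_subset_right.trans hrΩ)), smul_eq_mul]
    ring

/-- The trace on the Dirichlet boundary as a bounded linear map. -/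
theorem exists_trace_linearMap (hd : 1 ≤ d) [Fintype ι] (hΩ : IsPolytope Ω) (T : Mesh Ω ι)
    {ν : Sp d → Sp d} (hν : IsUnitNormalField T.skeleton ν) {ΓD : Set (Sp d)}
    (hΓD : ΓD ⊆ frontier Ω) (hmeas : MeasurableSet ΓD) :
    (∀ w : brokenH1 T, MemLp (trace Ω ((w : L2 Ω) : Sp d → ℝ)) 2 (surface ΓD)) ∧
      ∃ L : brokenH1 T →ₗ[ℝ] Lp ℝ 2 (surface ΓD), ∃ c : ℝ, 0 ≤ c ∧
        (∀ w : brokenH1 T, L w =ᵐ[surface ΓD] trace Ω ((w : L2 Ω) : Sp d → ℝ)) ∧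
        ∀ w : brokenH1 T, ‖L w‖ ≤ c * brokenNorm T ((w : L2 Ω) : Sp d → ℝ) := by
  obtain ⟨C, hC, h⟩ := exists_traces hd hΩ T hν hΓD hmeas
  refine exists_linearMap_Lp hC
    (fun w => brokenNorm_nonneg T ((w : L2 Ω) : Sp d → ℝ)) (fun w => ?_) (fun w => ?_)
    (fun u v => ?_) fun c w => ?_
  · obtain ⟨B, -, -, hB⟩ := h w
    exact aestronglyMeasurable_trace (M := {p | p.2 ∈ Ω})
      (measurable_snd hΩ.isOpen.measurableSet) (Lp.stronglyMeasurable (w : L2 Ω)).measurable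
      (hB.mono fun x ⟨a, ha, _⟩ => ⟨a, ha⟩)
  · obtain ⟨B, hBC, -, hB⟩ := h w
    refine (lintegral_mono_ae (hB.mono fun x ⟨a, ha, hab⟩ => ?_)).trans
      ((setLIntegral_le_lintegral ΓD B).trans hBC)
    rwa [ha.trace_eq]
  · obtain ⟨_, -, -, hu⟩ := h u
    obtain ⟨_, -, -, hv⟩ := h v
    filter_upwards [hu, hv] with x ⟨a, ha, _⟩ ⟨a', ha', _⟩
    rw [Pi.add_apply, ha.trace_eq, ha'.trace_eq]
    exact (ha.coeFn_add hΩ one_pos inter_subset_left ha').trace_eq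
  · obtain ⟨_, -, -, hw⟩ := h w
    filter_upwards [hw] with x ⟨a, ha, _⟩
    rw [Pi.smul_apply, ha.trace_eq]
    exact (ha.coeFn_smul c one_pos inter_subset_left).trace_eq

/-- The form `d` induces an operator from the broken space to its dual, with kernel `V^c_0`. -/
theorem exists_operator (hd : 1 ≤ d) [Fintype ι] (hΩ : IsPolytope Ω) (T : Mesh Ω ι)
    {ν : Sp d → Sp d} (hν : IsUnitNormalField T.skeleton ν) {ΓD : Set (Sp d)}
    (hΓD : ΓD ⊆ frontier Ω) (hmeas : MeasurableSet ΓD) :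
    ∃ D : brokenH1 T →ₗ[ℝ] brokenDual T,
      (∀ u v : brokenH1 T, (D u : Module.Dual ℝ (brokenH1 T)) v
        = dForm T ν ΓD ((u : L2 Ω) : Sp d → ℝ) ((v : L2 Ω) : Sp d → ℝ)) ∧
      (LinearMap.ker D : Set (brokenH1 T)) = admissible T ν ΓD := by
  obtain ⟨-, L, c, hc, hL, hLc⟩ := exists_jump_linearMap hd hΩ T hν
  obtain ⟨-, M, c', hc', hM, hMc⟩ := exists_trace_linearMap hd hΩ T hν hΓD hmeas
  let A : brokenH1 T →ₗ[ℝ] brokenH1 T →ₗ[ℝ] ℝ :=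
    LinearMap.mk₂ ℝ (fun u v => ⟪L u, L v⟫_ℝ + ⟪M u, M v⟫_ℝ)
      (fun u u' v => by simp only [map_add, inner_add_left]; ring)
      (fun a u v => by simp only [map_smul, real_inner_smul_left, smul_eq_mul]; ring)
      (fun u v v' => by simp only [map_add, inner_add_right]; ring)
      (fun a u v => by simp only [map_smul, real_inner_smul_right, smul_eq_mul]; ring)
  have hA : ∀ u v, A u v = ⟪L u, L v⟫_ℝ + ⟪M u, M v⟫_ℝ := fun u v => rfl
  have hbd : ∀ u, A u ∈ brokenDual T := fun u => by
    refine ⟨‖L u‖ * c + ‖M u‖ * c', fun v => ?_⟩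
    rw [hA, add_mul, mul_assoc, mul_assoc]
    exact (abs_add_le _ _).trans (add_le_add
      ((abs_real_inner_le_norm _ _).trans (mul_le_mul_of_nonneg_left (hLc v) (norm_nonneg _)))
      ((abs_real_inner_le_norm _ _).trans (mul_le_mul_of_nonneg_left (hMc v) (norm_nonneg _))))
  refine ⟨A.codRestrict (brokenDual T) hbd, fun u v => ?_, ?_⟩
  · rw [LinearMap.codRestrict_apply, hA, L2.inner_def, L2.inner_def, dForm]
    congr 1
    · refine integral_congr_ae ?_
      filter_upwards [hL u, hL v] with x hx hy
      simp [hx, hy, mul_comm]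
    · refine integral_congr_ae ?_
      filter_upwards [hM u, hM v] with x hx hy
      simp [hx, hy, mul_comm]
  · ext u
    rw [LinearMap.ker_codRestrict, SetLike.mem_coe, LinearMap.mem_ker]
    have hL0 : L u = 0 ↔ ∀ᵐ x ∂surface T.skeleton, jump ν ((u : L2 Ω) : Sp d → ℝ) x = 0 := by
      rw [Lp.eq_zero_iff_ae_eq_zero]
      exact ⟨fun h => (hL u).symm.trans h, fun h => (hL u).trans h⟩
    have hM0 : M u = 0 ↔ ∀ᵐ x ∂surface ΓD, trace Ω ((u : L2 Ω) : Sp d → ℝ) x = 0 := by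
      rw [Lp.eq_zero_iff_ae_eq_zero]
      exact ⟨fun h => (hM u).symm.trans h, fun h => (hM u).trans h⟩
    change _ ↔ (_ ∧ _)
    rw [← hL0, ← hM0]
    constructor
    · intro h
      have h1 := hA u u
      rw [h, LinearMap.zero_apply] at h1
      have h2 : 0 ≤ ⟪L u, L u⟫_ℝ := real_inner_self_nonneg
      have h3 : 0 ≤ ⟪M u, M u⟫_ℝ := real_inner_self_nonneg
      exact ⟨inner_self_eq_zero (𝕜 := ℝ).1 (by linarith),
        inner_self_eq_zero (𝕜 := ℝ).1 (by linarith)⟩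
    · rintro ⟨h1, h2⟩
      ext v
      rw [hA, h1, h2]
      simp

/-- Without jumps and with zero trace, a broken Sobolev function is a Sobolev function. -/
theorem image_admissible (hd : 1 ≤ d) [Fintype ι] (hΩ : IsPolytope Ω) (T : Mesh Ω ι)
    {ν : Sp d → Sp d} (hν : IsUnitNormalField T.skeleton ν) (ΓD : Set (Sp d)) :
    Subtype.val '' admissible T ν ΓD = H10 Ω ΓD := by
  obtain ⟨N, hN, -, hTN⟩ := T.exists_isArrangement hΩ
  have hΩm := hΩ.isOpen.measurableSet
  have hmem : ∀ᵐ x ∂surface T.skeleton, x ∈ Ω :=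
    (ae_restrict_mem (T.measurableSet_skeleton hΩ.isOpen)).mono fun x hx => hx.1
  have hW : ∀ u : L2 Ω, Ω.indicator (u : Sp d → ℝ) =ᵐ[volume.restrict Ω] u := fun u =>
    indicator_ae_eq_restrict hΩm
  have hj : ∀ u : L2 Ω, (∀ᵐ x ∂surface T.skeleton, jump ν u x = 0) ↔
      ∀ᵐ x ∂surface T.skeleton, jump ν (Ω.indicator (u : Sp d → ℝ)) x = 0 := fun u =>
    eventually_congr (hmem.mono fun x hx => by rw [jump_congr_ae hΩ.isOpen hx (hW u)])
  ext u
  constructor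
  · rintro ⟨w, ⟨hwj, hwt⟩, rfl⟩
    obtain ⟨g, hg, hg2, -⟩ := exists_isBrokenPair hΩ T w
    exact ⟨⟨Lp.memLp _, g, isWeakGradient_of_dirDeriv hg2 (hW w)
      (hg.dirDeriv_of_jump_eq_zero hd hΩ.isOpen hN hTN hν ((hj w).1 hwj))⟩, hwt⟩
  · rintro ⟨hu, hut⟩
    refine ⟨⟨u, fun i => hu.mono (T.subset i)⟩, ⟨(hj u).2 ?_, hut⟩, rfl⟩
    obtain ⟨hu2, g, hg⟩ := hu
    obtain ⟨g', hgm, -, hg2, hgi, hge⟩ := exists_global_field hΩm hΩ.volume_ne_top hg.1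
    exact ae_jump_eq_zero hd hΩ.isOpen hN hTN hν
      (L1L2.indicator hΩm hΩ.volume_ne_top (Lp.stronglyMeasurable u).measurable hu2)
      (fun e => ⟨hgm.inner_const, hgi.inner_const e, hg2.inner_const e⟩)
      fun e => hg.dirDeriv (hW u) hge e

end BrokenSobolev

end

/-- The traces in the definition of `d` exist and are square integrable; `d` induces a linear
operator `D : V → V*`; its kernel is `V^c_0`; and `V^c_0`, as a subset of `L²(Ω)`, is the space of
the functions of `H¹(Ω)` that vanish on `ΓD`. -/
theorem mainTheorem2 {d : ℕ} (hd : 1 ≤ d) {ι : Type*} [Fintype ι]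
    {Ω : Set (BrokenSobolev.Sp d)} (hΩ : BrokenSobolev.IsPolytope Ω)
    (T : BrokenSobolev.Mesh Ω ι)
    (ν : BrokenSobolev.Sp d → BrokenSobolev.Sp d)
    (hν : BrokenSobolev.IsUnitNormalField T.skeleton ν)
    (ΓD : Set (BrokenSobolev.Sp d)) (hΓD : ΓD ⊆ frontier Ω) (hmeas : MeasurableSet ΓD) :
    (∀ w : BrokenSobolev.brokenH1 T,
      (∀ᵐ x ∂BrokenSobolev.surface T.skeleton,
        (∃ a, BrokenSobolev.HasTraceAt (BrokenSobolev.side (ν x) x) w x a) ∧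
        (∃ b, BrokenSobolev.HasTraceAt (BrokenSobolev.side (-ν x) x) w x b)) ∧
      MemLp (BrokenSobolev.jump ν w) 2 (BrokenSobolev.surface T.skeleton) ∧
      (∀ᵐ x ∂BrokenSobolev.surface ΓD, ∃ a, BrokenSobolev.HasTraceAt Ω w x a) ∧
      MemLp (BrokenSobolev.trace Ω w) 2 (BrokenSobolev.surface ΓD)) ∧
    (∃ D : BrokenSobolev.brokenH1 T →ₗ[ℝ] BrokenSobolev.brokenDual T,
      (∀ u v : BrokenSobolev.brokenH1 T,
        (D u : Module.Dual ℝ (BrokenSobolev.brokenH1 T)) v = BrokenSobolev.dForm T ν ΓD u v) ∧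
      (LinearMap.ker D : Set (BrokenSobolev.brokenH1 T)) = BrokenSobolev.admissible T ν ΓD) ∧
    Subtype.val '' BrokenSobolev.admissible T ν ΓD = BrokenSobolev.H10 Ω ΓD := by
  refine ⟨fun w => ?_, BrokenSobolev.exists_operator hd hΩ T hν hΓD hmeas,
    BrokenSobolev.image_admissible hd hΩ T hν ΓD⟩
  obtain ⟨_, -, h⟩ := BrokenSobolev.exists_traces hd hΩ T hν hΓD hmeas
  obtain ⟨_, -, hj, ht⟩ := h w
  exact ⟨hj.mono fun _ ⟨a, b, ha, hb, _⟩ => ⟨⟨a, ha⟩, ⟨b, hb⟩⟩,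
    (BrokenSobolev.exists_jump_linearMap hd hΩ T hν).1 w,
    ht.mono fun _ ⟨a, ha, _⟩ => ⟨a, ha⟩,
    (BrokenSobolev.exists_trace_linearMap hd hΩ T hν hΓD hmeas).1 w⟩
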